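/- Fix a real number $t$ with $0\le t<1$. **Signatures.** $\mathrm{Sig}_N$ ($N\ge 0$) is the set of sequences of integers $\lambda=(\lambda_1\ge\dots\ge\lambda_N)$; put $|\lambda|=\lambda_1+\dots+\lambda_N$, $-\lambda=(-\lambda_N,\dots,-\lambda_1)$, $\lambda_0=+\infty$ and $\lambda_k=-\infty$ for $k>N$. For $\mu\in\mathrm{Sig}_N$ and $\lambda\in\mathrm{Sig}_{N-1}$ or $\lambda\in\mathrm{Sig}_N$ write $\lambda\prec\mu$ if $\mu_{k+1}\le\lambda_k\le\mu_k$ for all $k\ge1$, and set $$\psi_{\mu/\lambda}=\mathbf 1_{\lambda\prec\mu}\prod_{1\le k\le j\le N:\ \mu_{j+1}<\lambda_j=\lambda_k<\mu_k}(1-t^{j-k+1}),\qquad \phi_{\mu/\lambda}=\mathbf 1_{\lambda\prec\mu}\prod_{1\le k\le j\le N:\ \lambda_j<\mu_j=\mu_k<\lambda_{k-1}}(1-t^{j-k+1}).$$ **The coefficients $U$.** Let $\lambda,\mu,\nu,\rho\in\mathrm{Sig}_N$. Put $U(\mu\to\rho\mid\lambda\to\nu)=0$ unless $\lambda\prec\nu\prec\rho$,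 $\lambda\prec\mu\prec\rho$ and $|\nu|-|\lambda|=|\rho|-|\mu|$. In that case let $m=|\nu|-|\lambda|$, $n=|\mu|-|\lambda|$. Regard a signature as a configuration of particles at its coordinates. An *admissible function* assigns $\Lambda(i,j)\in\mathrm{Sig}_N$ to the integer points of $[0,m]\times[0,n]$ so that $\Lambda(0,0)=\lambda$, $\Lambda(m,0)=\nu$, $\Lambda(0,n)=\mu$, $\Lambda(m,n)=\rho$; $\Lambda(i+1,j)$ (resp. $\Lambda(i,j+1)$) arises from $\Lambda(i,j)$ by moving one particle from a position $h_{i,j}$ to $h_{i,j}+1$ (resp. from $v_{i,j}$ to $v_{i,j}+1$); $h_{i,j}<h_{i+1,j}$ and $v_{i,j}<v_{i,j+1}$; and whenever $h_{i,j}=v_{i,j}=k$, then $h_{i,j+1}=v_{i+1,j}\in\{k,k+1\}$. There is at most one such function. If there is none, put $U(\mu\to\rho\mid\lambda\to\nu)=0$; otherwise $U(\mu\to\rho\mid\lambda\to\nu)=\prod_{0\le i<m,\,0\le j<n}w(b_{i,j})$, where $b_{i,j}$ is the unit box with south-western corner $(i,j)$. The box is *trivial* if $h_{i,j}=h_{i,j+1}\ne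 v_{i,j}=v_{i+1,j}$, a *zero-box* if $h_{i,j}=v_{i,j}=h_{i,j+1}=v_{i+1,j}$, a *one-box* if $h_{i,j}=v_{i,j}=h_{i,j+1}-1=v_{i+1,j}-1$; boxes outside the rectangle count as trivial, and $h_{-1,j}=v_{i,-1}=-\infty$. For a non-trivial $B=b_{i,j}$ let $r=h_{i,j}$ and let $c=t^{a}$, where $a$ is the number of coordinates of $\Lambda(i,j)$ equal to $r$. The weights are: * $w(B)=1$ if $B$ is trivial; or $B$ is a one-box and $b_{i-1,j}$ or $b_{i,j-1}$ is a one-box; or $b_{i-1,j-1}$ is of the same kind (zero or one) as $B$ and $h_{i-1,j}=r-1$; * $w(B)=0$ if one of $B$, $b_{i-1,j-1}$ is a zero-box, the other one a one-box, and $h_{i-1,j}=v_{i,j-1}=r-1$; * $w(B)=t$ if $B$ is a zero-box and exactly one of $h_{i-1,j},v_{i,j-1}$ equals $r-1$; * $w(B)=1-t$ if $B$ is a one-box, $b_{i-1,j}$ and $b_{i,j-1}$ are trivial, and exactly one of $h_{i-1,j},v_{i,j-1}$ equals $r-1$; * if $h_{i-1,j}<r-1$ and $v_{i,j-1}<r-1$: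 $w(B)=\frac{t-c}{1-c}$ for a zero-box, $w(B)=\frac{1-t}{1-c}$ for a one-box. **The coefficients with input.** Let $N\ge1$, $\mu,\rho\in\mathrm{Sig}_N$, $\lambda,\nu\in\mathrm{Sig}_{N-1}$, $r\in\mathbb Z_{\ge0}$, and let $V$ be an integer such that $-V$ is strictly smaller than all coordinates of $\mu$ and $\nu$. If $\lambda\prec\mu\prec\rho$, $\lambda\prec\nu\prec\rho$ and $|\rho|-|\mu|=|\nu|-|\lambda|+r$, let $\tilde\nu=\nu\cup\{-V\}$, $\tilde\lambda=\lambda\cup\{-V-r\}$ and $$U^r(\mu\to\rho\mid\lambda\to\nu)=U(\mu\to\rho\mid\tilde\lambda\to\tilde\nu),\qquad \hat U^r(\nu\to\lambda\mid\rho\to\mu)=U(-\tilde\nu\to-\tilde\lambda\mid-\rho\to-\mu);$$ otherwise both are $0$. The statements below hold for every such choice of $V$. **Statement I.** Let $N\ge0$; all signatures are in $\mathrm{Sig}_N$. 1. All $U$ are nonnegative in the following sums, which have finitely many nonzero terms: if $\lambda\prec\mu$ and $\lambda\prec\nu$, then $\sum_\rho U(\mu\to\rho\mid\lambda\to\nu)=1$;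 if $\mu\prec\rho$ and $\nu\prec\rho$, then $\sum_\lambda U(-\nu\to-\lambda\mid-\rho\to-\mu)=1$. 2. For all $\lambda,\mu,\nu,\rho$: $\ \phi_{\nu/\lambda}\psi_{\mu/\lambda}U(\mu\to\rho\mid\lambda\to\nu)=\psi_{\rho/\nu}\phi_{\rho/\mu}U(-\nu\to-\lambda\mid-\rho\to-\mu)$. 3. For $\mu,\nu$ and $k,l\in\mathbb Z$ let $L=\{\lambda:\lambda\prec\mu,\ \lambda\prec\nu,\ |\mu|-|\lambda|=k,\ |\nu|-|\lambda|=l\}$ and $R=\{\rho:\mu\prec\rho,\ \nu\prec\rho,\ |\rho|-|\nu|=k,\ |\rho|-|\mu|=l\}$. These sets are finite and $$\sum_{\lambda\in L}\phi_{\nu/\lambda}\psi_{\mu/\lambda}=\sum_{\lambda\in L}\phi_{\nu/\lambda}\psi_{\mu/\lambda}\sum_\rho U(\mu\to\rho\mid\lambda\to\nu)=\sum_{\rho\in R}\psi_{\rho/\nu}\phi_{\rho/\mu}\sum_\lambda U(-\nu\to-\lambda\mid-\rho\to-\mu)=\sum_{\rho\in R}\psi_{\rho/\nu}\phi_{\rho/\mu}.$$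 The two double sums agree term by term: their terms with the same $(\lambda,\rho)$ are equal by 2, and if $\lambda\in L$ and $U(\mu\to\rho\mid\lambda\to\nu)\ne0$, then $\rho\in R$; if $\rho\in R$ and $U(-\nu\to-\lambda\mid-\rho\to-\mu)\ne0$, then $\lambda\in L$. **Statement II.** Let $N\ge1$, $\mu\in\mathrm{Sig}_N$, $\nu\in\mathrm{Sig}_{N-1}$; $\lambda$ ranges over $\mathrm{Sig}_{N-1}$, $\rho$ over $\mathrm{Sig}_N$ and $r$ over $\mathbb Z_{\ge0}$. 1. All coefficients are nonnegative in the following sums, which have finitely many nonzero terms: if $\lambda\prec\mu$ and $\lambda\prec\nu$, then $\sum_\rho U^r(\mu\to\rho\mid\lambda\to\nu)=1$ for every $r$; if $\mu\prec\rho$ and $\nu\prec\rho$, then $\sum_{\lambda,r}\hat U^r(\nu\to\lambda\mid\rho\to\mu)=1$. 2. For all $\lambda,\rho,r$: $\ (1-t\mathbf 1_{r\ge1})\,\phi_{\nu/\lambda}\psi_{\mu/\lambda}U^r(\mu\to\rho\mid\lambda\to\nu)=\psi_{\rho/\nu}\phi_{\rho/\mu}\hat U^r(\nu\to\lambda\mid\rho\to\mu)$.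 3. For $k,l\in\mathbb Z$ let $L_r=\{\lambda:\lambda\prec\mu,\ \lambda\prec\nu,\ |\mu|-|\lambda|=k-r,\ |\nu|-|\lambda|=l-r\}$ and $R=\{\rho:\mu\prec\rho,\ \nu\prec\rho,\ |\rho|-|\nu|=k,\ |\rho|-|\mu|=l\}$. Then $R$ and $\{(r,\lambda):\lambda\in L_r\}$ are finite and $$\sum_{r\ge0}(1-t\mathbf 1_{r\ge1})\sum_{\lambda\in L_r}\phi_{\nu/\lambda}\psi_{\mu/\lambda}=\sum_{r\ge0}(1-t\mathbf 1_{r\ge1})\sum_{\lambda\in L_r}\phi_{\nu/\lambda}\psi_{\mu/\lambda}\sum_\rho U^r(\mu\to\rho\mid\lambda\to\nu)$$ $$=\sum_{\rho\in R}\psi_{\rho/\nu}\phi_{\rho/\mu}\sum_{\lambda,r}\hat U^r(\nu\to\lambda\mid\rho\to\mu)=\sum_{\rho\in R}\psi_{\rho/\nu}\phi_{\rho/\mu}.$$ Again the two multiple sums agree term by term: equal terms by 2, and if $\lambda\in L_r$ and $U^r(\mu\to\rho\mid\lambda\to\nu)\neq0$, then $\rho\in R$; if $\rho\in R$ and $\hat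 U^r(\nu\to\lambda\mid\rho\to\mu)\ne0$, then $\lambda\in L_r$. 4. One has $$\sum_{\rho:\,\mu\prec\rho,\,\nu\prec\rho}\psi_{\rho/\nu}\phi_{\rho/\mu}\,x^{|\rho|-|\nu|}y^{|\rho|-|\mu|}=\sum_{r\ge0}(1-t\mathbf 1_{r\ge1})(xy)^r\sum_{\lambda:\,\lambda\prec\mu,\,\lambda\prec\nu}\phi_{\nu/\lambda}\psi_{\mu/\lambda}\,x^{|\mu|-|\lambda|}y^{|\nu|-|\lambda|}\sum_{\substack{\rho:\,\mu\prec\rho,\,\nu\prec\rho\\ |\rho|-|\mu|=|\nu|-|\lambda|+r}}U^r(\mu\to\rho\mid\lambda\to\nu),$$ both for formal $x,y$ (the coefficients of $x^ky^l$ on the two sides are equal for all $k,l\in\mathbb Z$) and for all nonzero real $x,y$ with $|xy|<1$ (both series, over $\rho$ and over $r$, converge absolutely and have the same sum; the sum over $\lambda$ is finite). -/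

import Mathlib

namespace HallLittlewood

/-- Signatures of length `N`: non-increasing sequences of `N` integers. The
one-based coordinate `κ_k` is `κ.1` at the index `k - 1`; see `part`. -/
abbrev Sig (N : ℕ) : Type := {κ : Fin N → ℤ // Antitone κ}

/-- `|κ|`, the sum of the coordinates. -/
def size {N : ℕ} (κ : Sig N) : ℤ := ∑ i, κ.1 i

/-- One-based coordinates `κ_k` with the conventions `κ_0 = +∞` and `κ_k = -∞` for `k > N`. -/
def part {N : ℕ} (κ : Sig N) (k : ℕ) : WithBot (WithTop ℤ) :=
  if k = 0 then ⊤
  else if hk : k - 1 < N then ((κ.1 ⟨k - 1, hk⟩ : WithTop ℤ) : WithBot (WithTop ℤ))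
  else ⊥

/-- Interlacing `lam ≺ μ`, that is `μ_1 ≥ lam_1 ≥ μ_2 ≥ lam_2 ≥ …`. With the conventions of `part`
this single formula is the interlacing of `lam ∈ Sig_{N-1}` with `μ ∈ Sig_N`
(ending in `… ≥ lam_{N-1} ≥ μ_N`) as well as that of `lam ∈ Sig_N` with `μ ∈ Sig_N`
(ending in `… ≥ μ_N ≥ lam_N`). It is only used for these two pairs of lengths. -/
def Interlaces {M N : ℕ} (lam : Sig M) (μ : Sig N) : Prop :=
  ∀ k : ℕ, 1 ≤ k → part μ (k + 1) ≤ part lam k ∧ part lam k ≤ part μ k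

infix:50 " ≺ " => Interlaces

open Classical in
/-- `ψ_{μ/lam}` for `μ ∈ Sig_N` and `lam ∈ Sig_{N-1}` or `lam ∈ Sig_N`. -/
noncomputable def psi {M N : ℕ} (t : ℝ) (μ : Sig N) (lam : Sig M) : ℝ :=
  if lam ≺ μ then
    ∏ p ∈ (Finset.Icc 1 N ×ˢ Finset.Icc 1 N).filter (fun p : ℕ × ℕ =>
        p.1 ≤ p.2 ∧ part μ (p.2 + 1) < part lam p.2 ∧ part lam p.2 = part lam p.1 ∧
          part lam p.1 < part μ p.1),
      (1 - t ^ (p.2 - p.1 + 1))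
  else 0

open Classical in
/-- `φ_{μ/lam}` for `μ ∈ Sig_N` and `lam ∈ Sig_{N-1}` or `lam ∈ Sig_N`. -/
noncomputable def phi {M N : ℕ} (t : ℝ) (μ : Sig N) (lam : Sig M) : ℝ :=
  if lam ≺ μ then
    ∏ p ∈ (Finset.Icc 1 N ×ˢ Finset.Icc 1 N).filter (fun p : ℕ × ℕ =>
        p.1 ≤ p.2 ∧ part lam p.2 < part μ p.2 ∧ part μ p.2 = part μ p.1 ∧
          part μ p.1 < part lam (p.1 - 1)),
      (1 - t ^ (p.2 - p.1 + 1))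
  else 0

/-- `κ'` is obtained from `κ` by moving one particle from position `x` to position `x + 1`. -/
def Moves {N : ℕ} (κ κ' : Sig N) (x : ℤ) : Prop :=
  ∃ a : Fin N, κ.1 a = x ∧ κ'.1 = Function.update κ.1 a (x + 1)

/-- A signature at each vertex of the lattice, with a label on each horizontal edge
`(i, j) – (i+1, j)` and on each vertical edge `(i, j) – (i, j+1)`. Only the values inside a
rectangle `[0, m] × [0, n]` are ever used. -/
structure Filling (N : ℕ) where
  Lam : ℕ → ℕ → Sig N
  h : ℕ → ℕ → ℤ
  v : ℕ → ℕ → ℤ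

namespace Filling

variable {N : ℕ}

/-- `F` is an admissible function on all vertices of `[0, m] × [0, n]` with the values
`lam`, `ν`, `μ`, `ρ` at the corners `(0, 0)`, `(m, 0)`, `(0, n)`, `(m, n)`; the edge label is the
initial position of the particle that moves along the edge. -/
structure IsAdmissible (F : Filling N) (m n : ℕ) (lam ν μ ρ : Sig N) : Prop where
  sw : F.Lam 0 0 = lam
  se : F.Lam m 0 = ν
  nw : F.Lam 0 n = μ
  ne : F.Lam m n = ρ
  move_h : ∀ i j, i < m → j ≤ n → Moves (F.Lam i j) (F.Lam (i + 1) j) (F.h i j)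
  move_v : ∀ i j, i ≤ m → j < n → Moves (F.Lam i j) (F.Lam i (j + 1)) (F.v i j)
  lt_h : ∀ i j, i + 2 ≤ m → j ≤ n → F.h i j < F.h (i + 1) j
  lt_v : ∀ i j, i ≤ m → j + 2 ≤ n → F.v i j < F.v i (j + 1)
  diag : ∀ i j, i < m → j < n → F.h i j = F.v i j →
    (F.h i (j + 1) = F.h i j ∧ F.v (i + 1) j = F.h i j) ∨
      (F.h i (j + 1) = F.h i j + 1 ∧ F.v (i + 1) j = F.h i j + 1)

/-- The box `b_{i,j}` (south-western corner `(i, j)`) is a zero-box. -/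
def IsZero (F : Filling N) (i j : ℕ) : Prop :=
  F.h i j = F.v i j ∧ F.h i (j + 1) = F.h i j ∧ F.v (i + 1) j = F.h i j

/-- The box `b_{i,j}` is a one-box. -/
def IsOne (F : Filling N) (i j : ℕ) : Prop :=
  F.h i j = F.v i j ∧ F.h i (j + 1) = F.h i j + 1 ∧ F.v (i + 1) j = F.h i j + 1

/-- The box `b_{i,j}` is trivial. -/
def IsTrivial (F : Filling N) (i j : ℕ) : Prop :=
  F.h i j ≠ F.v i j ∧ F.h i (j + 1) = F.h i j ∧ F.v (i + 1) j = F.v i j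

/-- `c(B) = t ^ (number of coordinates of Λ(i,j) equal to r(B))` for `B = b_{i,j}`,
where `r(B) = h_{i,j}`. -/
noncomputable def boxC (F : Filling N) (t : ℝ) (i j : ℕ) : ℝ :=
  t ^ (Finset.univ.filter (fun a : Fin N => (F.Lam i j).1 a = F.h i j)).card

/-- `h_{i-1,j} = r(B) - 1` for `B = b_{i,j}`, with the convention `h_{-1,j} = -∞`. -/
def HitLeft (F : Filling N) (i j : ℕ) : Prop := 0 < i ∧ F.h (i - 1) j = F.h i j - 1

/-- `v_{i,j-1} = r(B) - 1` for `B = b_{i,j}`, with the convention `v_{i,-1} = -∞`. -/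
def HitBelow (F : Filling N) (i j : ℕ) : Prop := 0 < j ∧ F.v i (j - 1) = F.h i j - 1

/-- `h_{i-1,j} < r(B) - 1` and `v_{i,j-1} < r(B) - 1` for `B = b_{i,j}`, with the same
conventions. -/
def NoHit (F : Filling N) (i j : ℕ) : Prop :=
  (0 < i → F.h (i - 1) j < F.h i j - 1) ∧ (0 < j → F.v i (j - 1) < F.h i j - 1)

/-- `b_{i-1,j-1}` is a zero-box whose upper label is `r(B) - 1`, where `B = b_{i,j}`. -/
def ZeroBefore (F : Filling N) (i j : ℕ) : Prop :=
  0 < i ∧ 0 < j ∧ F.IsZero (i - 1) (j - 1) ∧ F.h (i - 1) j = F.h i j - 1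

/-- `b_{i-1,j-1}` is a one-box whose upper label is `r(B) - 1`, where `B = b_{i,j}`. -/
def OneBefore (F : Filling N) (i j : ℕ) : Prop :=
  0 < i ∧ 0 < j ∧ F.IsOne (i - 1) (j - 1) ∧ F.h (i - 1) j = F.h i j - 1

open Classical in
/-- The weight `w(b_{i,j})`. For an admissible function the listed cases exhaust all boxes of the
rectangle, up to the two cases of weight `0` (a one-box with `ZeroBefore`, a zero-box with
`OneBefore`), which are the final `else`. Boxes outside of the rectangle count as trivial. -/
noncomputable def weight (F : Filling N) (t : ℝ) (i j : ℕ) : ℝ :=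
  if F.IsTrivial i j then 1
  else if F.IsOne i j ∧ ((0 < i ∧ F.IsOne (i - 1) j) ∨ (0 < j ∧ F.IsOne i (j - 1))) then 1
  else if F.IsOne i j ∧ F.OneBefore i j then 1
  else if F.IsZero i j ∧ F.ZeroBefore i j then 1
  else if F.IsZero i j ∧ Xor (F.HitLeft i j) (F.HitBelow i j) then t
  else if F.IsOne i j ∧ (0 < i → F.IsTrivial (i - 1) j) ∧ (0 < j → F.IsTrivial i (j - 1)) ∧
      Xor (F.HitLeft i j) (F.HitBelow i j) then 1 - t
  else if F.IsZero i j ∧ F.NoHit i j then (t - F.boxC t i j) / (1 - F.boxC t i j)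
  else if F.IsOne i j ∧ F.NoHit i j then (1 - t) / (1 - F.boxC t i j)
  else 0

end Filling

open Classical in
/-- `U(μ → ρ ∣ lam → ν)` for signatures of length `N`: the product of the weights of all boxes of
`[0, m] × [0, n]`, `m = |ν| - |lam|`, `n = |μ| - |lam|`, for the (unique, if any) admissible
function with these four corner values; `0` if there is none, or if the interlacing and size
conditions fail. -/
noncomputable def U {N : ℕ} (t : ℝ) (μ ρ lam ν : Sig N) : ℝ :=
  if lam ≺ ν ∧ lam ≺ μ ∧ ν ≺ ρ ∧ μ ≺ ρ ∧ size ν - size lam = size ρ - size μ then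
    if hF : ∃ F : Filling N, F.IsAdmissible (size ν - size lam).toNat (size μ - size lam).toNat
        lam ν μ ρ then
      ∏ i ∈ Finset.range (size ν - size lam).toNat,
        ∏ j ∈ Finset.range (size μ - size lam).toNat, hF.choose.weight t i j
    else 0
  else 0

/-- The reversed signature `-κ = (-κ_N, …, -κ_1)`. -/
def rev {N : ℕ} (κ : Sig N) : Sig N :=
  ⟨fun i => -κ.1 (Fin.rev i), fun _ _ hij => neg_le_neg (κ.2 (Fin.rev_le_rev.mpr hij))⟩

/-- The signature `{x} ∪ κ`, for `x` not exceeding any coordinate of `κ`. -/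
def adjoin {n : ℕ} (κ : Sig n) (x : ℤ) (hx : ∀ i, x ≤ κ.1 i) : Sig (n + 1) :=
  ⟨Fin.snoc (α := fun _ => ℤ) κ.1 x, by
    intro i j hij
    induction j using Fin.lastCases with
    | last =>
      induction i using Fin.lastCases with
      | last => exact le_rfl
      | cast i => simpa using hx i
    | cast j =>
      induction i using Fin.lastCases with
      | last => exact absurd hij (by simp)
      | cast i => simpa using κ.2 (by simpa using hij)⟩

/-- The integer `-V` is strictly smaller than all coordinates of `μ` and `ν`. -/
def IsLow {M N : ℕ} (V : ℤ) (μ : Sig M) (ν : Sig N) : Prop :=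
  (∀ i, -V < μ.1 i) ∧ (∀ i, -V < ν.1 i)

/-- The conditions on the data of the algorithm with input `r`, together with the condition on the
auxiliary integer `V`. -/
def InputCond {n : ℕ} (V : ℤ) (r : ℕ) (μ ρ : Sig (n + 1)) (lam ν : Sig n) : Prop :=
  IsLow V μ ν ∧ lam ≺ μ ∧ μ ≺ ρ ∧ lam ≺ ν ∧ ν ≺ ρ ∧
    size ρ - size μ = size ν - size lam + r

theorem InputCond.le_nu {n : ℕ} {V : ℤ} {r : ℕ} {μ ρ : Sig (n + 1)} {lam ν : Sig n}
    (hc : InputCond V r μ ρ lam ν) (i : Fin n) : -V ≤ ν.1 i := (hc.1.2 i).le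

theorem InputCond.le_lam {n : ℕ} {V : ℤ} {r : ℕ} {μ ρ : Sig (n + 1)} {lam ν : Sig n}
    (hc : InputCond V r μ ρ lam ν) (i : Fin n) : -V - r ≤ lam.1 i := by
  have h1 := (hc.2.1 (i.1 + 1) (by omega)).1
  have h2 := hc.1.1 i.succ
  have hi := i.2
  simp only [part, Nat.add_eq_zero_iff, one_ne_zero, and_false, if_false, Nat.add_sub_cancel,
    Nat.add_lt_add_iff_right, hi, dif_pos, WithBot.coe_le_coe, WithTop.coe_le_coe] at h1
  have h3 : -V < μ.1 ⟨i.1 + 1, by omega⟩ := h2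
  have h4 : μ.1 ⟨i.1 + 1, by omega⟩ ≤ lam.1 i := h1
  omega

open Classical in
/-- `U^r(μ → ρ ∣ lam → ν) = U(μ → ρ ∣ {-V-r} ∪ lam → {-V} ∪ ν)` for `lam, ν ∈ Sig_{N-1}` and
`μ, ρ ∈ Sig_N`, `N = n + 1`, computed with the auxiliary integer `V`;
it is `0` if the conditions on the data fail. -/
noncomputable def Uin {n : ℕ} (t : ℝ) (V : ℤ) (r : ℕ) (μ ρ : Sig (n + 1)) (lam ν : Sig n) : ℝ :=
  if hc : InputCond V r μ ρ lam ν then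
    U t μ ρ (adjoin lam (-V - r) hc.le_lam) (adjoin ν (-V) hc.le_nu)
  else 0

open Classical in
/-- `Û^r(ν → lam ∣ ρ → μ) = U(-({-V} ∪ ν) → -({-V-r} ∪ lam) ∣ -ρ → -μ)`, the coefficients of the
inverse algorithm, computed with the auxiliary integer `V`;
it is `0` if the conditions on the data fail. -/
noncomputable def UinHat {n : ℕ} (t : ℝ) (V : ℤ) (r : ℕ) (ν lam : Sig n) (ρ μ : Sig (n + 1)) : ℝ :=
  if hc : InputCond V r μ ρ lam ν then
    U t (rev (adjoin ν (-V) hc.le_nu)) (rev (adjoin lam (-V - r) hc.le_lam)) (rev ρ) (rev μ)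
  else 0

/-- The factor `1 - t 1_{r ≥ 1}`. -/
noncomputable def inputFactor (t : ℝ) (r : ℕ) : ℝ := if 1 ≤ r then 1 - t else 1

/-- Signatures `lam` of length `L` with `lam ≺ μ`, `lam ≺ ν`, `|μ| - |lam| = k`,
`|ν| - |lam| = l`. -/
def Below (L : ℕ) {M N : ℕ} (μ : Sig M) (ν : Sig N) (k l : ℤ) : Set (Sig L) :=
  {lam | lam ≺ μ ∧ lam ≺ ν ∧ size μ - size lam = k ∧ size ν - size lam = l}

/-- Signatures `ρ` of length `L` with `μ ≺ ρ`, `ν ≺ ρ`, `|ρ| - |ν| = k`, `|ρ| - |μ| = l`. -/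
def Above (L : ℕ) {M N : ℕ} (μ : Sig M) (ν : Sig N) (k l : ℤ) : Set (Sig L) :=
  {ρ | μ ≺ ρ ∧ ν ≺ ρ ∧ size ρ - size ν = k ∧ size ρ - size μ = l}

end HallLittlewood

open HallLittlewood

/-!
The proof works with the conjugate coordinates of a signature, `dual κ x` = number of particles to
the right of `x`. In these coordinates interlacing means that `dual` grows by `0` or `1` at every
`x`, a move of a particle adds a delta function, and `ψ`, `φ` are products over sites `x` of factors
that only involve the neighbouring bonds (`psi_eq_prod`, `phi_eq_prod`).

The edge labels of an admissible function behave like lines that cross each other, where two lines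
with equal labels either both keep the label or both raise it by one. Once a line has been raised,
all its further collisions raise it, so almost all boxes have weight `1`: the only exceptions are the
first collisions of two lines that start with the same label `x`, and there is at most one for every
`x`. Its weight is determined by the boundary of the rectangle, namely by the currents (which lines
start or end with a given label) and by the carries, the numbers of lines raised from `x` to `x + 1`.
Thus `U` is also a product over sites of local factors (`Filling.IsAdmissible.prod_weight`,
`U_eq_prod`).

The flip property is then checked site by site. At a single site its two sides differ by the ratio of
a factor attached to the bond on the left and the same factor attached to the bond on the right
(`site_flip`), and this telescopes (`flip`). Reading an admissible function backwards with all
signatures reversed gives an admissible function for the reversed corners, so that both sides vanish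
simultaneously.

For stochasticity, the signatures `lam`, `μ`, `ν` fix the initial labels of all lines. The outcome is
encoded by the set `S` of the labels `x` at which the first collision raises both lines. For every `S`
the labels grow uniquely from the boundary, and an admissible function results whenever its weight is
not zero (`gridFilling_isAdmissible`). The weights are the probabilities of a chain of binary choices
made in increasing order of `x`, so they add up to one (`exists_choices`, `stochastic`).

The Cauchy identities follow by exchanging two sums (`weighted_bijection`,
`hasSum_of_weighted_bijection`). The version with input is the one for equal lengths applied to
signatures with an additional lowest particle, which contributes a factor `1 - t` to `ψ` on both
sides, and to `φ_{ν/lam}` if the input is not zero (`flip_input`).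
-/

/-! ### Conjugate coordinates -/

namespace HallLittlewood

/-- The conjugate coordinate of a signature: the number of particles strictly to the right
of `x`. -/
def dual {N : ℕ} (κ : Sig N) (x : ℤ) : ℕ := (Finset.univ.filter fun a : Fin N => x < κ.1 a).card

/-- The number of particles at `x`. -/
def mult {N : ℕ} (κ : Sig N) (x : ℤ) : ℕ := (Finset.univ.filter fun a : Fin N => κ.1 a = x).card

/-- The size of the signature obtained by truncating all coordinates at `x + 1`; it is the
sum of `dual κ y` over `y ≤ x`, up to a constant. -/
def trunc {N : ℕ} (κ : Sig N) (x : ℤ) : ℤ := ∑ a, min (κ.1 a) (x + 1)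

theorem dual_le {N : ℕ} (κ : Sig N) (x : ℤ) : dual κ x ≤ N := by
  simpa [dual] using Finset.card_filter_le (Finset.univ : Finset (Fin N)) fun a => x < κ.1 a

theorem lt_coord_iff {N : ℕ} (κ : Sig N) (x : ℤ) (a : Fin N) : x < κ.1 a ↔ a.1 < dual κ x := by
  constructor
  · intro h
    have hsub : Finset.Iic a ⊆ Finset.univ.filter fun b : Fin N => x < κ.1 b := by
      intro b hb
      simp only [Finset.mem_Iic] at hb
      simpa using h.trans_le (κ.2 hb)
    have := Finset.card_le_card hsub
    rw [Fin.card_Iic] at this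
    exact this
  · intro h
    by_contra hx
    have hsub : (Finset.univ.filter fun b : Fin N => x < κ.1 b) ⊆ Finset.Iio a := by
      intro b hb
      simp only [Finset.mem_filter, Finset.mem_univ, true_and] at hb
      simp only [Finset.mem_Iio]
      by_contra hab
      exact hx (hb.trans_le (κ.2 (not_lt.1 hab)))
    have := Finset.card_le_card hsub
    rw [Fin.card_Iio] at this
    exact absurd h (not_lt.2 this)

theorem lt_part_iff {N : ℕ} (κ : Sig N) (x : ℤ) (k : ℕ) :
    ((x : WithTop ℤ) : WithBot (WithTop ℤ)) < part κ k ↔ k ≤ dual κ x := by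
  unfold part
  split_ifs with h0 h1
  · subst h0
    simp only [Nat.zero_le, iff_true]
    exact WithBot.coe_lt_coe.2 (WithTop.coe_lt_top x)
  · rw [WithBot.coe_lt_coe, WithTop.coe_lt_coe, lt_coord_iff]
    simp only
    omega
  · have := dual_le κ x
    simp only [not_lt_bot, false_iff]
    omega

theorem le_of_forall_int_lt {a b : WithBot (WithTop ℤ)}
    (h : ∀ x : ℤ, ((x : WithTop ℤ) : WithBot (WithTop ℤ)) < a →
      ((x : WithTop ℤ) : WithBot (WithTop ℤ)) < b) : a ≤ b := by
  induction a with
  | bot => exact bot_le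
  | coe a =>
    induction a with
    | top =>
      induction b with
      | bot => exact absurd (h 0 (WithBot.coe_lt_coe.2 (WithTop.coe_lt_top _))) not_lt_bot
      | coe b =>
        induction b with
        | top => exact le_rfl
        | coe b =>
          have := h b (WithBot.coe_lt_coe.2 (WithTop.coe_lt_top _))
          exact absurd this (lt_irrefl _)
    | coe a =>
      have h1 := h (a - 1) (WithBot.coe_lt_coe.2 (WithTop.coe_lt_coe.2 (by omega)))
      induction b with
      | bot => exact absurd h1 not_lt_bot
      | coe b =>
        induction b with
        | top => exact WithBot.coe_le_coe.2 le_top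
        | coe b =>
          rw [WithBot.coe_lt_coe, WithTop.coe_lt_coe] at h1
          exact WithBot.coe_le_coe.2 (WithTop.coe_le_coe.2 (by omega))

/-- In conjugate coordinates interlacing reads the same for equal lengths as for lengths that
differ by one. -/
theorem interlaces_iff {M N : ℕ} (lam : Sig M) (μ : Sig N) :
    lam ≺ μ ↔ ∀ x, dual lam x ≤ dual μ x ∧ dual μ x ≤ dual lam x + 1 := by
  constructor
  · intro h x
    constructor
    · by_contra hx
      have h1 := (h (dual lam x) (by omega)).2
      have := (lt_part_iff μ x _).1 (((lt_part_iff lam x _).2 le_rfl).trans_le h1)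
      omega
    · by_contra hx
      have h1 := (h (dual lam x + 1) (by omega)).1
      have := (lt_part_iff lam x _).1
        (((lt_part_iff μ x (dual lam x + 1 + 1)).2 (by omega)).trans_le h1)
      omega
  · intro h k hk
    constructor
    · refine le_of_forall_int_lt fun x hx => ?_
      rw [lt_part_iff] at hx ⊢
      have := h x
      omega
    · refine le_of_forall_int_lt fun x hx => ?_
      rw [lt_part_iff] at hx ⊢
      have := h x
      omega

theorem dual_antitone {N : ℕ} (κ : Sig N) : Antitone (dual κ) := by
  intro x y hxy
  apply Finset.card_le_card
  intro a
  simp only [Finset.mem_filter, Finset.mem_univ, true_and]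
  omega

theorem dual_sub_one {N : ℕ} (κ : Sig N) (x : ℤ) : dual κ (x - 1) = dual κ x + mult κ x := by
  unfold dual mult
  rw [← Finset.card_union_of_disjoint]
  · congr 1
    ext a
    simp only [Finset.mem_filter, Finset.mem_univ, true_and, Finset.mem_union]
    omega
  · rw [Finset.disjoint_left]
    intro a
    simp only [Finset.mem_filter, Finset.mem_univ, true_and]
    omega

theorem sig_ext {N : ℕ} {κ κ' : Sig N} (h : ∀ x, dual κ x = dual κ' x) : κ = κ' := by
  apply Subtype.ext
  funext a
  have key : ∀ x, x < κ.1 a ↔ x < κ'.1 a := fun x => by rw [lt_coord_iff, lt_coord_iff, h]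
  have h1 := key (κ.1 a)
  have h2 := key (κ'.1 a)
  have h3 := key (κ.1 a - 1)
  have h4 := key (κ'.1 a - 1)
  omega

theorem trunc_sub_trunc {N : ℕ} (κ : Sig N) (x : ℤ) :
    trunc κ x - trunc κ (x - 1) = dual κ x := by
  unfold trunc dual
  rw [← Finset.sum_sub_distrib, Finset.card_filter, Nat.cast_sum]
  refine Finset.sum_congr rfl fun a _ => ?_
  split_ifs with h <;> push_cast <;> omega

theorem trunc_eq_size {N : ℕ} (κ : Sig N) (x : ℤ) (hx : ∀ a, κ.1 a ≤ x + 1) :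
    trunc κ x = size κ := by
  unfold trunc size
  exact Finset.sum_congr rfl fun a _ => min_eq_left (hx a)

theorem trunc_eq_of_le {N : ℕ} (κ : Sig N) (x : ℤ) (hx : ∀ a, x + 1 ≤ κ.1 a) :
    trunc κ x = N * (x + 1) := by
  unfold trunc
  rw [Finset.sum_congr rfl fun a _ => min_eq_right (hx a)]
  simp

theorem dual_eq_zero {N : ℕ} (κ : Sig N) (x : ℤ) (hx : ∀ a, κ.1 a ≤ x) : dual κ x = 0 := by
  unfold dual
  rw [Finset.card_eq_zero, Finset.filter_eq_empty_iff]
  intro a _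
  have := hx a
  omega

theorem dual_eq_length {N : ℕ} (κ : Sig N) (x : ℤ) (hx : ∀ a, x < κ.1 a) : dual κ x = N := by
  unfold dual
  rw [Finset.filter_true_of_mem fun a _ => hx a]
  simp

/-- Every signature is recovered from its conjugate coordinates, which may be any non-increasing
function descending from `N` to `0`. -/
theorem exists_dual_eq {N : ℕ} (c : ℤ → ℕ) (hc : Antitone c) (A B : ℤ)
    (hA : ∀ x < A, c x = N) (hB : ∀ x, B ≤ x → c x = 0) : ∃ κ : Sig N, ∀ x, dual κ x = c x := by
  have key : ∀ a : Fin N, ∃ y : ℤ, ∀ x, x < y ↔ a.1 < c x := by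
    intro a
    obtain ⟨y, hy, hmin⟩ := Int.exists_least_of_bdd (P := fun z => c z ≤ a.1)
      ⟨A, fun z hz => by
        by_contra hlt
        have := hA z (not_le.1 hlt)
        have := a.2
        omega⟩ ⟨B, by rw [hB B le_rfl]; exact Nat.zero_le _⟩
    refine ⟨y, fun x => ⟨fun hx => ?_, fun hx => ?_⟩⟩
    · by_contra h
      have := hmin x (not_lt.1 h)
      omega
    · by_contra h
      have := hc (not_lt.1 h)
      omega
  choose f hf using key
  have hanti : Antitone f := by
    intro a b hab
    by_contra h
    have h1 := (hf b (f a)).1 (not_le.1 h)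
    have h2 := (hf a (f a)).2 (lt_of_le_of_lt hab h1)
    exact lt_irrefl _ h2
  refine ⟨⟨f, hanti⟩, fun x => ?_⟩
  have hle : c x ≤ N := by
    rcases lt_or_ge x A with h | h
    · exact (hA x h).le
    · have := hc h
      have h2 := hA (A - 1) (by omega)
      have h3 := hc (show A - 1 ≤ x by omega)
      omega
  unfold dual
  simp only [hf]
  rw [show (Finset.univ.filter fun a : Fin N => a.1 < c x) =
    (Finset.range (c x)).attachFin (fun a ha => (Finset.mem_range.1 ha).trans_le hle) by
      ext a; simp]
  simp

/-- In conjugate coordinates a move of a particle away from `x` is the addition of a delta function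
at `x`. -/
theorem moves_iff {N : ℕ} (κ κ' : Sig N) (x : ℤ) :
    Moves κ κ' x ↔ ∀ y, dual κ' y = dual κ y + if x = y then 1 else 0 := by
  constructor
  · rintro ⟨a, ha, hκ⟩ y
    unfold dual
    rw [hκ, Finset.card_filter, Finset.card_filter,
      ← Finset.add_sum_erase _ _ (Finset.mem_univ a),
      ← Finset.add_sum_erase _ (fun i => if y < κ.1 i then 1 else 0) (Finset.mem_univ a)]
    rw [Finset.sum_congr rfl (g := fun i => if y < κ.1 i then 1 else 0) (fun i hi => by
      rw [Function.update_of_ne (Finset.ne_of_mem_erase hi)])]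
    simp only [Function.update_self, ha]
    split_ifs <;> omega
  · intro h
    have hx := h x
    rw [if_pos rfl] at hx
    have hN := dual_le κ' x
    have ha : dual κ x < N := by omega
    have hne : ∀ y, y ≠ x → dual κ' y = dual κ y := fun y hy => by
      rw [h y, if_neg (Ne.symm hy), add_zero]
    have key : ∀ b : Fin N, ∀ y, (y < κ'.1 b ↔ (y < κ.1 b ∨ (y = x ∧ b.1 = dual κ x))) := by
      intro b y
      rw [lt_coord_iff, lt_coord_iff, h y]
      split_ifs with hxy
      · subst hxy; omega
      · omega
    refine ⟨⟨dual κ x, ha⟩, ?_, ?_⟩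
    · have h1 : ¬ x < κ.1 ⟨dual κ x, ha⟩ := by rw [lt_coord_iff]; simp
      have h2 : x - 1 < κ.1 ⟨dual κ x, ha⟩ := by
        rw [lt_coord_iff]
        have := hne (x - 1) (by omega)
        have := dual_antitone κ' (show x - 1 ≤ x by omega)
        simp only
        omega
      omega
    · funext b
      by_cases hb : b = ⟨dual κ x, ha⟩
      · subst hb
        rw [Function.update_self]
        have h1 := (key ⟨dual κ x, ha⟩ x).2 (Or.inr ⟨rfl, rfl⟩)
        have h2 : ¬ x + 1 < κ'.1 ⟨dual κ x, ha⟩ := by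
          rw [lt_coord_iff, hne (x + 1) (by omega)]
          have := dual_antitone κ (show x ≤ x + 1 by omega)
          simp only
          omega
        omega
      · rw [Function.update_of_ne hb]
        have hb' : b.1 ≠ dual κ x := fun h => hb (Fin.ext h)
        have h1 := key b (κ.1 b)
        have h2 := key b (κ'.1 b)
        have h3 := key b (κ.1 b - 1)
        have h4 := key b (κ'.1 b - 1)
        omega

theorem trunc_of_moves {N : ℕ} {κ κ' : Sig N} {x : ℤ} (h : Moves κ κ' x) (y : ℤ) :
    trunc κ' y = trunc κ y + if x ≤ y then 1 else 0 := by
  obtain ⟨a, ha, hκ⟩ := h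
  unfold trunc
  rw [hκ, ← Finset.add_sum_erase _ _ (Finset.mem_univ a),
    ← Finset.add_sum_erase _ (fun i => min (κ.1 i) (y + 1)) (Finset.mem_univ a)]
  rw [Finset.sum_congr rfl (g := fun i => min (κ.1 i) (y + 1)) (fun i hi => by
    rw [Function.update_of_ne (Finset.ne_of_mem_erase hi)])]
  simp only [Function.update_self, ha]
  split_ifs <;> omega

theorem dual_rev {N : ℕ} (κ : Sig N) (x : ℤ) : dual (rev κ) x + dual κ (-x - 1) = N := by
  have h1 : dual (rev κ) x = (Finset.univ.filter fun a : Fin N => ¬ (-x - 1 < κ.1 a)).card := by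
    unfold dual rev
    refine Finset.card_bij' (fun a _ => Fin.rev a) (fun a _ => Fin.rev a) ?_ ?_ ?_ ?_
    · intro a
      simp only [Finset.mem_filter, Finset.mem_univ, true_and]
      omega
    · intro a
      simp only [Finset.mem_filter, Finset.mem_univ, true_and, Fin.rev_rev]
      omega
    · simp
    · simp
  rw [h1, add_comm]
  unfold dual
  rw [Finset.card_filter_add_card_filter_not]
  simp

theorem size_rev {N : ℕ} (κ : Sig N) : size (rev κ) = -size κ := by
  unfold size rev
  simp only [Finset.sum_neg_distrib]
  rw [Equiv.sum_comp Fin.revPerm (fun i => κ.1 i) |>.symm]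
  rfl

theorem trunc_rev {N : ℕ} (κ : Sig N) (x : ℤ) :
    trunc (rev κ) x = trunc κ (-x - 2) - size κ + N * (x + 1) := by
  unfold trunc size rev
  have : ∑ a : Fin N, min (-κ.1 (Fin.rev a)) (x + 1) = ∑ a, min (-κ.1 a) (x + 1) :=
    Equiv.sum_comp Fin.revPerm (fun i => min (-κ.1 i) (x + 1))
  rw [this, show (N : ℤ) * (x + 1) = ∑ _a : Fin N, (x + 1) by simp, ← Finset.sum_sub_distrib,
    ← Finset.sum_add_distrib]
  refine Finset.sum_congr rfl fun a _ => ?_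
  omega

theorem mult_rev {N : ℕ} (κ : Sig N) (x : ℤ) : mult (rev κ) x = mult κ (-x) := by
  have h1 := dual_sub_one (rev κ) x
  have h2 := dual_sub_one κ (-x)
  have h3 := dual_rev κ x
  have h4 := dual_rev κ (x - 1)
  rw [show -(x - 1) - 1 = -x by ring] at h4
  omega

theorem rev_rev {N : ℕ} (κ : Sig N) : rev (rev κ) = κ := by
  apply Subtype.ext
  funext a
  simp [rev]

theorem rev_interlaces_rev {N : ℕ} {κ κ' : Sig N} (h : κ ≺ κ') : rev κ' ≺ rev κ := by
  rw [interlaces_iff] at h ⊢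
  intro x
  have h1 := h (-x - 1)
  have h2 := dual_rev κ x
  have h3 := dual_rev κ' x
  omega

theorem moves_rev {N : ℕ} {κ κ' : Sig N} {x : ℤ} (h : Moves κ κ' x) :
    Moves (rev κ') (rev κ) (-x - 1) := by
  rw [moves_iff] at h ⊢
  intro y
  have h1 := h (-y - 1)
  have h2 := dual_rev κ y
  have h3 := dual_rev κ' y
  split_ifs at h1 ⊢ <;> omega

end HallLittlewood

/-! ### The branching coefficients as products over sites -/

namespace HallLittlewood

/-- All particles of `κ` lie in `[A, B)`. -/
def InWindow {N : ℕ} (A B : ℤ) (κ : Sig N) : Prop := ∀ a, A ≤ κ.1 a ∧ κ.1 a < B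

theorem InWindow.dual_low {N : ℕ} {A B : ℤ} {κ : Sig N} (h : InWindow A B κ) {x : ℤ}
    (hx : x < A) : dual κ x = N := dual_eq_length κ x fun a => hx.trans_le (h a).1

theorem InWindow.dual_high {N : ℕ} {A B : ℤ} {κ : Sig N} (h : InWindow A B κ) {x : ℤ}
    (hx : B ≤ x + 1) : dual κ x = 0 := dual_eq_zero κ x fun a => by have := (h a).2; omega

theorem InWindow.mono {N : ℕ} {A B A' B' : ℤ} {κ : Sig N} (h : InWindow A B κ) (hA : A' ≤ A)
    (hB : B ≤ B') : InWindow A' B' κ := fun a => ⟨hA.trans (h a).1, (h a).2.trans_le hB⟩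

theorem exists_inWindow {N : ℕ} (κ : Sig N) : ∃ M : ℤ, 0 ≤ M ∧ InWindow (-M) M κ := by
  refine ⟨∑ a, |κ.1 a| + 1, by positivity, fun a => ?_⟩
  have := Finset.single_le_sum (f := fun a => |κ.1 a|) (fun i _ => abs_nonneg _)
    (Finset.mem_univ a)
  have h1 := neg_abs_le (κ.1 a)
  have h2 := le_abs_self (κ.1 a)
  omega

theorem inWindow_rev {N : ℕ} {A B : ℤ} {κ : Sig N} (h : InWindow A B κ) :
    InWindow (-B + 1) (-A + 1) (rev κ) := fun a => by
  have := h (Fin.rev a)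
  simp only [rev]
  omega

theorem lt_int_iff (a : WithBot (WithTop ℤ)) (x : ℤ) :
    a < ((x : WithTop ℤ) : WithBot (WithTop ℤ)) ↔
      ¬ (((x - 1 : ℤ) : WithTop ℤ) : WithBot (WithTop ℤ)) < a := by
  induction a with
  | bot => simp
  | coe a =>
    rw [WithBot.coe_lt_coe, WithBot.coe_lt_coe]
    induction a with
    | top => simp
    | coe a =>
      rw [WithTop.coe_lt_coe, WithTop.coe_lt_coe]
      omega

theorem part_lt_iff {N : ℕ} (κ : Sig N) (x : ℤ) (k : ℕ) :
    part κ k < ((x : WithTop ℤ) : WithBot (WithTop ℤ)) ↔ dual κ (x - 1) < k := by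
  rw [lt_int_iff, lt_part_iff, not_le]

theorem part_eq_iff {N : ℕ} (κ : Sig N) (x : ℤ) (k : ℕ) :
    part κ k = ((x : WithTop ℤ) : WithBot (WithTop ℤ)) ↔ dual κ x < k ∧ k ≤ dual κ (x - 1) := by
  have h1 := part_lt_iff κ x k
  have h2 := lt_part_iff κ x k
  rw [← not_le (b := dual κ x), ← h2]
  constructor
  · intro h
    rw [h] at h1 h2
    refine ⟨h ▸ lt_irrefl _, ?_⟩
    by_contra hk
    exact lt_irrefl _ (h1.2 (not_le.1 hk))
  · rintro ⟨h3, h4⟩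
    refine le_antisymm (not_lt.1 h3) (not_lt.1 fun h => ?_)
    exact absurd (h1.1 h) (not_lt.2 h4)

theorem exists_part_eq {N : ℕ} (κ : Sig N) (k : ℕ) (hk : 1 ≤ k) (hb : part κ k ≠ ⊥) :
    ∃ x : ℤ, part κ k = ((x : WithTop ℤ) : WithBot (WithTop ℤ)) := by
  unfold part at hb ⊢
  rw [if_neg (by omega)] at hb ⊢
  split_ifs with h
  · exact ⟨_, rfl⟩
  · rw [dif_neg h] at hb
    exact absurd rfl hb

theorem InWindow.mem_of_dual {N : ℕ} {A B : ℤ} {κ : Sig N} (h : InWindow A B κ) {x : ℤ}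
    (hx : dual κ x < dual κ (x - 1)) : A ≤ x ∧ x < B := by
  constructor
  · by_contra hA
    have h1 := h.dual_low (not_le.1 hA)
    have h2 := dual_le κ (x - 1)
    omega
  · by_contra hB
    have := h.dual_high (x := x - 1) (by omega)
    omega

/-- A site contributes to `ψ_{μ/lam}` if a particle leaves it and none arrives. -/
theorem psi_eq_prod {M N : ℕ} (t : ℝ) {μ : Sig N} {lam : Sig M} (hl : lam ≺ μ) {A B : ℤ}
    (hA : InWindow A B lam) :
    psi t μ lam = ∏ x ∈ Finset.Ico A B,
      if dual μ (x - 1) = dual lam (x - 1) ∧ dual μ x = dual lam x + 1 then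
        1 - t ^ mult lam x else 1 := by
  unfold psi
  rw [if_pos hl, ← Finset.prod_filter]
  rw [interlaces_iff] at hl
  symm
  refine Finset.prod_nbij (fun x => (dual lam x + 1, dual lam (x - 1))) ?_ ?_ ?_ ?_
  · intro x hx
    simp only [Finset.mem_filter, Finset.mem_Ico] at hx
    obtain ⟨-, h1, h2⟩ := hx
    have h3 := dual_antitone μ (show x - 1 ≤ x by omega)
    have h4 := dual_le μ (x - 1)
    simp only [Finset.mem_filter, Finset.mem_product, Finset.mem_Icc]
    have e1 := (part_eq_iff lam x (dual lam (x - 1))).2 (by omega)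
    have e2 := (part_eq_iff lam x (dual lam x + 1)).2 (by omega)
    rw [e1, e2, part_lt_iff, lt_part_iff]
    refine ⟨by omega, by omega, by omega, rfl, by omega⟩
  · intro x hx y hy hxy
    simp only [Finset.coe_filter, Set.mem_ofPred_eq, Finset.mem_Ico, Prod.mk.injEq] at hx hy hxy
    have h3 := dual_antitone μ (show x - 1 ≤ x by omega)
    have h4 := dual_antitone μ (show y - 1 ≤ y by omega)
    have e1 := (part_eq_iff lam x (dual lam (x - 1))).2 (by omega)
    have e2 := (part_eq_iff lam y (dual lam (x - 1))).2 (by omega)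
    rw [e1] at e2
    exact WithTop.coe_injective (WithBot.coe_injective e2)
  · rintro ⟨k, j⟩ hp
    simp only [Finset.coe_filter, Set.mem_ofPred_eq, Finset.mem_product, Finset.mem_Icc] at hp
    obtain ⟨⟨⟨hk, -⟩, hj, -⟩, hkj, h1, h2, h3⟩ := hp
    obtain ⟨x, hx⟩ := exists_part_eq lam j hj (ne_bot_of_gt h1)
    rw [← h2, hx, lt_part_iff] at h3
    rw [hx, part_lt_iff] at h1
    rw [hx] at h2
    have e1 := (part_eq_iff lam x j).1 hx
    have e2 := (part_eq_iff lam x k).1 h2.symm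
    have l1 := hl x
    have l2 := hl (x - 1)
    refine ⟨x, ?_, ?_⟩
    · simp only [Finset.coe_filter, Set.mem_ofPred_eq, Finset.mem_Ico]
      exact ⟨hA.mem_of_dual (by omega), by omega, by omega⟩
    · simp only [Prod.mk.injEq]
      omega
  · intro x hx
    simp only [Finset.mem_filter, Finset.mem_Ico] at hx
    have h3 := dual_antitone μ (show x - 1 ≤ x by omega)
    have h4 := dual_sub_one lam x
    simp only
    congr 2
    omega

/-- A site contributes to `φ_{μ/lam}` if a particle arrives at it and none leaves. -/
theorem phi_eq_prod {M N : ℕ} (t : ℝ) {μ : Sig N} {lam : Sig M} (hl : lam ≺ μ) {A B : ℤ}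
    (hA : InWindow A B μ) :
    phi t μ lam = ∏ x ∈ Finset.Ico A B,
      if dual μ (x - 1) = dual lam (x - 1) + 1 ∧ dual μ x = dual lam x then
        1 - t ^ mult μ x else 1 := by
  unfold phi
  rw [if_pos hl, ← Finset.prod_filter]
  rw [interlaces_iff] at hl
  symm
  refine Finset.prod_nbij (fun x => (dual μ x + 1, dual μ (x - 1))) ?_ ?_ ?_ ?_
  · intro x hx
    simp only [Finset.mem_filter, Finset.mem_Ico] at hx
    obtain ⟨-, h1, h2⟩ := hx
    have h3 := dual_antitone lam (show x - 1 ≤ x by omega)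
    have h4 := dual_le μ (x - 1)
    simp only [Finset.mem_filter, Finset.mem_product, Finset.mem_Icc]
    have e1 := (part_eq_iff μ x (dual μ (x - 1))).2 (by omega)
    have e2 := (part_eq_iff μ x (dual μ x + 1)).2 (by omega)
    rw [e1, e2, part_lt_iff, lt_part_iff]
    refine ⟨by omega, by omega, by omega, rfl, by omega⟩
  · intro x hx y hy hxy
    simp only [Finset.coe_filter, Set.mem_ofPred_eq, Finset.mem_Ico, Prod.mk.injEq] at hx hy hxy
    have h3 := dual_antitone lam (show x - 1 ≤ x by omega)
    have h4 := dual_antitone lam (show y - 1 ≤ y by omega)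
    have e1 := (part_eq_iff μ x (dual μ (x - 1))).2 (by omega)
    have e2 := (part_eq_iff μ y (dual μ (x - 1))).2 (by omega)
    rw [e1] at e2
    exact WithTop.coe_injective (WithBot.coe_injective e2)
  · rintro ⟨k, j⟩ hp
    simp only [Finset.coe_filter, Set.mem_ofPred_eq, Finset.mem_product, Finset.mem_Icc] at hp
    obtain ⟨⟨⟨hk, -⟩, hj, -⟩, hkj, h1, h2, h3⟩ := hp
    obtain ⟨x, hx⟩ := exists_part_eq μ j hj (ne_bot_of_gt h1)
    rw [← h2, hx, lt_part_iff] at h3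
    rw [hx, part_lt_iff] at h1
    rw [hx] at h2
    have e1 := (part_eq_iff μ x j).1 hx
    have e2 := (part_eq_iff μ x k).1 h2.symm
    have l1 := hl x
    have l2 := hl (x - 1)
    refine ⟨x, ?_, ?_⟩
    · simp only [Finset.coe_filter, Set.mem_ofPred_eq, Finset.mem_Ico]
      exact ⟨hA.mem_of_dual (by omega), by omega, by omega⟩
    · simp only [Prod.mk.injEq]
      omega
  · intro x hx
    simp only [Finset.mem_filter, Finset.mem_Ico] at hx
    have h3 := dual_antitone lam (show x - 1 ≤ x by omega)
    have h4 := dual_sub_one μ x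
    simp only
    congr 2
    omega

end HallLittlewood

/-! ### Colliding labels -/

namespace HallLittlewood

/-- The edge labels of an admissible function, without the signatures: labels increase along rows
and columns, and two lines carrying different labels cross unchanged, while two lines carrying
the same label both keep it or both raise it by one. -/
structure LabelGrid (m n : ℕ) (h v : ℕ → ℕ → ℤ) : Prop where
  lt_h : ∀ i j, i + 2 ≤ m → j ≤ n → h i j < h (i + 1) j
  lt_v : ∀ i j, i ≤ m → j + 2 ≤ n → v i j < v i (j + 1)
  box : ∀ i j, i < m → j < n →
    (h i j ≠ v i j ∧ h i (j + 1) = h i j ∧ v (i + 1) j = v i j) ∨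
    (h i j = v i j ∧ h i (j + 1) = h i j ∧ v (i + 1) j = h i j) ∨
    (h i j = v i j ∧ h i (j + 1) = h i j + 1 ∧ v (i + 1) j = h i j + 1)

/-- The number of labels equal to `x`. -/
def occ (m : ℕ) (s : ℕ → ℤ) (x : ℤ) : ℤ := ∑ i ∈ Finset.range m, if s i = x then 1 else 0

/-- The number of horizontal lines whose label is raised from `x` to `x + 1`. -/
def flow (m n : ℕ) (h : ℕ → ℕ → ℤ) (x : ℤ) : ℤ :=
  ∑ i ∈ Finset.range m, if h i 0 ≤ x ∧ x < h i n then 1 else 0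

theorem occ_nonneg (m : ℕ) (s : ℕ → ℤ) (x : ℤ) : 0 ≤ occ m s x :=
  Finset.sum_nonneg fun i _ => by split_ifs <;> simp

theorem occ_eq_ite {m : ℕ} {s : ℕ → ℤ} (hs : ∀ i i', i < i' → i' < m → s i < s i') (x : ℤ)
    [Decidable (∃ i < m, s i = x)] : occ m s x = if ∃ i < m, s i = x then 1 else 0 := by
  unfold occ
  split_ifs with hx
  · obtain ⟨i, hi, rfl⟩ := hx
    rw [Finset.sum_eq_single i]
    · simp
    · intro i' hi' hne
      rw [Finset.mem_range] at hi'
      rw [if_neg]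
      rcases lt_or_gt_of_ne hne with h | h
      · exact (hs _ _ h hi).ne
      · exact (hs _ _ h hi').ne'
    · intro h
      exact absurd (Finset.mem_range.2 hi) h
  · refine Finset.sum_eq_zero fun i hi => if_neg fun h => hx ⟨i, Finset.mem_range.1 hi, h⟩

theorem flow_nonneg (m n : ℕ) (h : ℕ → ℕ → ℤ) (x : ℤ) : 0 ≤ flow m n h x :=
  Finset.sum_nonneg fun i _ => by split_ifs <;> simp

theorem one_le_flow_iff {m n : ℕ} {h : ℕ → ℕ → ℤ} {x : ℤ} :
    1 ≤ flow m n h x ↔ ∃ i < m, h i 0 ≤ x ∧ x < h i n := by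
  constructor
  · intro hx
    by_contra hne
    have : flow m n h x = 0 := Finset.sum_eq_zero fun i hi =>
      if_neg fun hi' => hne ⟨i, Finset.mem_range.1 hi, hi'⟩
    omega
  · rintro ⟨i, hi, hx⟩
    have := Finset.single_le_sum (f := fun i => if h i 0 ≤ x ∧ x < h i n then (1 : ℤ) else 0)
      (fun i _ => by split_ifs <;> simp) (Finset.mem_range.2 hi)
    simp only [if_pos hx] at this
    exact this

theorem flow_eq_zero_iff {m n : ℕ} {h : ℕ → ℕ → ℤ} {x : ℤ} :
    flow m n h x = 0 ↔ ∀ i < m, h i 0 ≤ x → h i n ≤ x := by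
  have h1 := one_le_flow_iff (m := m) (n := n) (h := h) (x := x)
  have h2 := flow_nonneg m n h x
  constructor
  · intro h0 i hi hx
    by_contra hlt
    have := h1.2 ⟨i, hi, hx, not_le.1 hlt⟩
    omega
  · intro hall
    by_contra hne
    obtain ⟨i, hi, hx, hx'⟩ := h1.1 (by omega)
    exact absurd (hall i hi hx) (not_le.2 hx')

namespace LabelGrid

variable {m n : ℕ} {h v : ℕ → ℕ → ℤ}

theorem transpose (G : LabelGrid m n h v) :
    LabelGrid n m (fun j i => v i j) (fun j i => h i j) where
  lt_h j i hj hi := G.lt_v i j hi hj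
  lt_v j i hj hi := G.lt_h i j hi hj
  box j i hj hi := by
    have := G.box i j hi hj
    omega

theorem h_lt_h (G : LabelGrid m n h v) {i i' j : ℕ} (hi : i < i') (hm : i' < m) (hj : j ≤ n) :
    h i j < h i' j := by
  induction i', hi using Nat.le_induction with
  | base => exact G.lt_h i j (by omega) hj
  | succ k hk ih => exact (ih (by omega)).trans (G.lt_h k j (by omega) hj)

theorem v_lt_v (G : LabelGrid m n h v) {i j j' : ℕ} (hj : j < j') (hn : j' < n) (hi : i ≤ m) :
    v i j < v i j' := G.transpose.h_lt_h hj hn hi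

theorem h_le_h (G : LabelGrid m n h v) {i j j' : ℕ} (hi : i < m) (hj : j ≤ j') (hn : j' ≤ n) :
    h i j ≤ h i j' := by
  induction j', hj using Nat.le_induction with
  | base => exact le_rfl
  | succ k hk ih =>
    have := G.box i k hi (by omega)
    have := ih (by omega)
    omega

theorem v_le_v (G : LabelGrid m n h v) {i i' j : ℕ} (hj : j < n) (hi : i ≤ i') (hm : i' ≤ m) :
    v i j ≤ v i' j := G.transpose.h_le_h hj hi hm

/-- A label that passes `x` does so in a box where both labels are raised. -/
theorem exists_raise_h (G : LabelGrid m n h v) {i j : ℕ} {x : ℤ} (hi : i < m) (hj : j ≤ n)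
    (h0 : h i 0 ≤ x) (hx : x < h i j) :
    ∃ k < j, h i k = x ∧ v i k = x ∧ h i (k + 1) = x + 1 ∧ v (i + 1) k = x + 1 := by
  induction j with
  | zero => omega
  | succ j ih =>
    by_cases hlt : x < h i j
    · obtain ⟨k, hk, hh⟩ := ih (by omega) hlt
      exact ⟨k, by omega, hh⟩
    · have := G.box i j hi (by omega)
      exact ⟨j, by omega, by omega, by omega, by omega, by omega⟩

theorem exists_raise_v (G : LabelGrid m n h v) {i j : ℕ} {x : ℤ} (hj : j < n) (hi : i ≤ m)
    (h0 : v 0 j ≤ x) (hx : x < v i j) :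
    ∃ k < i, v k j = x ∧ h k j = x ∧ v (k + 1) j = x + 1 ∧ h k (j + 1) = x + 1 :=
  G.transpose.exists_raise_h hj hi h0 hx

/-- Once a vertical line has been raised, all its further collisions raise it. -/
theorem raise_of_raised_v (G : LabelGrid m n h v) {i j : ℕ} (hi : i < m) (hj : j < n)
    (he : h i j = v i j) (hv : v 0 j < v i j) : h i (j + 1) = h i j + 1 := by
  obtain ⟨k, hk, h1, h2, h3, h4⟩ := G.exists_raise_v (x := v i j - 1) hj hi.le (by omega)
    (by omega)
  have := G.h_lt_h (j := j + 1) hk hi (by omega)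
  have := G.box i j hi hj
  omega

theorem raise_of_raised_h (G : LabelGrid m n h v) {i j : ℕ} (hi : i < m) (hj : j < n)
    (he : h i j = v i j) (hh : h i 0 < h i j) : h i (j + 1) = h i j + 1 := by
  have := G.transpose.raise_of_raised_v hj hi he.symm hh
  have := G.box i j hi hj
  omega

/-- The sum of a function of the labels is the same along the two boundary paths of the
rectangle. -/
theorem sum_conservation (G : LabelGrid m n h v) (f : ℤ → ℤ) :
    ∑ i ∈ Finset.range m, f (h i 0) + ∑ j ∈ Finset.range n, f (v m j) =
      ∑ j ∈ Finset.range n, f (v 0 j) + ∑ i ∈ Finset.range m, f (h i n) := by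
  have h1 : ∑ i ∈ Finset.range m, ∑ j ∈ Finset.range n, (f (h i (j + 1)) - f (h i j)) =
      ∑ i ∈ Finset.range m, (f (h i n) - f (h i 0)) :=
    Finset.sum_congr rfl fun i _ => Finset.sum_range_sub (fun j => f (h i j)) n
  have h2 : ∑ j ∈ Finset.range n, ∑ i ∈ Finset.range m, (f (v (i + 1) j) - f (v i j)) =
      ∑ j ∈ Finset.range n, (f (v m j) - f (v 0 j)) :=
    Finset.sum_congr rfl fun j _ => Finset.sum_range_sub (fun i => f (v i j)) m
  have h3 : ∑ i ∈ Finset.range m, ∑ j ∈ Finset.range n, (f (h i (j + 1)) - f (h i j)) =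
      ∑ i ∈ Finset.range m, ∑ j ∈ Finset.range n, (f (v (i + 1) j) - f (v i j)) := by
    refine Finset.sum_congr rfl fun i hi => Finset.sum_congr rfl fun j hj => ?_
    rcases G.box i j (Finset.mem_range.1 hi) (Finset.mem_range.1 hj) with hb | hb | hb
    · rw [hb.2.1, hb.2.2]; ring
    · rw [hb.2.1, hb.2.2, hb.1]
    · rw [hb.2.1, hb.2.2, hb.1]
  rw [Finset.sum_comm] at h2
  rw [h1, h2, Finset.sum_sub_distrib, Finset.sum_sub_distrib] at h3
  linarith

theorem occ_conservation (G : LabelGrid m n h v) (x : ℤ) :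
    occ m (fun i => h i 0) x + occ n (fun j => v m j) x =
      occ n (fun j => v 0 j) x + occ m (fun i => h i n) x :=
  G.sum_conservation fun y => if y = x then 1 else 0

theorem flow_eq_sub (G : LabelGrid m n h v) (x : ℤ) :
    flow m n h x = ∑ i ∈ Finset.range m, (if h i 0 ≤ x then 1 else 0) -
      ∑ i ∈ Finset.range m, (if h i n ≤ x then 1 else 0) := by
  unfold flow
  rw [← Finset.sum_sub_distrib]
  refine Finset.sum_congr rfl fun i hi => ?_
  have := G.h_le_h (j := 0) (j' := n) (Finset.mem_range.1 hi) (by omega) le_rfl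
  split_ifs <;> omega

theorem flow_transpose (G : LabelGrid m n h v) (x : ℤ) :
    flow n m (fun j i => v i j) x = flow m n h x := by
  rw [G.flow_eq_sub, G.transpose.flow_eq_sub]
  have := G.sum_conservation fun y => if y ≤ x then 1 else 0
  linarith

theorem flow_sub_flow (G : LabelGrid m n h v) (x : ℤ) :
    flow m n h x - flow m n h (x - 1) =
      occ m (fun i => h i 0) x - occ m (fun i => h i n) x := by
  rw [G.flow_eq_sub, G.flow_eq_sub]
  unfold occ
  simp only [← Finset.sum_sub_distrib]
  refine Finset.sum_congr rfl fun i _ => ?_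
  split_ifs <;> omega

theorem flow_sub_flow' (G : LabelGrid m n h v) (x : ℤ) :
    flow m n h x - flow m n h (x - 1) =
      occ n (fun j => v 0 j) x - occ n (fun j => v m j) x := by
  rw [← G.flow_transpose, ← G.flow_transpose]
  exact G.transpose.flow_sub_flow x

section Decidable

open Classical in
theorem occ_h (G : LabelGrid m n h v) {j : ℕ} (hj : j ≤ n) (x : ℤ) :
    occ m (fun i => h i j) x = if ∃ i < m, h i j = x then 1 else 0 :=
  occ_eq_ite (fun _ _ hi hi' => G.h_lt_h hi hi' hj) x

open Classical in
theorem occ_v (G : LabelGrid m n h v) {i : ℕ} (hi : i ≤ m) (x : ℤ) :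
    occ n (fun j => v i j) x = if ∃ j < n, v i j = x then 1 else 0 :=
  G.transpose.occ_h hi x

end Decidable

theorem occ_h_le_one (G : LabelGrid m n h v) {j : ℕ} (hj : j ≤ n) (x : ℤ) :
    occ m (fun i => h i j) x ≤ 1 := by
  rw [G.occ_h hj]
  split_ifs <;> simp

theorem occ_v_le_one (G : LabelGrid m n h v) {i : ℕ} (hi : i ≤ m) (x : ℤ) :
    occ n (fun j => v i j) x ≤ 1 := G.transpose.occ_h_le_one hi x

theorem occ_h_eq_one_iff (G : LabelGrid m n h v) {j : ℕ} (hj : j ≤ n) (x : ℤ) :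
    occ m (fun i => h i j) x = 1 ↔ ∃ i < m, h i j = x := by
  rw [G.occ_h hj]
  split_ifs with hx <;> simp [hx]

theorem occ_v_eq_one_iff (G : LabelGrid m n h v) {i : ℕ} (hi : i ≤ m) (x : ℤ) :
    occ n (fun j => v i j) x = 1 ↔ ∃ j < n, v i j = x := G.transpose.occ_h_eq_one_iff hi x

/-- If lines are raised from `x - 1` to `x`, then a horizontal line ends with the label `x`
exactly if no vertical line starts with it: the raised lines all collide with that vertical line
or get stuck at `x` when it is missing. -/
theorem occ_out_h (G : LabelGrid m n h v) {x : ℤ} (hf : 1 ≤ flow m n h (x - 1)) :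
    occ m (fun i => h i n) x = 1 - occ n (fun j => v 0 j) x := by
  rw [one_le_flow_iff] at hf
  obtain ⟨i₁, hi₁, hlow, hhigh⟩ := hf
  rw [G.occ_h le_rfl, G.occ_v (Nat.zero_le _)]
  by_cases hv : ∃ j < n, v 0 j = x
  · rw [if_pos hv, if_neg, sub_self]
    rintro ⟨i, hi, hix⟩
    obtain ⟨j, hj, hjx⟩ := hv
    have hi0 : h i 0 ≤ x - 1 := by
      rcases lt_trichotomy i i₁ with hlt | rfl | hlt
      · have := G.h_lt_h (j := 0) hlt hi₁ (Nat.zero_le _)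
        omega
      · exact hlow
      · have := G.h_lt_h (j := n) hlt hi le_rfl
        omega
    obtain ⟨k, hk, h1, h2, h3, -⟩ := G.exists_raise_h hi le_rfl hi0 (by omega)
    have hv0 := G.v_le_v (i := 0) hj (Nat.zero_le i) hi.le
    have hkj : k < j := by
      by_contra hge
      rcases eq_or_lt_of_le (not_lt.1 hge) with heq | hlt
      · subst heq; omega
      · have := G.v_lt_v hlt hk hi.le
        omega
    have h4 := G.h_le_h (j := k + 1) hi (show k + 1 ≤ j by omega) hj.le
    have h5 := G.h_le_h (j := j) hi hj.le le_rfl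
    have hvx : v i j = x := by
      by_contra hne
      obtain ⟨i', hi', h6, h7, -⟩ := G.exists_raise_v (x := x) hj hi.le hjx.le (by omega)
      have := G.h_lt_h hi' hi hj.le
      omega
    have h6 := G.raise_of_raised_h hi hj (by omega) (by omega)
    have h7 := G.h_le_h (j := j + 1) hi hj le_rfl
    omega
  · rw [if_neg hv, if_pos, sub_zero]
    have hex : ∃ i, i < m ∧ x ≤ h i n := ⟨i₁, hi₁, by omega⟩
    classical
    obtain ⟨hi, hix⟩ := Nat.find_spec hex
    have hmin := fun i (hi' : i < Nat.find hex) => Nat.find_min hex hi'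
    have hle := Nat.find_min' hex ⟨hi₁, by omega⟩
    generalize Nat.find hex = i at *
    refine ⟨i, hi, ?_⟩
    have hi0 : h i 0 ≤ x := by
      rcases eq_or_lt_of_le hle with rfl | hlt
      · omega
      · have := G.h_lt_h (j := 0) hlt hi₁ (Nat.zero_le _)
        omega
    by_contra hne
    obtain ⟨k, hk, h1, h2, h3, -⟩ := G.exists_raise_h (x := x) hi le_rfl hi0 (by omega)
    have hv0 := G.v_le_v (i := 0) hk (Nat.zero_le i) hi.le
    have hv1 : v 0 k ≠ x := fun h => hv ⟨k, hk, h⟩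
    obtain ⟨i', hi', h4, h5, h6, h7⟩ := G.exists_raise_v (x := x - 1) hk hi.le (by omega)
      (by omega)
    have := G.h_le_h (j := k + 1) (show i' < m by omega) hk le_rfl
    exact hmin i' hi' ⟨by omega, by omega⟩

theorem occ_out_v (G : LabelGrid m n h v) {x : ℤ} (hf : 1 ≤ flow m n h (x - 1)) :
    occ n (fun j => v m j) x = 1 - occ m (fun i => h i 0) x := by
  rw [← G.flow_transpose] at hf
  exact G.transpose.occ_out_h hf

/-! ### Two lines that start with the same label -/

section SameStart

variable {i j : ℕ} {x : ℤ}

/-- Two lines with the same initial label `x` collide at `x` unless lines are raised from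
`x - 1` to `x`. -/
theorem label_eq_of_flow_eq_zero (G : LabelGrid m n h v) (hi : i < m) (hj : j < n)
    (hx : h i 0 = x) (vx : v 0 j = x) (hf : flow m n h (x - 1) = 0) : h i j = x := by
  by_contra hne
  have := G.h_le_h (j := 0) hi (Nat.zero_le j) hj.le
  obtain ⟨k, hk, h1, h2, h3, -⟩ := G.exists_raise_h (x := x) hi hj.le hx.le (by omega)
  have h4 := G.v_lt_v (i := 0) hk hj (Nat.zero_le _)
  rw [← G.flow_transpose, flow_eq_zero_iff] at hf
  have h5 := hf k (by omega) (by omega)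
  have h6 := G.v_le_v (i := i) (show k < n by omega) hi.le le_rfl
  omega

theorem label_v_eq (G : LabelGrid m n h v) (hi : i < m) (hj : j < n)
    (vx : v 0 j = x) (hxj : h i j = x) : v i j = x := by
  by_contra hne
  have := G.v_le_v (i := 0) hj (Nat.zero_le i) hi.le
  obtain ⟨k, hk, h1, h2, -⟩ := G.exists_raise_v (x := x) hj hi.le vx.le (by omega)
  have := G.h_lt_h hk hi hj.le
  omega

theorem flow_eq_zero_of_label_eq (G : LabelGrid m n h v) (hi : i < m) (hj : j < n)
    (hx : h i 0 = x) (vx : v 0 j = x) (hxj : h i j = x) : flow m n h (x - 1) = 0 := by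
  rw [flow_eq_zero_iff]
  intro i₁ hi₁ hlow
  by_contra hhigh
  have hlt : i₁ < i := by
    by_contra hge
    rcases eq_or_lt_of_le (not_lt.1 hge) with rfl | hlt
    · omega
    · have := G.h_lt_h (j := 0) hlt hi₁ (Nat.zero_le _)
      omega
  have h1 := G.h_lt_h hlt hi hj.le
  obtain ⟨k, hk, h2, h3, h4, -⟩ := G.exists_raise_h hi₁ le_rfl hlow (not_le.1 hhigh)
  have hjk : j ≤ k := by
    by_contra hkj
    have := G.h_le_h (j := k + 1) hi₁ (show k + 1 ≤ j by omega) hj.le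
    omega
  have h5 := G.v_le_v (i := 0) hk (Nat.zero_le i₁) hi₁.le
  rcases eq_or_lt_of_le hjk with rfl | hlt'
  · omega
  · have := G.v_lt_v (i := 0) hlt' hk (Nat.zero_le _)
    omega

/-- Left of and below the collision of two lines with the same initial label `x`, the labels
`x - 1` are those of the lines that keep them to the end. -/
theorem hit_left_iff (G : LabelGrid m n h v) (hi : i < m) (hj : j < n)
    (hx : h i 0 = x) (vx : v 0 j = x) (hxj : h i j = x) :
    (0 < i ∧ h (i - 1) j = x - 1) ↔ occ m (fun i => h i n) (x - 1) = 1 := by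
  rw [G.occ_h_eq_one_iff le_rfl]
  have hf := G.flow_eq_zero_of_label_eq hi hj hx vx hxj
  rw [flow_eq_zero_iff] at hf
  constructor
  · rintro ⟨h0, h1⟩
    refine ⟨i - 1, by omega, ?_⟩
    have h2 := G.h_lt_h (j := 0) (show i - 1 < i by omega) hi (Nat.zero_le _)
    have h3 := hf (i - 1) (by omega) (by omega)
    have h4 := G.h_le_h (j := j) (show i - 1 < m by omega) hj.le le_rfl
    omega
  · rintro ⟨i', hi', h1⟩
    have h2 := G.h_le_h (j := 0) hi (Nat.zero_le n) le_rfl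
    have hlt : i' < i := by
      by_contra hge
      rcases eq_or_lt_of_le (not_lt.1 hge) with rfl | hlt
      · omega
      · have := G.h_lt_h (j := n) hlt hi' le_rfl
        omega
    have h3 := G.h_lt_h (j := 0) (show i - 1 < i by omega) hi (Nat.zero_le _)
    have h4 := hf (i - 1) (by omega) (by omega)
    have he : i' = i - 1 := by
      by_contra hne
      have := G.h_lt_h (j := n) (show i' < i - 1 by omega) (by omega) le_rfl
      omega
    subst he
    refine ⟨by omega, ?_⟩
    have h5 := G.h_le_h (j := j) hi' hj.le le_rfl
    by_contra hne
    have h6 := G.h_le_h (j := 0) hi' (Nat.zero_le j) hj.le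
    obtain ⟨k, hk, h7, h8, h9, -⟩ := G.exists_raise_h (x := x - 2) hi' le_rfl (by omega)
      (by omega)
    have hjk : j ≤ k := by
      by_contra hkj
      have := G.h_le_h (j := k + 1) hi' (show k + 1 ≤ j by omega) hj.le
      omega
    have h10 := G.v_le_v (i := 0) hk (Nat.zero_le (i - 1)) (by omega)
    rcases eq_or_lt_of_le hjk with rfl | hlt'
    · omega
    · have := G.v_lt_v (i := 0) hlt' hk (Nat.zero_le _)
      omega

theorem hit_below_iff (G : LabelGrid m n h v) (hi : i < m) (hj : j < n)
    (hx : h i 0 = x) (vx : v 0 j = x) (hxj : h i j = x) :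
    (0 < j ∧ v i (j - 1) = x - 1) ↔ occ n (fun j => v m j) (x - 1) = 1 :=
  G.transpose.hit_left_iff hj hi vx hx (G.label_v_eq hi hj vx hxj)

/-- If the collision of two lines with the same initial label `x` keeps the label, then a horizontal
line both starts and ends with the label `x`, so that as many lines are raised from `x` as from
`x - 1`, namely none. -/
theorem flow_of_stay (G : LabelGrid m n h v) (hi : i < m) (hj : j < n)
    (hx : h i 0 = x) (vx : v 0 j = x) (hxj : h i j = x) (hst : h i (j + 1) = x) :
    flow m n h x = 0 := by
  have hn : h i n = x := by
    have h1 := G.h_le_h (j := j) hi hj.le le_rfl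
    by_contra hne
    obtain ⟨k, hk, h2, h3, h4, -⟩ := G.exists_raise_h (x := x) hi le_rfl hx.le (by omega)
    have hjk : j + 1 ≤ k := by
      by_contra hkj
      have := G.h_le_h (j := k + 1) hi (show k + 1 ≤ j + 1 by omega) hj
      omega
    have h5 := G.v_lt_v (i := i) (show j < k by omega) hk hi.le
    have h6 := G.label_v_eq hi hj vx hxj
    omega
  have h1 := (G.occ_h_eq_one_iff le_rfl x).2 ⟨i, hi, hn⟩
  have h2 := (G.occ_h_eq_one_iff (Nat.zero_le _) x).2 ⟨i, hi, hx⟩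
  have h3 := G.flow_sub_flow x
  have h4 := G.flow_eq_zero_of_label_eq hi hj hx vx hxj
  omega

theorem flow_of_raise (G : LabelGrid m n h v) (hi : i < m) (hj : j < n)
    (hx : h i 0 = x) (hst : h i (j + 1) = x + 1) : 1 ≤ flow m n h x := by
  have h1 := G.h_le_h (j := j + 1) hi hj le_rfl
  exact one_le_flow_iff.2 ⟨i, hi, hx.le, by omega⟩

/-- The collision at `x - 1` diagonally before a collision at `x` of two lines with the same
initial label keeps the labels exactly if no lines are raised from `x - 2`. -/
theorem diagonal_before (G : LabelGrid m n h v) (hi : i < m) (hj : j < n)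
    (hx : h i 0 = x) (vx : v 0 j = x) (hxj : h i j = x) (hi0 : 0 < i) (hj0 : 0 < j)
    (hl : h (i - 1) j = x - 1) (hb : v i (j - 1) = x - 1) :
    (flow m n h (x - 2) = 0 ∧ h (i - 1) (j - 1) = x - 1 ∧ v (i - 1) (j - 1) = x - 1) ∨
      (1 ≤ flow m n h (x - 2) ∧ h (i - 1) (j - 1) = x - 2 ∧ v (i - 1) (j - 1) = x - 2) := by
  have hbox := G.box (i - 1) (j - 1) (by omega) (by omega)
  rw [Nat.sub_add_cancel hi0, Nat.sub_add_cancel hj0] at hbox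
  rcases hbox with h1 | h1 | h1
  · omega
  · left
    refine ⟨?_, by omega, by omega⟩
    by_contra hne
    have hf := flow_nonneg m n h (x - 2)
    have h2 := G.occ_out_h (x := x - 1) (by rw [show x - 1 - 1 = x - 2 by ring]; omega)
    have h3 := (G.hit_left_iff hi hj hx vx hxj).1 ⟨hi0, hl⟩
    have h4 := G.occ_v_eq_one_iff (Nat.zero_le m) (x - 1)
    have h5 : v 0 (j - 1) ≠ x - 1 := fun h => by
      have := h4.2 ⟨j - 1, by omega, h⟩
      omega
    have h6 := G.v_le_v (i := 0) (show j - 1 < n by omega) (Nat.zero_le (i - 1)) (by omega)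
    have h7 := G.raise_of_raised_v (i := i - 1) (j := j - 1) (by omega) (by omega) (by omega)
      (by omega)
    rw [Nat.sub_add_cancel hj0] at h7
    omega
  · right
    refine ⟨?_, by omega, by omega⟩
    have h2 := G.h_le_h (j := 0) (show i - 1 < m by omega) (Nat.zero_le (j - 1)) (by omega)
    have h3 := G.h_le_h (j := j) (show i - 1 < m by omega) hj.le le_rfl
    exact one_le_flow_iff.2 ⟨i - 1, by omega, by omega, by omega⟩

end SameStart

end LabelGrid

end HallLittlewood

/-! ### The weight of an admissible function as a product over sites -/

namespace HallLittlewood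

/-- The number of particles that cross from `x` to `x + 1` between `κ` and `κ'`. -/
def current {N : ℕ} (κ κ' : Sig N) (x : ℤ) : ℤ := dual κ' x - dual κ x

/-- The sum over `y ≤ x` of `current lam ν y - current μ ρ y`, in closed form. For the corners of
an admissible function this is the number of lines raised from `x` to `x + 1`. -/
def carry {N : ℕ} (μ ρ lam ν : Sig N) (x : ℤ) : ℤ :=
  trunc ν x - trunc lam x - trunc ρ x + trunc μ x

/-- The weight of a site `x` that holds `c` particles of `lam`. Here `a`, `b` say whether a
horizontal and a vertical line start with the label `x`, and `p`, `q` whether such lines end with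
the label `x - 1`; `k₂`, `k₁`, `k₀` are the numbers of lines raised from `x - 2`, `x - 1`, `x`. -/
noncomputable def siteWeight (t : ℝ) (a b p q k₂ k₁ k₀ : ℤ) (c : ℕ) : ℝ :=
  if a = 1 ∧ b = 1 ∧ k₁ = 0 then
    if p = 1 ∧ q = 1 then (if k₂ = 0 ↔ k₀ = 0 then 1 else 0)
    else if p = 1 ∨ q = 1 then (if k₀ = 0 then t else 1 - t)
    else if k₀ = 0 then (t - t ^ c) / (1 - t ^ c) else (1 - t) / (1 - t ^ c)
  else 1

/-- The site weight determined by four signatures. -/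
noncomputable def localWeight {N : ℕ} (t : ℝ) (μ ρ lam ν : Sig N) (x : ℤ) : ℝ :=
  siteWeight t (current lam ν x) (current lam μ x) (current μ ρ (x - 1)) (current ν ρ (x - 1))
    (carry μ ρ lam ν (x - 2)) (carry μ ρ lam ν (x - 1)) (carry μ ρ lam ν x) (mult lam x)

theorem occ_zero (s : ℕ → ℤ) (x : ℤ) : occ 0 s x = 0 := by simp [occ]

theorem dual_of_chain {N m : ℕ} {Λ : ℕ → Sig N} {s : ℕ → ℤ}
    (h : ∀ i < m, Moves (Λ i) (Λ (i + 1)) (s i)) {i : ℕ} (hi : i ≤ m) (y : ℤ) :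
    (dual (Λ i) y : ℤ) = dual (Λ 0) y + occ i s y := by
  induction i with
  | zero => simp [occ]
  | succ i ih =>
    have h1 := (moves_iff _ _ _).1 (h i (by omega)) y
    have h2 := ih (by omega)
    unfold occ at *
    rw [Finset.sum_range_succ, h1]
    push_cast
    omega

theorem trunc_of_chain {N m : ℕ} {Λ : ℕ → Sig N} {s : ℕ → ℤ}
    (h : ∀ i < m, Moves (Λ i) (Λ (i + 1)) (s i)) (y : ℤ) :
    trunc (Λ m) y = trunc (Λ 0) y + ∑ i ∈ Finset.range m, if s i ≤ y then 1 else 0 := by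
  induction m with
  | zero => simp
  | succ m ih =>
    rw [trunc_of_moves (h m (by omega)) y, ih fun i hi => h i (by omega),
      Finset.sum_range_succ, add_assoc]

namespace Filling.IsAdmissible

variable {N : ℕ} {F : Filling N} {m n : ℕ} {lam ν μ ρ : Sig N}

/-- The two paths around a box lead to the same signature. Hence two different labels cross
unchanged. -/
theorem labelGrid (hF : F.IsAdmissible m n lam ν μ ρ) : LabelGrid m n F.h F.v where
  lt_h := hF.lt_h
  lt_v := hF.lt_v
  box i j hi hj := by
    have h1 := (moves_iff _ _ _).1 (hF.move_h i j hi hj.le)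
    have h2 := (moves_iff _ _ _).1 (hF.move_v (i + 1) j hi hj)
    have h3 := (moves_iff _ _ _).1 (hF.move_v i j hi.le hj)
    have h4 := (moves_iff _ _ _).1 (hF.move_h i (j + 1) hi hj)
    have key : ∀ y, (if F.h i j = y then 1 else 0) + (if F.v (i + 1) j = y then 1 else 0) =
        (if F.v i j = y then 1 else 0) + (if F.h i (j + 1) = y then 1 else 0) := fun y => by
      have := h1 y
      have := h2 y
      have := h3 y
      have := h4 y
      omega
    by_cases he : F.h i j = F.v i j
    · have := hF.diag i j hi hj he
      omega
    · have k1 := key (F.h i j)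
      have k2 := key (F.v i j)
      left
      simp only [if_pos, if_neg he, if_neg (Ne.symm he)] at k1 k2
      refine ⟨he, ?_, ?_⟩
      · split_ifs at k1 <;> omega
      · split_ifs at k2 <;> omega

theorem dual_Lam (hF : F.IsAdmissible m n lam ν μ ρ) {i j : ℕ} (hi : i ≤ m) (hj : j ≤ n) (y : ℤ) :
    (dual (F.Lam i j) y : ℤ) =
      dual lam y + occ i (fun i => F.h i 0) y + occ j (fun j => F.v i j) y := by
  rw [dual_of_chain (m := n) (Λ := fun j => F.Lam i j) (s := fun j => F.v i j)
    (fun j hj => hF.move_v i j hi hj) hj y,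
    dual_of_chain (m := m) (Λ := fun i => F.Lam i 0) (s := fun i => F.h i 0)
    (fun i hi => hF.move_h i 0 hi (Nat.zero_le _)) hi y, hF.sw]

theorem current_lam_nu (hF : F.IsAdmissible m n lam ν μ ρ) (x : ℤ) :
    current lam ν x = occ m (fun i => F.h i 0) x := by
  have := hF.dual_Lam le_rfl (Nat.zero_le n) x
  rw [hF.se] at this
  rw [occ_zero] at this
  unfold current
  omega

theorem current_lam_mu (hF : F.IsAdmissible m n lam ν μ ρ) (x : ℤ) :
    current lam μ x = occ n (fun j => F.v 0 j) x := by
  have := hF.dual_Lam (Nat.zero_le m) le_rfl x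
  rw [hF.nw] at this
  rw [occ_zero] at this
  unfold current
  omega

theorem current_nu_rho (hF : F.IsAdmissible m n lam ν μ ρ) (x : ℤ) :
    current ν ρ x = occ n (fun j => F.v m j) x := by
  have h1 := hF.dual_Lam le_rfl le_rfl x
  have h2 := hF.current_lam_nu x
  rw [hF.ne] at h1
  unfold current at *
  omega

theorem current_mu_rho (hF : F.IsAdmissible m n lam ν μ ρ) (x : ℤ) :
    current μ ρ x = occ m (fun i => F.h i n) x := by
  have h1 := hF.labelGrid.occ_conservation x
  have h2 := hF.current_lam_nu x
  have h3 := hF.current_lam_mu x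
  have h4 := hF.current_nu_rho x
  unfold current at *
  omega

theorem carry_eq_flow (hF : F.IsAdmissible m n lam ν μ ρ) (x : ℤ) :
    carry μ ρ lam ν x = flow m n F.h x := by
  have h1 := trunc_of_chain (m := m) (Λ := fun i => F.Lam i 0) (s := fun i => F.h i 0)
    (fun i hi => hF.move_h i 0 hi (Nat.zero_le _)) x
  have h2 := trunc_of_chain (m := m) (Λ := fun i => F.Lam i n) (s := fun i => F.h i n)
    (fun i hi => hF.move_h i n hi le_rfl) x
  rw [hF.labelGrid.flow_eq_sub]
  unfold carry
  rw [hF.se, hF.sw] at h1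
  rw [hF.ne, hF.nw] at h2
  linarith

/-- All boxes have weight `1` except those in which two lines with the same initial label collide
before being raised. -/
theorem weight_eq_one (hF : F.IsAdmissible m n lam ν μ ρ) (t : ℝ) {i j : ℕ} (hi : i < m)
    (hj : j < n) (hne : ¬ (F.h i 0 = F.v 0 j ∧ F.h i j = F.v 0 j)) : F.weight t i j = 1 := by
  have G := hF.labelGrid
  by_cases he : F.h i j = F.v i j
  · have hT : ¬ F.IsTrivial i j := fun h => h.1 he
    have h1 := G.h_le_h (j := 0) hi (Nat.zero_le j) hj.le
    have h2 := G.v_le_v (i := 0) hj (Nat.zero_le i) hi.le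
    have key : F.IsOne i j ∧ ((0 < i ∧ F.IsOne (i - 1) j) ∨ (0 < j ∧ F.IsOne i (j - 1))) := by
      by_cases hv : F.v 0 j < F.v i j
      · have h3 := G.raise_of_raised_v hi hj he hv
        have h4 := G.box i j hi hj
        obtain ⟨k, hk, h5, h6, h7, h8⟩ := G.exists_raise_v (x := F.v i j - 1) hj hi.le (by omega)
          (by omega)
        have hki : i = k + 1 := by
          by_contra hki
          have h9 := G.h_lt_h (j := j) (show k < k + 1 by omega) (by omega) hj.le
          have h10 := G.h_lt_h (j := j) (show k + 1 < i by omega) hi hj.le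
          omega
        subst hki
        refine ⟨⟨he, h3, by omega⟩, Or.inl ⟨by omega, ?_⟩⟩
        rw [Nat.add_sub_cancel]
        exact ⟨by omega, by omega, by omega⟩
      · have hh : F.h i 0 < F.h i j := by omega
        have h3 := G.raise_of_raised_h hi hj he hh
        have h4 := G.box i j hi hj
        obtain ⟨k, hk, h5, h6, h7, h8⟩ := G.exists_raise_h (x := F.h i j - 1) hi hj.le (by omega)
          (by omega)
        have hkj : j = k + 1 := by
          by_contra hkj
          have h9 := G.v_lt_v (i := i) (show k < k + 1 by omega) (by omega) hi.le
          have h10 := G.v_lt_v (i := i) (show k + 1 < j by omega) hj hi.le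
          omega
        subst hkj
        refine ⟨⟨he, h3, by omega⟩, Or.inr ⟨by omega, ?_⟩⟩
        rw [Nat.add_sub_cancel]
        exact ⟨by omega, by omega, by omega⟩
    rw [Filling.weight, if_neg hT, if_pos key]
  · have hT : F.IsTrivial i j := by
      have := G.box i j hi hj
      exact ⟨he, by omega, by omega⟩
    rw [Filling.weight, if_pos hT]

/-- The weight of a box in which two lines with the same initial label `x` collide at `x`. All data
that enter it can be read off from the boundary of the rectangle: a hit from the left or from below
is a line that ends with the label `x - 1`, and the diagonally preceding box is a zero-box exactly
if no line is raised from `x - 2`. -/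
theorem weight_eq_siteWeight (hF : F.IsAdmissible m n lam ν μ ρ) (t : ℝ) {i j : ℕ} {x : ℤ}
    (hi : i < m) (hj : j < n) (hx : F.h i 0 = x) (vx : F.v 0 j = x) (hxj : F.h i j = x) :
    F.weight t i j = siteWeight t 1 1 (occ m (fun i => F.h i n) (x - 1))
      (occ n (fun j => F.v m j) (x - 1)) (flow m n F.h (x - 2)) 0 (flow m n F.h x)
      (mult lam x) := by
  have G := hF.labelGrid
  have hv := G.label_v_eq hi hj vx hxj
  have hbox := G.box i j hi hj
  have hT : ¬ F.IsTrivial i j := fun h => h.1 (hxj.trans hv.symm)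
  have hL : 0 < i → F.IsTrivial (i - 1) j := by
    intro h0
    have h1 := G.box (i - 1) j (by omega) hj
    have h2 := G.h_lt_h (j := j) (show i - 1 < i by omega) hi hj.le
    have h3 := G.v_le_v (i := 0) hj (Nat.zero_le (i - 1)) (by omega)
    have h4 := G.v_le_v (i := i - 1) hj (show i - 1 ≤ i by omega) hi.le
    rw [Nat.sub_add_cancel h0] at h1
    refine ⟨by omega, by omega, ?_⟩
    rw [Nat.sub_add_cancel h0]
    omega
  have hB : 0 < j → F.IsTrivial i (j - 1) := by
    intro h0
    have h1 := G.box i (j - 1) hi (by omega)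
    have h2 := G.v_lt_v (i := i) (show j - 1 < j by omega) hj hi.le
    have h3 := G.h_le_h (j := 0) hi (Nat.zero_le (j - 1)) (by omega)
    have h4 := G.h_le_h (j := j - 1) hi (show j - 1 ≤ j by omega) hj.le
    rw [Nat.sub_add_cancel h0] at h1
    refine ⟨by omega, ?_, by omega⟩
    rw [Nat.sub_add_cancel h0]
    omega
  have hL1 : ¬ (0 < i ∧ F.IsOne (i - 1) j) := fun h => (hL h.1).1 h.2.1
  have hB1 : ¬ (0 < j ∧ F.IsOne i (j - 1)) := fun h => (hB h.1).1 h.2.1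
  have HL : F.HitLeft i j ↔ occ m (fun i => F.h i n) (x - 1) = 1 := by
    rw [← G.hit_left_iff hi hj hx vx hxj, Filling.HitLeft, hxj]
  have HB : F.HitBelow i j ↔ occ n (fun j => F.v m j) (x - 1) = 1 := by
    rw [← G.hit_below_iff hi hj hx vx hxj, Filling.HitBelow, hxj]
  have HZ : F.ZeroBefore i j ↔ (F.HitLeft i j ∧ F.HitBelow i j) ∧ flow m n F.h (x - 2) = 0 := by
    constructor
    · rintro ⟨h0, h1, hz, h2⟩
      have hz' := hz
      rw [Filling.IsZero, Nat.sub_add_cancel h0, Nat.sub_add_cancel h1] at hz'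
      have hb : F.v i (j - 1) = x - 1 := by omega
      refine ⟨⟨⟨h0, h2⟩, ⟨h1, by omega⟩⟩, ?_⟩
      rcases G.diagonal_before hi hj hx vx hxj h0 h1 (by omega) hb with h | h
      · exact h.1
      · omega
    · rintro ⟨⟨⟨h0, h2⟩, ⟨h1, h3⟩⟩, hf⟩
      rcases G.diagonal_before hi hj hx vx hxj h0 h1 (by omega) (by omega) with h | h
      · refine ⟨h0, h1, ?_, h2⟩
        rw [Filling.IsZero, Nat.sub_add_cancel h0, Nat.sub_add_cancel h1]
        omega
      · omega
  have HO : F.OneBefore i j ↔ (F.HitLeft i j ∧ F.HitBelow i j) ∧ flow m n F.h (x - 2) ≠ 0 := by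
    constructor
    · rintro ⟨h0, h1, hz, h2⟩
      have hz' := hz
      rw [Filling.IsOne, Nat.sub_add_cancel h0, Nat.sub_add_cancel h1] at hz'
      have hb : F.v i (j - 1) = x - 1 := by omega
      refine ⟨⟨⟨h0, h2⟩, ⟨h1, by omega⟩⟩, ?_⟩
      rcases G.diagonal_before hi hj hx vx hxj h0 h1 (by omega) hb with h | h
      · omega
      · omega
    · rintro ⟨⟨⟨h0, h2⟩, ⟨h1, h3⟩⟩, hf⟩
      rcases G.diagonal_before hi hj hx vx hxj h0 h1 (by omega) (by omega) with h | h
      · omega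
      · refine ⟨h0, h1, ?_, h2⟩
        rw [Filling.IsOne, Nat.sub_add_cancel h0, Nat.sub_add_cancel h1]
        omega
  have HN : F.NoHit i j ↔ ¬ F.HitLeft i j ∧ ¬ F.HitBelow i j := by
    have h1 := fun h0 : 0 < i => G.h_lt_h (j := j) (show i - 1 < i by omega) hi hj.le
    have h2 := fun h0 : 0 < j => G.v_lt_v (i := i) (show j - 1 < j by omega) hj hi.le
    unfold Filling.NoHit Filling.HitLeft Filling.HitBelow
    omega
  have hC : F.NoHit i j → F.boxC t i j = t ^ mult lam x := by
    rintro ⟨h1, h2⟩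
    have key : ∀ y, x - 1 ≤ y → (dual (F.Lam i j) y : ℤ) = dual lam y := by
      intro y hy
      rw [hF.dual_Lam hi.le hj.le]
      have e1 : occ i (fun i => F.h i 0) y = 0 := Finset.sum_eq_zero fun i' hi' => if_neg (by
        change ¬ F.h i' 0 = y
        have hi' := Finset.mem_range.1 hi'
        have h3 := h1 (by omega)
        have h4 := G.h_le_h (j := 0) (show i' < m by omega) (Nat.zero_le j) hj.le
        rcases eq_or_lt_of_le (show i' ≤ i - 1 by omega) with h | h
        · rw [← h] at h3; omega
        · have := G.h_lt_h (j := j) h (by omega) hj.le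
          omega)
      have e2 : occ j (fun j => F.v i j) y = 0 := Finset.sum_eq_zero fun j' hj' => if_neg (by
        change ¬ F.v i j' = y
        have hj' := Finset.mem_range.1 hj'
        have h3 := h2 (by omega)
        rcases eq_or_lt_of_le (show j' ≤ j - 1 by omega) with h | h
        · rw [← h] at h3; omega
        · have := G.v_lt_v (i := i) h (by omega) hi.le
          omega)
      omega
    have k1 := key (x - 1) le_rfl
    have k2 := key x (by omega)
    have d1 := dual_sub_one lam x
    have d2 := dual_sub_one (F.Lam i j) x
    unfold Filling.boxC
    rw [hxj]
    congr 1
    change mult (F.Lam i j) x = mult lam x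
    omega
  have hf0 := flow_nonneg m n F.h x
  rw [Filling.weight, if_neg hT, if_neg (fun h => h.2.elim hL1 hB1), siteWeight,
    if_pos (show (1 : ℤ) = 1 ∧ (1 : ℤ) = 1 ∧ (0 : ℤ) = 0 from ⟨rfl, rfl, rfl⟩)]
  classical
  simp only [← HL, ← HB, HZ, HO]
  rcases hbox with hb | hb | hb
  · omega
  · have hZ : F.IsZero i j := hb
    have hO : ¬ F.IsOne i j := fun h => by have := h.2.1; omega
    have hk := G.flow_of_stay hi hj hx vx hxj (hb.2.1.trans hxj)
    simp only [hZ, hO, hk, true_and, false_and, if_false, iff_true, if_true]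
    by_cases p : F.HitLeft i j <;> by_cases q : F.HitBelow i j <;>
      simp only [p, q, HN, xor_true, xor_false, true_and, and_true, and_false, false_and,
        not_true, not_false_iff, id, if_true, if_false, or_true, or_false]
    rw [hC (HN.2 ⟨p, q⟩)]
  · have hO : F.IsOne i j := hb
    have hZ : ¬ F.IsZero i j := fun h => by have := h.2.1; omega
    have hk := G.flow_of_raise hi hj hx (hb.2.1.trans (by rw [hxj]))
    have hk' : flow m n F.h x ≠ 0 := by omega
    have hL' := eq_true hL
    have hB' := eq_true hB
    simp only [hZ, hO, hk', hL', hB', true_and, false_and, if_false, iff_false]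
    by_cases p : F.HitLeft i j <;> by_cases q : F.HitBelow i j <;>
      simp only [p, q, HN, xor_true, xor_false, true_and, and_true, and_false, false_and,
        not_true, not_false_iff, id, if_true, if_false, or_true, or_false]
    rw [hC (HN.2 ⟨p, q⟩)]

end Filling.IsAdmissible

theorem InWindow.current_eq_zero {N : ℕ} {A B : ℤ} {κ κ' : Sig N} (h : InWindow A B κ)
    (h' : InWindow A B κ') {x : ℤ} (hx : x < A ∨ B ≤ x + 1) : current κ κ' x = 0 := by
  unfold current
  rcases hx with hx | hx
  · rw [h.dual_low hx, h'.dual_low hx, sub_self]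
  · rw [h.dual_high hx, h'.dual_high hx, sub_self]

/-- The weight of an admissible function depends only on its four corners, and it is local in the
positions of the particles. -/
theorem Filling.IsAdmissible.prod_weight {N : ℕ} {F : Filling N} {m n : ℕ} {lam ν μ ρ : Sig N}
    (hF : F.IsAdmissible m n lam ν μ ρ) (t : ℝ) {A B : ℤ} (hl : InWindow A B lam)
    (hν : InWindow A B ν) :
    ∏ i ∈ Finset.range m, ∏ j ∈ Finset.range n, F.weight t i j =
      ∏ x ∈ Finset.Ico A B, localWeight t μ ρ lam ν x := by
  have G := hF.labelGrid
  have h1 : ∏ x ∈ Finset.Ico A B, localWeight t μ ρ lam ν x =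
      ∏ x ∈ (Finset.Ico A B).filter (fun x => current lam ν x = 1 ∧ current lam μ x = 1 ∧
        carry μ ρ lam ν (x - 1) = 0), localWeight t μ ρ lam ν x := by
    symm
    refine Finset.prod_filter_of_ne fun x _ hne => ?_
    by_contra hc
    exact hne (if_neg hc)
  have h2 : ∏ p ∈ Finset.range m ×ˢ Finset.range n, F.weight t p.1 p.2 =
      ∏ p ∈ (Finset.range m ×ˢ Finset.range n).filter (fun p => F.h p.1 0 = F.v 0 p.2 ∧
        F.h p.1 p.2 = F.v 0 p.2), F.weight t p.1 p.2 := by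
    symm
    refine Finset.prod_filter_of_ne fun p hp hne => ?_
    by_contra hc
    simp only [Finset.mem_product, Finset.mem_range] at hp
    exact hne (hF.weight_eq_one t hp.1 hp.2 hc)
  rw [← Finset.prod_product', h1, h2]
  refine Finset.prod_nbij (fun p => F.h p.1 0) ?_ ?_ ?_ ?_
  · rintro ⟨i, j⟩ hp
    simp only [Finset.mem_filter, Finset.mem_product, Finset.mem_range, Finset.mem_Ico] at hp ⊢
    obtain ⟨⟨hi, hj⟩, e1, e2⟩ := hp
    have c1 : current lam ν (F.h i 0) = 1 := by
      rw [hF.current_lam_nu, G.occ_h_eq_one_iff (Nat.zero_le _)]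
      exact ⟨i, hi, rfl⟩
    refine ⟨?_, c1, ?_, ?_⟩
    · by_contra hc
      have := hl.current_eq_zero hν (x := F.h i 0) (by omega)
      omega
    · rw [hF.current_lam_mu, G.occ_v_eq_one_iff (Nat.zero_le _)]
      exact ⟨j, hj, e1.symm⟩
    · rw [hF.carry_eq_flow]
      exact G.flow_eq_zero_of_label_eq hi hj rfl e1.symm (by omega)
  · rintro ⟨i, j⟩ hp ⟨i', j'⟩ hp' heq
    simp only [Finset.coe_filter, Finset.mem_product, Finset.mem_range,
      Set.mem_ofPred_eq] at hp hp' heq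
    have e1 : i = i' := by
      rcases lt_trichotomy i i' with h | h | h
      · have := G.h_lt_h (j := 0) h hp'.1.1 (Nat.zero_le _); omega
      · exact h
      · have := G.h_lt_h (j := 0) h hp.1.1 (Nat.zero_le _); omega
    have e2 : j = j' := by
      rcases lt_trichotomy j j' with h | h | h
      · have := G.v_lt_v (i := 0) h hp'.1.2 (Nat.zero_le _); omega
      · exact h
      · have := G.v_lt_v (i := 0) h hp.1.2 (Nat.zero_le _); omega
    rw [e1, e2]
  · intro x hx
    simp only [Finset.coe_filter, Finset.mem_Ico, Set.mem_ofPred_eq, hF.current_lam_nu,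
      hF.current_lam_mu, hF.carry_eq_flow, G.occ_h_eq_one_iff (Nat.zero_le _),
      G.occ_v_eq_one_iff (Nat.zero_le _)] at hx
    obtain ⟨-, ⟨i, hi, ex⟩, ⟨j, hj, ey⟩, hf⟩ := hx
    refine ⟨(i, j), ?_, ex⟩
    simp only [Finset.coe_filter, Finset.mem_product, Finset.mem_range, Set.mem_ofPred_eq]
    exact ⟨⟨hi, hj⟩, by omega, by rw [G.label_eq_of_flow_eq_zero hi hj ex ey hf, ey]⟩
  · rintro ⟨i, j⟩ hp
    simp only [Finset.mem_filter, Finset.mem_product, Finset.mem_range] at hp ⊢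
    obtain ⟨⟨hi, hj⟩, e1, e2⟩ := hp
    rw [hF.weight_eq_siteWeight t hi hj rfl e1.symm (by omega), localWeight, hF.current_lam_nu,
      hF.current_lam_mu, hF.current_mu_rho, hF.current_nu_rho, hF.carry_eq_flow,
      hF.carry_eq_flow, hF.carry_eq_flow,
      (G.occ_h_eq_one_iff (Nat.zero_le _) _).2 ⟨i, hi, rfl⟩,
      (G.occ_v_eq_one_iff (Nat.zero_le _) _).2 ⟨j, hj, e1.symm⟩,
      G.flow_eq_zero_of_label_eq hi hj rfl e1.symm (by omega)]

end HallLittlewood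

/-! ### The flip property -/

namespace HallLittlewood

theorem one_sub_pow_ne_zero {t : ℝ} (ht0 : 0 ≤ t) (ht1 : t < 1) {c : ℕ} (hc : c ≠ 0) :
    1 - t ^ c ≠ 0 := by
  have := pow_lt_one₀ ht0 ht1 hc
  linarith

/-- The factor by which the flip property fails between two neighbouring sites. It depends on the
state of the bond between them, so it cancels in the product over all sites. -/
noncomputable def bondFactor (t : ℝ) (a b p q k₁ k₀ : ℤ) : ℝ :=
  if k₁ ≠ 0 ∨ k₀ ≠ 0 then 1 - t
  else if a = 1 ∧ b = 1 ∧ p = 1 ∧ q = 1 then t else 1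

/-- The flip property at one site. The numbers with index `1` describe the bond to the left of
the site, those with index `0` the bond to its right. -/
theorem site_flip {t : ℝ} (ht0 : 0 ≤ t) (ht1 : t < 1) {a₁ b₁ p₁ q₁ a₀ b₀ p₀ q₀ k₂ k₁ k₀ : ℤ}
    {c cν cρ : ℕ}
    (ha₁ : a₁ = 0 ∨ a₁ = 1) (hb₁ : b₁ = 0 ∨ b₁ = 1) (hp₁ : p₁ = 0 ∨ p₁ = 1)
    (hq₁ : q₁ = 0 ∨ q₁ = 1) (ha₀ : a₀ = 0 ∨ a₀ = 1) (hb₀ : b₀ = 0 ∨ b₀ = 1)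
    (hp₀ : p₀ = 0 ∨ p₀ = 1) (hq₀ : q₀ = 0 ∨ q₀ = 1)
    (hk₂ : 0 ≤ k₂) (hk₁ : 0 ≤ k₁) (hk₀ : 0 ≤ k₀)
    (e₁ : k₁ - k₂ = a₁ - p₁) (e₁' : k₁ - k₂ = b₁ - q₁)
    (e₀ : k₀ - k₁ = a₀ - p₀) (e₀' : k₀ - k₁ = b₀ - q₀)
    (r₁ : 1 ≤ k₂ → p₁ = 1 - b₁ ∧ q₁ = 1 - a₁) (r₀ : 1 ≤ k₁ → p₀ = 1 - b₀ ∧ q₀ = 1 - a₀)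
    (hν : (cν : ℤ) = c + a₁ - a₀) (hρ : (cρ : ℤ) = cν + q₁ - q₀) :
    (if a₁ = 1 ∧ a₀ = 0 then 1 - t ^ cν else 1) * (if b₁ = 0 ∧ b₀ = 1 then 1 - t ^ c else 1) *
        siteWeight t a₀ b₀ p₁ q₁ k₂ k₁ k₀ c * bondFactor t a₁ b₁ p₁ q₁ k₂ k₁ =
      (if q₁ = 0 ∧ q₀ = 1 then 1 - t ^ cν else 1) * (if p₁ = 1 ∧ p₀ = 0 then 1 - t ^ cρ else 1) *
        siteWeight t p₁ q₁ a₀ b₀ k₀ k₁ k₂ cρ * bondFactor t a₀ b₀ p₀ q₀ k₁ k₀ := by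
  by_cases h1 : k₁ = 0
  · subst h1
    -- no line is raised from the left bond to the right one
    have hL : (p₁ = a₁ ∧ q₁ = b₁ ∧ k₂ = 0) ∨ (a₁ = 0 ∧ b₁ = 0 ∧ p₁ = 1 ∧ q₁ = 1 ∧ k₂ = 1) := by
      omega
    have hR : (p₀ = a₀ ∧ q₀ = b₀ ∧ k₀ = 0) ∨ (a₀ = 1 ∧ b₀ = 1 ∧ p₀ = 0 ∧ q₀ = 0 ∧ k₀ = 1) := by
      omega
    rcases hL with ⟨rfl, rfl, rfl⟩ | ⟨rfl, rfl, rfl, rfl, rfl⟩ <;>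
      rcases hR with ⟨rfl, rfl, rfl⟩ | ⟨rfl, rfl, rfl, rfl, rfl⟩
    · rcases ha₁ with rfl | rfl <;> rcases hb₁ with rfl | rfl <;> rcases ha₀ with rfl | rfl <;>
        rcases hb₀ with rfl | rfl <;> simp [siteWeight, bondFactor]
      all_goals first
        | (have e : c = cν + 1 := by omega
           subst e
           have := one_sub_pow_ne_zero ht0 ht1 (Nat.succ_ne_zero cν)
           field_simp
           try ring)
        | (have e : cρ = cν + 1 := by omega
           subst e
           have := one_sub_pow_ne_zero ht0 ht1 (Nat.succ_ne_zero cν)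
           field_simp
           try ring)
        | (have e : c = cν := by omega
           subst e
           simp)
        | (have e : cρ = cν := by omega
           subst e
           simp)
        | (have e : c = cρ := by omega
           subst e
           simp)
    · rcases ha₁ with rfl | rfl <;> rcases hb₁ with rfl | rfl <;> simp [siteWeight, bondFactor]
      · have := one_sub_pow_ne_zero ht0 ht1 (show c ≠ 0 by omega)
        field_simp
      · obtain rfl : c = cρ := by omega
        simp
    · rcases ha₀ with rfl | rfl <;> rcases hb₀ with rfl | rfl <;> simp [siteWeight, bondFactor]
      · have := one_sub_pow_ne_zero ht0 ht1 (show cρ ≠ 0 by omega)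
        field_simp
      · obtain rfl : c = cρ := by omega
        simp
    · obtain rfl : c = cρ := by omega
      simp [siteWeight, bondFactor]
  · obtain ⟨rfl, rfl⟩ := r₀ (by omega)
    obtain ⟨rfl, rfl⟩ : p₁ = 1 - b₁ ∧ q₁ = 1 - a₁ := by omega
    obtain rfl : c = cρ := by omega
    rcases ha₁ with rfl | rfl <;> rcases hb₁ with rfl | rfl <;> rcases ha₀ with rfl | rfl <;>
      rcases hb₀ with rfl | rfl <;> simp [siteWeight, bondFactor, h1]

theorem current_rev {N : ℕ} (κ κ' : Sig N) (x : ℤ) :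
    current (rev κ') (rev κ) x = current κ κ' (-x - 1) := by
  have h1 := dual_rev κ x
  have h2 := dual_rev κ' x
  unfold current
  omega

theorem carry_rev {N : ℕ} {μ ρ lam ν : Sig N} (hs : size ν - size lam = size ρ - size μ) (x : ℤ) :
    carry (rev ν) (rev lam) (rev ρ) (rev μ) x = carry μ ρ lam ν (-x - 2) := by
  unfold carry
  simp only [trunc_rev]
  linarith

theorem localWeight_rev {N : ℕ} (t : ℝ) {μ ρ lam ν : Sig N}
    (hs : size ν - size lam = size ρ - size μ) (x : ℤ) :
    localWeight t (rev ν) (rev lam) (rev ρ) (rev μ) (-x) =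
      siteWeight t (current μ ρ (x - 1)) (current ν ρ (x - 1)) (current lam ν x)
        (current lam μ x) (carry μ ρ lam ν x) (carry μ ρ lam ν (x - 1)) (carry μ ρ lam ν (x - 2))
        (mult ρ x) := by
  unfold localWeight
  simp only [current_rev, carry_rev hs, mult_rev]
  ring_nf

/-- The filling read backwards, with all signatures reversed. -/
def Filling.reflect {N : ℕ} (F : Filling N) (m n : ℕ) : Filling N where
  Lam i j := rev (F.Lam (m - i) (n - j))
  h i j := -F.h (m - 1 - i) (n - j) - 1
  v i j := -F.v (m - i) (n - 1 - j) - 1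

theorem Filling.IsAdmissible.reflect {N : ℕ} {F : Filling N} {m n : ℕ} {lam ν μ ρ : Sig N}
    (hF : F.IsAdmissible m n lam ν μ ρ) :
    (F.reflect m n).IsAdmissible m n (rev ρ) (rev μ) (rev ν) (rev lam) where
  sw := by simp [Filling.reflect, hF.ne]
  se := by simp [Filling.reflect, hF.nw]
  nw := by simp [Filling.reflect, hF.se]
  ne := by simp [Filling.reflect, hF.sw]
  move_h i j hi hj := by
    have := moves_rev (hF.move_h (m - 1 - i) (n - j) (by omega) (by omega))
    rw [show m - 1 - i + 1 = m - i by omega] at this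
    simpa only [Filling.reflect, show m - (i + 1) = m - 1 - i by omega] using this
  move_v i j hi hj := by
    have := moves_rev (hF.move_v (m - i) (n - 1 - j) (by omega) (by omega))
    rw [show n - 1 - j + 1 = n - j by omega] at this
    simpa only [Filling.reflect, show n - (j + 1) = n - 1 - j by omega] using this
  lt_h i j hi hj := by
    have := hF.lt_h (m - 1 - (i + 1)) (n - j) (by omega) (by omega)
    rw [show m - 1 - (i + 1) + 1 = m - 1 - i by omega] at this
    simp only [Filling.reflect]
    omega
  lt_v i j hi hj := by
    have := hF.lt_v (m - i) (n - 1 - (j + 1)) (by omega) (by omega)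
    rw [show n - 1 - (j + 1) + 1 = n - 1 - j by omega] at this
    simp only [Filling.reflect]
    omega
  diag i j hi hj he := by
    have := hF.labelGrid.box (m - 1 - i) (n - 1 - j) (by omega) (by omega)
    rw [show m - 1 - i + 1 = m - i by omega, show n - 1 - j + 1 = n - j by omega] at this
    simp only [Filling.reflect] at he ⊢
    rw [show m - (i + 1) = m - 1 - i by omega, show n - (j + 1) = n - 1 - j by omega]
    omega

/-- The conditions on four signatures under which admissible functions are considered. -/
def Square {N : ℕ} (μ ρ lam ν : Sig N) : Prop :=
  lam ≺ ν ∧ lam ≺ μ ∧ ν ≺ ρ ∧ μ ≺ ρ ∧ size ν - size lam = size ρ - size μ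

/-- There is an admissible function with the four given corners. -/
def HasFilling {N : ℕ} (μ ρ lam ν : Sig N) : Prop :=
  ∃ F : Filling N, F.IsAdmissible (size ν - size lam).toNat (size μ - size lam).toNat lam ν μ ρ

theorem Square.rev {N : ℕ} {μ ρ lam ν : Sig N} (h : Square μ ρ lam ν) :
    Square (rev ν) (rev lam) (rev ρ) (rev μ) := by
  obtain ⟨h1, h2, h3, h4, h5⟩ := h
  refine ⟨rev_interlaces_rev h4, rev_interlaces_rev h3, rev_interlaces_rev h2,
    rev_interlaces_rev h1, ?_⟩
  simp only [size_rev]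
  omega

theorem square_rev_iff {N : ℕ} {μ ρ lam ν : Sig N} :
    Square (rev ν) (rev lam) (rev ρ) (rev μ) ↔ Square μ ρ lam ν :=
  ⟨fun h => by simpa [rev_rev] using h.rev, Square.rev⟩

theorem HasFilling.rev {N : ℕ} {μ ρ lam ν : Sig N} (hs : Square μ ρ lam ν)
    (h : HasFilling μ ρ lam ν) : HasFilling (rev ν) (rev lam) (rev ρ) (rev μ) := by
  obtain ⟨F, hF⟩ := h
  have := hs.2.2.2.2
  refine ⟨F.reflect (size ν - size lam).toNat (size μ - size lam).toNat, ?_⟩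
  simp only [size_rev]
  convert hF.reflect using 1 <;> omega

theorem hasFilling_rev_iff {N : ℕ} {μ ρ lam ν : Sig N} (hs : Square μ ρ lam ν) :
    HasFilling (rev ν) (rev lam) (rev ρ) (rev μ) ↔ HasFilling μ ρ lam ν :=
  ⟨fun h => by simpa [rev_rev] using h.rev hs.rev, HasFilling.rev hs⟩

theorem U_eq_zero {N : ℕ} (t : ℝ) {μ ρ lam ν : Sig N}
    (h : ¬ (Square μ ρ lam ν ∧ HasFilling μ ρ lam ν)) : U t μ ρ lam ν = 0 := by
  unfold U
  split_ifs with h1 h2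
  · exact absurd ⟨h1, h2⟩ h
  · rfl
  · rfl

theorem square_of_U_ne_zero {N : ℕ} {t : ℝ} {μ ρ lam ν : Sig N} (h : U t μ ρ lam ν ≠ 0) :
    Square μ ρ lam ν ∧ HasFilling μ ρ lam ν := by
  by_contra hc
  exact h (U_eq_zero t hc)

theorem U_eq_prod {N : ℕ} (t : ℝ) {μ ρ lam ν : Sig N} (hs : Square μ ρ lam ν)
    (hF : HasFilling μ ρ lam ν) {A B : ℤ} (hl : InWindow A B lam) (hν : InWindow A B ν) :
    U t μ ρ lam ν = ∏ x ∈ Finset.Ico A B, localWeight t μ ρ lam ν x := by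
  unfold U
  rw [if_pos (show lam ≺ ν ∧ lam ≺ μ ∧ ν ≺ ρ ∧ μ ≺ ρ ∧
    size ν - size lam = size ρ - size μ from hs),
    dif_pos (show ∃ F : Filling N, F.IsAdmissible (size ν - size lam).toNat
      (size μ - size lam).toNat lam ν μ ρ from hF)]
  exact Filling.IsAdmissible.prod_weight hF.choose_spec t hl hν

/-- Two products agree if their factors agree up to a telescoping factor that is trivial at both
ends. The telescoping factor `w` may vanish in between. -/
theorem prod_Ico_eq_of_step {f g : ℤ → ℝ} {w : ℤ → ℝ} {A B : ℤ} (hAB : A ≤ B)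
    (hstep : ∀ x, f x * w (x - 1) = g x * w x) (hA : w (A - 1) = 1) (hB : w (B - 1) = 1) :
    ∏ x ∈ Finset.Ico A B, f x = ∏ x ∈ Finset.Ico A B, g x := by
  have key : ∏ x ∈ Finset.Ico A B, f x = (∏ x ∈ Finset.Ico A B, g x) * w (B - 1) := by
    clear hB
    induction B, hAB using Int.leInduction with
    | base => simp [hA]
    | succ B hAB ih =>
      rw [← Finset.insert_Ico_right_eq_Ico_add_one hAB, Finset.prod_insert (by simp),
        Finset.prod_insert (by simp), ih, add_sub_cancel_right]
      have := hstep B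
      linear_combination (∏ x ∈ Finset.Ico A B, g x) * this
  rw [key, hB, mul_one]

theorem carry_eq_zero {N : ℕ} {A B : ℤ} {μ ρ lam ν : Sig N}
    (hs : size ν - size lam = size ρ - size μ) (hl : InWindow A B lam)
    (hμ : InWindow A B μ) (hν : InWindow A B ν) (hρ : InWindow A B ρ) {x : ℤ}
    (hx : x < A ∨ B ≤ x + 2) : carry μ ρ lam ν x = 0 := by
  unfold carry
  rcases hx with hx | hx
  · have h {κ : Sig N} (hκ : InWindow A B κ) : trunc κ x = N * (x + 1) :=
      trunc_eq_of_le κ x fun a => by have := (hκ a).1; omega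
    rw [h hl, h hμ, h hν, h hρ]
    ring
  · have h {κ : Sig N} (hκ : InWindow A B κ) : trunc κ x = size κ :=
      trunc_eq_size κ x fun a => by have := (hκ a).2; omega
    rw [h hl, h hμ, h hν, h hρ]
    linarith

theorem current_eq_zero_or_one {N : ℕ} {κ κ' : Sig N} (h : κ ≺ κ') (x : ℤ) :
    current κ κ' x = 0 ∨ current κ κ' x = 1 := by
  have := (interlaces_iff κ κ').1 h x
  unfold current
  omega

theorem exists_common_window {N : ℕ} (κ₁ κ₂ κ₃ κ₄ : Sig N) : ∃ A B : ℤ, A ≤ B ∧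
    InWindow A B κ₁ ∧ InWindow A B κ₂ ∧ InWindow A B κ₃ ∧ InWindow A B κ₄ := by
  obtain ⟨M₁, h1, w1⟩ := exists_inWindow κ₁
  obtain ⟨M₂, h2, w2⟩ := exists_inWindow κ₂
  obtain ⟨M₃, h3, w3⟩ := exists_inWindow κ₃
  obtain ⟨M₄, h4, w4⟩ := exists_inWindow κ₄
  exact ⟨-(M₁ + M₂ + M₃ + M₄), M₁ + M₂ + M₃ + M₄, by omega, w1.mono (by omega) (by omega),
    w2.mono (by omega) (by omega), w3.mono (by omega) (by omega), w4.mono (by omega) (by omega)⟩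

theorem carry_sub_carry {N : ℕ} (μ ρ lam ν : Sig N) (x : ℤ) :
    carry μ ρ lam ν x - carry μ ρ lam ν (x - 1) = current lam ν x - current μ ρ x := by
  have h1 := trunc_sub_trunc ν x
  have h2 := trunc_sub_trunc lam x
  have h3 := trunc_sub_trunc ρ x
  have h4 := trunc_sub_trunc μ x
  unfold carry current
  linarith

/-- The flip property is the product over all sites of `site_flip`. -/
theorem flip {N : ℕ} {t : ℝ} (ht0 : 0 ≤ t) (ht1 : t < 1) (lam μ ν ρ : Sig N) :
    phi t ν lam * psi t μ lam * U t μ ρ lam ν =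
      psi t ρ ν * phi t ρ μ * U t (rev ν) (rev lam) (rev ρ) (rev μ) := by
  by_cases hc : Square μ ρ lam ν ∧ HasFilling μ ρ lam ν
  swap
  · rw [U_eq_zero t hc, U_eq_zero t, mul_zero, mul_zero]
    rintro ⟨h1, h2⟩
    rw [square_rev_iff] at h1
    exact hc ⟨h1, (hasFilling_rev_iff h1).1 h2⟩
  obtain ⟨hs, hf⟩ := hc
  have hs' := hs.2.2.2.2
  obtain ⟨A, B, hAB, wl, wμ, wν, wρ⟩ := exists_common_window lam μ ν ρ
  obtain ⟨F, hF⟩ := id hf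
  have G := hF.labelGrid
  have hraise : ∀ x, 1 ≤ carry μ ρ lam ν (x - 1) →
      current μ ρ x = 1 - current lam μ x ∧ current ν ρ x = 1 - current lam ν x := by
    intro x hx
    rw [hF.carry_eq_flow] at hx
    rw [hF.current_mu_rho, hF.current_nu_rho, hF.current_lam_nu, hF.current_lam_mu]
    exact ⟨G.occ_out_h hx, G.occ_out_v hx⟩
  have hnonneg : ∀ x, 0 ≤ carry μ ρ lam ν x := fun x => by
    rw [hF.carry_eq_flow]
    exact flow_nonneg _ _ _ _
  have hrev : ∏ x ∈ Finset.Ico (-B + 1) (-A + 1),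
      localWeight t (rev ν) (rev lam) (rev ρ) (rev μ) x =
      ∏ x ∈ Finset.Ico A B, localWeight t (rev ν) (rev lam) (rev ρ) (rev μ) (-x) := by
    refine Finset.prod_nbij' (fun x => -x) (fun x => -x) ?_ ?_ ?_ ?_ ?_
    · intro x hx
      simp only [Finset.mem_Ico] at hx ⊢
      omega
    · intro x hx
      simp only [Finset.mem_Ico] at hx ⊢
      omega
    · simp
    · simp
    · simp
  rw [U_eq_prod t hs hf wl wν, U_eq_prod t hs.rev (hf.rev hs) (inWindow_rev wρ)
    (inWindow_rev wμ), hrev, phi_eq_prod t hs.1 wν, psi_eq_prod t hs.2.1 wl,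
    psi_eq_prod t hs.2.2.1 wν, phi_eq_prod t hs.2.2.2.1 wρ]
  simp only [← Finset.prod_mul_distrib]
  refine prod_Ico_eq_of_step (w := fun x => bondFactor t (current lam ν x) (current lam μ x)
    (current μ ρ x) (current ν ρ x) (carry μ ρ lam ν (x - 1)) (carry μ ρ lam ν x)) hAB ?_ ?_ ?_
  · intro x
    rw [localWeight_rev t hs', localWeight]
    have e1 := carry_sub_carry μ ρ lam ν (x - 1)
    have e0 := carry_sub_carry μ ρ lam ν x
    have d1 := dual_sub_one lam x
    have d2 := dual_sub_one ν x
    have d3 := dual_sub_one ρ x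
    rw [show x - 1 - 1 = x - 2 by ring] at e1 ⊢
    have key := site_flip ht0 ht1 (c := mult lam x) (cν := mult ν x) (cρ := mult ρ x)
      (current_eq_zero_or_one hs.1 (x - 1)) (current_eq_zero_or_one hs.2.1 (x - 1))
      (current_eq_zero_or_one hs.2.2.2.1 (x - 1)) (current_eq_zero_or_one hs.2.2.1 (x - 1))
      (current_eq_zero_or_one hs.1 x) (current_eq_zero_or_one hs.2.1 x)
      (current_eq_zero_or_one hs.2.2.2.1 x) (current_eq_zero_or_one hs.2.2.1 x)
      (hnonneg (x - 2)) (hnonneg (x - 1)) (hnonneg x)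
      e1 (by unfold current at *; omega) e0 (by unfold current at *; omega)
      (fun h => hraise (x - 1) (by rw [show x - 1 - 1 = x - 2 by ring]; exact h)) (hraise x)
      (by unfold current; omega) (by unfold current; omega)
    have c1 : ∀ {κ κ' : Sig N} {y : ℤ}, (dual κ' y = dual κ y ↔ current κ κ' y = 0) := by
      intro κ κ' y; unfold current; omega
    have c2 : ∀ {κ κ' : Sig N} {y : ℤ}, (dual κ' y = dual κ y + 1 ↔ current κ κ' y = 1) := by
      intro κ κ' y; unfold current; omega
    simp only [c1, c2]
    exact key
  · simp only [bondFactor]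
    rw [wl.current_eq_zero wν (Or.inl (by omega)),
      carry_eq_zero hs' wl wμ wν wρ (Or.inl (by omega)),
      carry_eq_zero hs' wl wμ wν wρ (Or.inl (by omega))]
    simp
  · simp only [bondFactor]
    rw [wl.current_eq_zero wν (Or.inr (by omega)),
      carry_eq_zero hs' wl wμ wν wρ (Or.inr (by omega)),
      carry_eq_zero hs' wl wμ wν wρ (Or.inr (by omega))]
    simp

end HallLittlewood

/-! ### Growing an admissible function from its boundary -/

namespace HallLittlewood

/-- The sites at which particles move between two interlacing signatures, in increasing order. -/
theorem exists_enumeration {N : ℕ} {κ κ' : Sig N} (h : κ ≺ κ') : ∃ (m : ℕ) (s : ℕ → ℤ),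
    (∀ i i', i < i' → i' < m → s i < s i') ∧ ∀ x, occ m s x = current κ κ' x := by
  obtain ⟨A, B, -, w, w', -⟩ := exists_common_window κ κ' κ κ'
  set H := (Finset.Ico A B).filter fun x => current κ κ' x = 1 with hH
  have hmem : ∀ x, x ∈ H ↔ current κ κ' x = 1 := by
    intro x
    simp only [hH, Finset.mem_filter, Finset.mem_Ico, and_iff_right_iff_imp]
    intro hx
    by_contra hc
    have := w.current_eq_zero w' (x := x) (by omega)
    omega
  have hs : ∀ i i', i < i' → i' < H.card →
      (if hi : i < H.card then H.orderEmbOfFin rfl ⟨i, hi⟩ else 0) <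
        (if hi : i' < H.card then H.orderEmbOfFin rfl ⟨i', hi⟩ else 0) := by
    intro i i' hi hi'
    rw [dif_pos hi', dif_pos (hi.trans hi')]
    exact (H.orderEmbOfFin rfl).strictMono hi
  refine ⟨H.card, fun i => if hi : i < H.card then H.orderEmbOfFin rfl ⟨i, hi⟩ else 0, hs,
    fun x => ?_⟩
  classical
  rw [occ_eq_ite hs]
  have hx := hmem x
  rw [← H.mem_coe, ← Finset.range_orderEmbOfFin H rfl] at hx
  rcases current_eq_zero_or_one h x with h0 | h1
  · rw [h0, if_neg]
    rintro ⟨i, hi, hix⟩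
    rw [dif_pos hi] at hix
    have := hx.1 ⟨_, hix⟩
    omega
  · rw [h1, if_pos]
    obtain ⟨⟨i, hi⟩, hix⟩ := hx.2 h1
    exact ⟨i, hi, by rw [dif_pos hi]; exact hix⟩

/-- The labels of a vertical line with initial label `a`, read from left to right, when it meets
horizontal lines with initial labels `h₀` and present labels `hr`. A collision raises the labels,
unless it is the first one for both lines and happens outside of `S`. -/
def vRow (S : Finset ℤ) (h₀ hr : ℕ → ℤ) (a : ℤ) : ℕ → ℤ
  | 0 => a
  | i + 1 =>
    if hr i = vRow S h₀ hr a i ∧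
        ¬ (h₀ i = vRow S h₀ hr a i ∧ a = vRow S h₀ hr a i ∧ vRow S h₀ hr a i ∉ S) then
      vRow S h₀ hr a i + 1 else vRow S h₀ hr a i

/-- The labels of the horizontal lines after `j` collisions each. -/
def hRow (S : Finset ℤ) (h₀ v₀ : ℕ → ℤ) : ℕ → ℕ → ℤ
  | 0 => h₀
  | j + 1 => fun i =>
    if hRow S h₀ v₀ j i = vRow S h₀ (hRow S h₀ v₀ j) (v₀ j) i ∧
        ¬ (h₀ i = vRow S h₀ (hRow S h₀ v₀ j) (v₀ j) i ∧
          v₀ j = vRow S h₀ (hRow S h₀ v₀ j) (v₀ j) i ∧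
          vRow S h₀ (hRow S h₀ v₀ j) (v₀ j) i ∉ S) then
      hRow S h₀ v₀ j i + 1 else hRow S h₀ v₀ j i

/-- The horizontal labels of the grid that grows from the boundary labels `h₀`, `v₀` when exactly
the first collisions at labels in `S` raise the labels. -/
def gridH (S : Finset ℤ) (h₀ v₀ : ℕ → ℤ) (i j : ℕ) : ℤ := hRow S h₀ v₀ j i

/-- The vertical labels of the same grid. -/
def gridV (S : Finset ℤ) (h₀ v₀ : ℕ → ℤ) (i j : ℕ) : ℤ :=
  vRow S h₀ (hRow S h₀ v₀ j) (v₀ j) i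

section Grid

variable {S : Finset ℤ} {h₀ v₀ : ℕ → ℤ}

theorem gridH_zero (i : ℕ) : gridH S h₀ v₀ i 0 = h₀ i := rfl

theorem gridV_zero (j : ℕ) : gridV S h₀ v₀ 0 j = v₀ j := rfl

theorem gridH_succ (i j : ℕ) : gridH S h₀ v₀ i (j + 1) =
    if gridH S h₀ v₀ i j = gridV S h₀ v₀ i j ∧ ¬ (h₀ i = gridV S h₀ v₀ i j ∧
      v₀ j = gridV S h₀ v₀ i j ∧ gridV S h₀ v₀ i j ∉ S) then
    gridH S h₀ v₀ i j + 1 else gridH S h₀ v₀ i j := rfl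

theorem gridV_succ (i j : ℕ) : gridV S h₀ v₀ (i + 1) j =
    if gridH S h₀ v₀ i j = gridV S h₀ v₀ i j ∧ ¬ (h₀ i = gridV S h₀ v₀ i j ∧
      v₀ j = gridV S h₀ v₀ i j ∧ gridV S h₀ v₀ i j ∉ S) then
    gridV S h₀ v₀ i j + 1 else gridV S h₀ v₀ i j := rfl

theorem le_gridH (i j : ℕ) : h₀ i ≤ gridH S h₀ v₀ i j := by
  induction j with
  | zero => exact le_rfl
  | succ j ih =>
    rw [gridH_succ]
    split_ifs <;> omega

theorem le_gridV (i j : ℕ) : v₀ j ≤ gridV S h₀ v₀ i j := by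
  induction i with
  | zero => exact le_rfl
  | succ i ih =>
    rw [gridV_succ]
    split_ifs <;> omega

theorem labelGrid_grid {m n : ℕ} (hh : ∀ i i', i < i' → i' < m → h₀ i < h₀ i')
    (hv : ∀ j j', j < j' → j' < n → v₀ j < v₀ j') :
    LabelGrid m n (gridH S h₀ v₀) (gridV S h₀ v₀) where
  lt_h i j hi hj := by
    clear hj
    induction j with
    | zero => exact hh i (i + 1) (by omega) (by omega)
    | succ j ih =>
      have h1 := le_gridV (S := S) (h₀ := h₀) (v₀ := v₀) i j
      have h2 := gridV_succ (S := S) (h₀ := h₀) (v₀ := v₀) i j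
      rw [gridH_succ, gridH_succ]
      split_ifs at h2 ⊢ <;> omega
  lt_v i j hi hj := by
    clear hi
    induction i with
    | zero => exact hv j (j + 1) (by omega) (by omega)
    | succ i ih =>
      have h1 := le_gridH (S := S) (h₀ := h₀) (v₀ := v₀) i j
      have h2 := gridH_succ (S := S) (h₀ := h₀) (v₀ := v₀) i j
      rw [gridV_succ, gridV_succ]
      split_ifs at h2 ⊢ <;> omega
  box i j hi hj := by
    rw [gridH_succ, gridV_succ]
    split_ifs <;> omega

end Grid

/-- The carries `k` follow the rule by which the choices in `S` and the boundary data `a`, `b`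
determine them from left to right. -/
def CarryRule (a b : ℤ → ℤ) (S : Finset ℤ) (k : ℤ → ℤ) : Prop :=
  ∀ x, 0 ≤ k x ∧ (1 ≤ k (x - 1) → k x = k (x - 1) - 1 + a x + b x) ∧
    (k (x - 1) = 0 → k x = if a x = 1 ∧ b x = 1 ∧ x ∈ S then 1 else 0)

/-- The carry at `y` depends only on the choices made up to `y`. -/
theorem CarryRule.unique {a b : ℤ → ℤ} {S S' : Finset ℤ} {k k' : ℤ → ℤ}
    (hk : CarryRule a b S k) (hk' : CarryRule a b S' k') {A : ℤ} (h0 : ∀ x < A, k x = 0)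
    (h0' : ∀ x < A, k' x = 0) (y : ℤ) (hS : ∀ x ≤ y, x ∈ S ↔ x ∈ S') : k y = k' y := by
  rcases lt_or_ge y A with hy | hy
  · rw [h0 y hy, h0' y hy]
  have key : ∀ z, A - 1 ≤ z → z ≤ y → k z = k' z := by
    intro z hz
    induction z, hz using Int.leInduction with
    | base => intro _; rw [h0 _ (by omega), h0' _ (by omega)]
    | succ z hz ih =>
      intro hzy
      have e := ih (by omega)
      have h1 := hk (z + 1)
      have h2 := hk' (z + 1)
      have h3 := (hk z).1
      rw [add_sub_cancel_right] at h1 h2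
      rw [if_congr (by rw [hS (z + 1) hzy]) rfl rfl] at h1
      by_cases hz0 : k z = 0
      · rw [h1.2.2 hz0, h2.2.2 (by omega)]
      · rw [h1.2.1 (by omega), h2.2.1 (by omega), e]
  exact key y (by omega) le_rfl

theorem LabelGrid.carryRule {m n : ℕ} {h v : ℕ → ℕ → ℤ} (G : LabelGrid m n h v) {S : Finset ℤ}
    (hS : ∀ x, flow m n h (x - 1) = 0 → occ m (fun i => h i 0) x = 1 →
      occ n (fun j => v 0 j) x = 1 → (x ∈ S ↔ flow m n h x ≠ 0)) :
    CarryRule (occ m fun i => h i 0) (occ n fun j => v 0 j) S (flow m n h) := by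
  intro x
  have h1 := G.flow_sub_flow x
  have h2 := G.flow_sub_flow' x
  have h3 := flow_nonneg m n h x
  have h4 := occ_nonneg m (fun i => h i n) x
  have h5 := occ_nonneg n (fun j => v m j) x
  have h6 := occ_nonneg m (fun i => h i 0) x
  have h7 := occ_nonneg n (fun j => v 0 j) x
  have h8 := G.occ_h_le_one (Nat.zero_le n) x
  have h9 := G.occ_v_le_one (Nat.zero_le m) x
  refine ⟨h3, fun hf => ?_, fun hf => ?_⟩
  · have := G.occ_out_h hf
    omega
  · have := hS x hf
    split_ifs with hc
    · have := (this hc.1 hc.2.1).1 hc.2.2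
      omega
    · by_contra hne
      exact hc ⟨by omega, by omega, (this (by omega) (by omega)).2 hne⟩

theorem grid_carryRule {m n : ℕ} {h₀ v₀ : ℕ → ℤ} (S : Finset ℤ)
    (hh : ∀ i i', i < i' → i' < m → h₀ i < h₀ i') (hv : ∀ j j', j < j' → j' < n → v₀ j < v₀ j') :
    CarryRule (occ m h₀) (occ n v₀) S (flow m n (gridH S h₀ v₀)) := by
  have G := labelGrid_grid (S := S) hh hv
  refine G.carryRule fun x hf ha hb => ?_
  obtain ⟨i, hi, hix⟩ := (G.occ_h_eq_one_iff (Nat.zero_le _) x).1 ha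
  obtain ⟨j, hj, hjx⟩ := (G.occ_v_eq_one_iff (Nat.zero_le _) x).1 hb
  have e1 := G.label_eq_of_flow_eq_zero hi hj hix hjx hf
  have e2 := G.label_v_eq hi hj hjx e1
  have e3 := gridH_succ (S := S) (h₀ := h₀) (v₀ := v₀) i j
  rw [gridH_zero] at hix
  rw [gridV_zero] at hjx
  constructor
  · intro hxS
    rw [e2, if_pos ⟨e1, fun h => h.2.2 hxS⟩, e1] at e3
    have := G.flow_of_raise hi hj hix e3
    omega
  · intro hne
    by_contra hxS
    rw [e2, if_neg (fun h => h.2 ⟨hix, hjx, hxS⟩), e1] at e3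
    exact hne (G.flow_of_stay hi hj hix hjx e1 e3)

/-- The conjugate coordinates of the signature at the vertex `(i, j)`, if there is one. -/
def gridDual {N : ℕ} (lam : Sig N) (S : Finset ℤ) (h₀ v₀ : ℕ → ℤ) (i j : ℕ) (y : ℤ) : ℤ :=
  dual lam y + occ i h₀ y + occ j (fun j => gridV S h₀ v₀ i j) y

theorem occ_succ (m : ℕ) (s : ℕ → ℤ) (x : ℤ) :
    occ (m + 1) s x = occ m s x + if s m = x then 1 else 0 := by
  unfold occ
  rw [Finset.sum_range_succ]

section GridDual

variable {N : ℕ} {lam : Sig N} {S : Finset ℤ} {h₀ v₀ : ℕ → ℤ}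

theorem gridDual_succ_right (i j : ℕ) (y : ℤ) : gridDual lam S h₀ v₀ i (j + 1) y =
    gridDual lam S h₀ v₀ i j y + if gridV S h₀ v₀ i j = y then 1 else 0 := by
  unfold gridDual
  rw [occ_succ]
  ring

theorem gridDual_succ_left (i j : ℕ) (y : ℤ) : gridDual lam S h₀ v₀ (i + 1) j y =
    gridDual lam S h₀ v₀ i j y + if gridH S h₀ v₀ i j = y then 1 else 0 := by
  induction j with
  | zero =>
    unfold gridDual
    rw [occ_succ, occ_zero, occ_zero, gridH_zero]
    ring
  | succ j ih =>
    rw [gridDual_succ_right, gridDual_succ_right, ih]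
    have h1 := gridH_succ (S := S) (h₀ := h₀) (v₀ := v₀) i j
    have h2 := gridV_succ (S := S) (h₀ := h₀) (v₀ := v₀) i j
    split_ifs at h1 h2 with hc
    · rw [h1, h2, hc.1]
    · rw [h1, h2]
      ring

/-- Moving the particles one by one in increasing order of the sites passes through signatures
only. -/
theorem antitone_partial {κ : Sig N} {m : ℕ} {s : ℕ → ℤ}
    (hs : ∀ i i', i < i' → i' < m → s i < s i') (hcur : ∀ x, occ m s x = current lam κ x) {i : ℕ}
    (hi : i ≤ m) (y : ℤ) :
    (dual lam y : ℤ) + occ i s y ≤ dual lam (y - 1) + occ i s (y - 1) := by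
  classical
  have hs' : ∀ i' i'', i' < i'' → i'' < i → s i' < s i'' := fun a b h1 h2 =>
    hs a b h1 (by omega)
  have h1 := dual_antitone lam (show y - 1 ≤ y by omega)
  have h2 := dual_antitone κ (show y - 1 ≤ y by omega)
  have h3 := occ_nonneg i s (y - 1)
  rw [occ_eq_ite hs' y]
  split_ifs with hy
  · obtain ⟨i', hi', hy⟩ := hy
    have h4 := hcur y
    have h5 := hcur (y - 1)
    rw [occ_eq_ite hs, if_pos ⟨i', by omega, hy⟩] at h4
    rw [occ_eq_ite hs] at h5
    rw [occ_eq_ite hs'] at h3 ⊢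
    unfold current at h4 h5
    split_ifs at h5 with hc
    · obtain ⟨i'', hi'', hy'⟩ := hc
      have hlt : i'' < i' := by
        by_contra hge
        rcases eq_or_lt_of_le (not_lt.1 hge) with rfl | hlt
        · omega
        · have := hs i' i'' hlt hi''
          omega
      rw [if_pos ⟨i'', by omega, hy'⟩]
      omega
    · omega
  · omega

/-- The moves of a growing grid are possible at all vertices provided that a collision that keeps
both labels happens where there are two particles. This is automatic if one of them has just
arrived, so the multiplicities in `lam` matter only for collisions without a hit. -/
theorem gridDual_antitone {μ ν : Sig N} {m n : ℕ}
    (hh : ∀ i i', i < i' → i' < m → h₀ i < h₀ i') (hv : ∀ j j', j < j' → j' < n → v₀ j < v₀ j')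
    (ha : ∀ x, occ m h₀ x = current lam ν x) (hb : ∀ x, occ n v₀ x = current lam μ x)
    (hS : ∀ x ∉ S, occ m h₀ x = 1 → occ n v₀ x = 1 → flow m n (gridH S h₀ v₀) (x - 1) = 0 →
      occ m (fun i => gridH S h₀ v₀ i n) (x - 1) ≠ 1 →
      occ n (fun j => gridV S h₀ v₀ m j) (x - 1) ≠ 1 → mult lam x ≠ 1) :
    ∀ s i j, i + j = s → i ≤ m → j ≤ n → ∀ y,
      gridDual lam S h₀ v₀ i j y ≤ gridDual lam S h₀ v₀ i j (y - 1) := by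
  have G := labelGrid_grid (S := S) hh hv
  intro s
  induction s using Nat.strong_induction_on with
  | _ s ih =>
    intro i j hij hi hj y
    rcases i with _ | i
    · have := antitone_partial hv hb hj y
      simp only [gridDual, occ_zero, gridV_zero, add_zero] at this ⊢
      exact this
    rcases j with _ | j
    · have := antitone_partial hh ha hi y
      simp only [gridDual, occ_zero, add_zero] at this ⊢
      exact this
    have q0 := ih (i + j) (by omega) i j rfl (by omega) (by omega)
    have q1 := ih (i + 1 + j) (by omega) (i + 1) j rfl (by omega) (by omega)
    have q2 := ih (i + (j + 1)) (by omega) i (j + 1) rfl (by omega) (by omega)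
    simp only [gridDual_succ_left, gridDual_succ_right] at q0 q1 q2
    rw [gridDual_succ_right (i + 1), gridDual_succ_right (i + 1), gridDual_succ_left,
      gridDual_succ_left]
    have b1 := gridV_succ (S := S) (h₀ := h₀) (v₀ := v₀) i j
    by_cases he : gridH S h₀ v₀ i j = gridV S h₀ v₀ i j
    · by_cases hc : h₀ i = gridV S h₀ v₀ i j ∧ v₀ j = gridV S h₀ v₀ i j ∧
        gridV S h₀ v₀ i j ∉ S
      · -- the collision keeps both labels, so the site needs two particles
        rw [if_neg (fun h => h.2 hc)] at b1
        rw [b1, he]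
        obtain ⟨c1, c2, c3⟩ := hc
        generalize hx : gridV S h₀ v₀ i j = x at *
        have key : gridDual lam S h₀ v₀ i j x + 2 ≤ gridDual lam S h₀ v₀ i j (x - 1) := by
          have k1 := G.hit_left_iff hi hj c1 c2 he
          have k2 := G.hit_below_iff hi hj c1 c2 he
          by_cases hl : 0 < i ∧ gridH S h₀ v₀ (i - 1) j = x - 1
          · obtain ⟨h0, hl⟩ := hl
            obtain ⟨i, rfl⟩ := Nat.exists_eq_succ_of_ne_zero h0.ne'
            rw [Nat.succ_sub_one] at hl
            have q := ih (i + (j + 1)) (by omega) i (j + 1) rfl (by omega) (by omega) x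
            have hvx : gridV S h₀ v₀ i j = x := by
              have e1 := le_gridV (S := S) (h₀ := h₀) (v₀ := v₀) i j
              have e2 := G.v_le_v (j := j) hj (show i ≤ i + 1 by omega) (by omega)
              simp only [Nat.succ_eq_add_one] at hx
              omega
            simp only [Nat.succ_eq_add_one, gridDual_succ_left, gridDual_succ_right, hl,
              hvx] at q ⊢
            split_ifs at q ⊢ <;> omega
          by_cases hbl : 0 < j ∧ gridV S h₀ v₀ i (j - 1) = x - 1
          · obtain ⟨h0, hbl⟩ := hbl
            obtain ⟨j, rfl⟩ := Nat.exists_eq_succ_of_ne_zero h0.ne'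
            rw [Nat.succ_sub_one] at hbl
            have q := ih (i + 1 + j) (by omega) (i + 1) j rfl (by omega) (by omega) x
            have hhx : gridH S h₀ v₀ i j = x := by
              have e1 := le_gridH (S := S) (h₀ := h₀) (v₀ := v₀) i j
              have e2 := G.h_le_h (i := i) hi (show j ≤ j + 1 by omega) (by omega)
              simp only [Nat.succ_eq_add_one] at he
              omega
            simp only [Nat.succ_eq_add_one, gridDual_succ_left, gridDual_succ_right, hbl,
              hhx] at q ⊢
            split_ifs at q ⊢ <;> omega
          have hm := hS x c3 ((G.occ_h_eq_one_iff (Nat.zero_le n) x).2 ⟨i, hi, c1⟩)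
            ((G.occ_v_eq_one_iff (Nat.zero_le m) x).2 ⟨j, hj, c2⟩)
            (G.flow_eq_zero_of_label_eq hi hj c1 c2 he) (fun h => hl (k1.2 h))
            (fun h => hbl (k2.2 h))
          have hd : ∀ y, x - 1 ≤ y → gridDual lam S h₀ v₀ i j y = dual lam y := by
            intro y hy
            have e1 : occ i h₀ y = 0 := Finset.sum_eq_zero fun i' hi' => if_neg (by
              have hi' := Finset.mem_range.1 hi'
              have h4 := le_gridH (S := S) (h₀ := h₀) (v₀ := v₀) i' j
              have h5 := G.h_lt_h (j := j) (show i - 1 < i by omega) hi (by omega)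
              have h6 : gridH S h₀ v₀ i' j ≤ gridH S h₀ v₀ (i - 1) j := by
                rcases eq_or_lt_of_le (show i' ≤ i - 1 by omega) with h | h
                · rw [h]
                · exact (G.h_lt_h h (by omega) (by omega)).le
              omega)
            have e2 : occ j (fun j => gridV S h₀ v₀ i j) y = 0 :=
              Finset.sum_eq_zero fun j' hj' => if_neg (by
                change ¬ gridV S h₀ v₀ i j' = y
                have hj' := Finset.mem_range.1 hj'
                have h5 := G.v_lt_v (i := i) (show j - 1 < j by omega) hj (by omega)
                have h6 : gridV S h₀ v₀ i j' ≤ gridV S h₀ v₀ i (j - 1) := by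
                  rcases eq_or_lt_of_le (show j' ≤ j - 1 by omega) with h | h
                  · rw [h]
                  · exact (G.v_lt_v h (by omega) (by omega)).le
                omega)
            unfold gridDual
            omega
          have e1 := hd x (by omega)
          have e2 := hd (x - 1) le_rfl
          have e3 := dual_sub_one lam x
          have e4 := q1 x
          rw [he] at e4
          split_ifs at e4 <;> omega
        have := q0 y
        by_cases hxy : x = y
        · subst hxy
          split_ifs <;> omega
        · split_ifs <;> omega
      · rw [if_pos ⟨he, hc⟩] at b1
        rw [b1, he]
        have e0 := q0 y
        have e2 := q2 y
        split_ifs at e2 ⊢ <;> omega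
    · rw [if_neg (fun h => he h.1)] at b1
      rw [b1]
      have e1 := q1 y
      have e2 := q2 y
      split_ifs at e1 e2 ⊢ <;> omega

open Classical in
/-- The filling with the labels of a growing grid; the signatures are determined by their
conjugate coordinates. -/
noncomputable def gridFilling (lam : Sig N) (S : Finset ℤ) (h₀ v₀ : ℕ → ℤ) : Filling N where
  Lam i j := if hκ : ∃ κ : Sig N, ∀ y, (dual κ y : ℤ) = gridDual lam S h₀ v₀ i j y then
    hκ.choose else lam
  h := gridH S h₀ v₀
  v := gridV S h₀ v₀

theorem gridFilling_isAdmissible {μ ν : Sig N} {m n : ℕ}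
    (hh : ∀ i i', i < i' → i' < m → h₀ i < h₀ i') (hv : ∀ j j', j < j' → j' < n → v₀ j < v₀ j')
    (ha : ∀ x, occ m h₀ x = current lam ν x) (hb : ∀ x, occ n v₀ x = current lam μ x)
    (hS : ∀ x ∉ S, occ m h₀ x = 1 → occ n v₀ x = 1 → flow m n (gridH S h₀ v₀) (x - 1) = 0 →
      occ m (fun i => gridH S h₀ v₀ i n) (x - 1) ≠ 1 →
      occ n (fun j => gridV S h₀ v₀ m j) (x - 1) ≠ 1 → mult lam x ≠ 1) :
    (gridFilling lam S h₀ v₀).IsAdmissible m n lam ν μ ((gridFilling lam S h₀ v₀).Lam m n) := by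
  have G := labelGrid_grid (S := S) hh hv
  have hdual : ∀ i j, i ≤ m → j ≤ n → ∀ y,
      (dual ((gridFilling lam S h₀ v₀).Lam i j) y : ℤ) = gridDual lam S h₀ v₀ i j y := by
    intro i j hi hj
    have hex : ∃ κ : Sig N, ∀ y, (dual κ y : ℤ) = gridDual lam S h₀ v₀ i j y := by
      have hanti := gridDual_antitone (S := S) hh hv ha hb hS (i + j) i j rfl hi hj
      have hnn : ∀ y, 0 ≤ gridDual lam S h₀ v₀ i j y := fun y => by
        have h1 := occ_nonneg i h₀ y
        have h2 := occ_nonneg j (fun j => gridV S h₀ v₀ i j) y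
        unfold gridDual
        omega
      obtain ⟨M, hM0, hM⟩ := exists_inWindow lam
      -- all labels involved are bounded by `K` in absolute value
      obtain ⟨K, hK⟩ := (((Finset.range i).image fun i => |h₀ i|) ∪
        ((Finset.range j).image fun j => |gridV S h₀ v₀ i j|) ∪ {M + 1}).exists_le
      have hK1 : M + 1 ≤ K := hK _ (by simp)
      have hout : ∀ y, K < |y| → gridDual lam S h₀ v₀ i j y = dual lam y := by
        intro y hy
        have e1 : occ i h₀ y = 0 := Finset.sum_eq_zero fun i' hi' => if_neg (by
          rintro rfl
          have := hK _ (Finset.mem_union_left _ (Finset.mem_union_left _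
            (Finset.mem_image_of_mem _ hi')))
          omega)
        have e2 : occ j (fun j => gridV S h₀ v₀ i j) y = 0 :=
          Finset.sum_eq_zero fun j' hj' => if_neg (by
            rintro rfl
            have := hK _ (Finset.mem_union_left _ (Finset.mem_union_right _
              (Finset.mem_image_of_mem _ hj')))
            simp only at this hy
            omega)
        unfold gridDual
        omega
      obtain ⟨κ, hκ⟩ := exists_dual_eq (N := N)
        (fun y => (gridDual lam S h₀ v₀ i j y).toNat) (by
          refine antitone_int_of_succ_le fun y => ?_
          have := hanti (y + 1)
          rw [add_sub_cancel_right] at this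
          exact Int.toNat_le_toNat this) (-K) (K + 1)
        (fun y hy => by
          rw [hout y (by rw [abs_of_neg (by omega)]; omega), hM.dual_low (by omega)]
          simp)
        (fun y hy => by
          rw [hout y (by rw [abs_of_pos (by omega)]; omega), hM.dual_high (by omega)]
          simp)
      refine ⟨κ, fun y => ?_⟩
      rw [hκ y, Int.toNat_of_nonneg (hnn y)]
    simp only [gridFilling]
    rw [dif_pos hex]
    exact hex.choose_spec
  refine ⟨?_, ?_, ?_, rfl, ?_, ?_, G.lt_h, G.lt_v, ?_⟩
  · refine sig_ext fun y => ?_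
    have := hdual 0 0 (Nat.zero_le _) (Nat.zero_le _) y
    simp only [gridDual, occ_zero] at this
    omega
  · refine sig_ext fun y => ?_
    have h1 := hdual m 0 le_rfl (Nat.zero_le _) y
    have h2 := ha y
    simp only [gridDual, occ_zero] at h1
    unfold current at h2
    omega
  · refine sig_ext fun y => ?_
    have h1 := hdual 0 n (Nat.zero_le _) le_rfl y
    have h2 : occ n (fun j => v₀ j) y = _ := hb y
    simp only [gridDual, occ_zero, gridV_zero] at h1
    unfold current at h2
    omega
  · intro i j hi hj
    rw [moves_iff]
    intro y
    have h1 := hdual i j hi.le hj y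
    have h2 := hdual (i + 1) j hi hj y
    rw [gridDual_succ_left] at h2
    change _ = _ + if gridH S h₀ v₀ i j = y then 1 else 0
    split_ifs at h2 ⊢ <;> omega
  · intro i j hi hj
    rw [moves_iff]
    intro y
    have h1 := hdual i j hi hj.le y
    have h2 := hdual i (j + 1) hi hj y
    rw [gridDual_succ_right] at h2
    change _ = _ + if gridV S h₀ v₀ i j = y then 1 else 0
    split_ifs at h2 ⊢ <;> omega
  · intro i j hi hj he
    have := G.box i j hi hj
    change gridH S h₀ v₀ i j = gridV S h₀ v₀ i j at he
    change (gridH S h₀ v₀ i (j + 1) = gridH S h₀ v₀ i j ∧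
      gridV S h₀ v₀ (i + 1) j = gridH S h₀ v₀ i j) ∨
      (gridH S h₀ v₀ i (j + 1) = gridH S h₀ v₀ i j + 1 ∧
      gridV S h₀ v₀ (i + 1) j = gridH S h₀ v₀ i j + 1)
    omega

end GridDual

end HallLittlewood

/-! ### Stochasticity -/

namespace HallLittlewood

theorem Filling.IsAdmissible.weight_nonneg {N : ℕ} {F : Filling N} {m n : ℕ}
    {lam ν μ ρ : Sig N} (hF : F.IsAdmissible m n lam ν μ ρ) {t : ℝ} (ht0 : 0 ≤ t) (ht1 : t < 1)
    {i j : ℕ} (hi : i < m) (hj : j < n) : 0 ≤ F.weight t i j := by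
  have hc : F.boxC t i j ≤ t := by
    obtain ⟨a, ha, -⟩ := hF.move_h i j hi hj.le
    unfold Filling.boxC
    refine pow_le_of_le_one ht0 ht1.le (Finset.card_ne_zero.2 ⟨a, ?_⟩)
    simpa using ha
  unfold Filling.weight
  split_ifs
  any_goals first | exact zero_le_one | exact le_rfl | exact ht0
  · linarith
  · exact div_nonneg (by linarith) (by linarith)
  · exact div_nonneg (by linarith) (by linarith)

theorem U_nonneg {N : ℕ} {t : ℝ} (ht0 : 0 ≤ t) (ht1 : t < 1) (μ ρ lam ν : Sig N) :
    0 ≤ U t μ ρ lam ν := by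
  unfold U
  split_ifs with h1 h2
  · refine Finset.prod_nonneg fun i hi => Finset.prod_nonneg fun j hj => ?_
    exact h2.choose_spec.weight_nonneg ht0 ht1 (Finset.mem_range.1 hi) (Finset.mem_range.1 hj)
  · exact le_rfl
  · exact le_rfl

/-- If choices are made successively at the points of `C`, each with probabilities adding up to
one given the earlier choices, then the probabilities of all sequences of choices add up to
one. -/
theorem sum_powerset_prod_eq_one {C : Finset ℤ} {p : ℤ → Finset ℤ → ℝ}
    (hloc : ∀ x S S', (∀ y ≤ x, y ∈ S ↔ y ∈ S') → p x S = p x S')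
    (hone : ∀ x ∈ C, ∀ S, x ∉ S → p x S + p x (insert x S) = 1) :
    ∑ S ∈ C.powerset, ∏ x ∈ C, p x S = 1 := by
  induction C using Finset.induction_on_max with
  | empty => simp
  | insert a C hmax ih =>
    have ha : a ∉ C := fun h => lt_irrefl _ (hmax a h)
    rw [Finset.sum_powerset_insert ha, ← Finset.sum_add_distrib,
      ← ih fun x hx => hone x (Finset.mem_insert_of_mem hx)]
    refine Finset.sum_congr rfl fun S hS => ?_
    have haS : a ∉ S := fun h => ha (Finset.mem_powerset.1 hS h)
    have e : ∏ x ∈ C, p x (insert a S) = ∏ x ∈ C, p x S := by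
      refine Finset.prod_congr rfl fun x hx => hloc x _ _ fun y hy => ?_
      have := hmax x hx
      rw [Finset.mem_insert]
      constructor
      · rintro (h | h)
        · omega
        · exact h
      · exact Or.inr
    rw [Finset.prod_insert ha, Finset.prod_insert ha, e, ← add_mul,
      hone a (Finset.mem_insert_self _ _) S haS, one_mul]

/-- The conditional probability of the choice made by `S` at the label `x`, at which a horizontal
and a vertical line start, given the carries `k`. The currents into the site are expressed by the
carries and the initial currents `a`, `b`. If lines are raised from `x - 1`, there is no choice, and
`S` has to contain `x` by convention. -/
noncomputable def choiceWeight (t : ℝ) (a b k : ℤ → ℤ) (S : Finset ℤ) (c : ℕ) (x : ℤ) : ℝ :=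
  if 1 ≤ k (x - 1) then (if x ∈ S then 1 else 0)
  else siteWeight t 1 1 (a (x - 1) - k (x - 1) + k (x - 2)) (b (x - 1) - k (x - 1) + k (x - 2))
    (k (x - 2)) (k (x - 1)) (k x) c

/-- The weights of a zero-box and of a one-box under the same circumstances add up to one. -/
theorem siteWeight_add {t : ℝ} (ht0 : 0 ≤ t) (ht1 : t < 1) {p q k₂ : ℤ} {c : ℕ}
    (hc : p ≠ 1 → q ≠ 1 → c ≠ 0) :
    siteWeight t 1 1 p q k₂ 0 0 c + siteWeight t 1 1 p q k₂ 0 1 c = 1 := by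
  unfold siteWeight
  by_cases hp : p = 1 <;> by_cases hq : q = 1 <;> simp [hp, hq]
  · by_cases hk : k₂ = 0 <;> simp [hk]
  · have := one_sub_pow_ne_zero ht0 ht1 (hc hp hq)
    field_simp
    ring

theorem Filling.IsAdmissible.size_eq {N : ℕ} {F : Filling N} {m n : ℕ} {lam ν μ ρ : Sig N}
    (hF : F.IsAdmissible m n lam ν μ ρ) :
    size ν = size lam + m ∧ size μ = size lam + n ∧ size ρ = size μ + m := by
  have key : ∀ {κ κ' : Sig N} {x : ℤ}, Moves κ κ' x → size κ' = size κ + 1 := by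
    rintro κ κ' x ⟨a, ha, hκ⟩
    unfold size
    rw [hκ, Finset.sum_update_of_mem (Finset.mem_univ a),
      ← Finset.sum_sdiff (Finset.subset_univ {a}), Finset.sum_singleton, ha]
    ring
  have hh : ∀ j ≤ n, ∀ i ≤ m, size (F.Lam i j) = size (F.Lam 0 j) + i := by
    intro j hj i hi
    induction i with
    | zero => simp
    | succ i ih =>
      rw [key (hF.move_h i j hi hj), ih (by omega)]
      push_cast
      ring
  have hv : ∀ j ≤ n, size (F.Lam 0 j) = size (F.Lam 0 0) + j := by
    intro j hj
    induction j with
    | zero => simp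
    | succ j ih =>
      rw [key (hF.move_v 0 j (Nat.zero_le _) hj), ih (by omega)]
      push_cast
      ring
  have h1 := hh 0 (Nat.zero_le _) m le_rfl
  have h2 := hh n le_rfl m le_rfl
  have h3 := hv n le_rfl
  rw [hF.sw, hF.se] at h1
  rw [hF.ne, hF.nw] at h2
  rw [hF.sw, hF.nw] at h3
  exact ⟨h1, h3, h2⟩

theorem Filling.IsAdmissible.square {N : ℕ} {F : Filling N} {m n : ℕ} {lam ν μ ρ : Sig N}
    (hF : F.IsAdmissible m n lam ν μ ρ) : Square μ ρ lam ν := by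
  have G := hF.labelGrid
  have hs := hF.size_eq
  have key : ∀ {κ κ' : Sig N}, (∀ x, 0 ≤ current κ κ' x ∧ current κ κ' x ≤ 1) → κ ≺ κ' := by
    intro κ κ' h
    rw [interlaces_iff]
    intro x
    have := h x
    unfold current at this
    omega
  refine ⟨key fun x => ?_, key fun x => ?_, key fun x => ?_, key fun x => ?_, by omega⟩
  · rw [hF.current_lam_nu]
    exact ⟨occ_nonneg _ _ _, G.occ_h_le_one (Nat.zero_le _) x⟩
  · rw [hF.current_lam_mu]
    exact ⟨occ_nonneg _ _ _, G.occ_v_le_one (Nat.zero_le _) x⟩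
  · rw [hF.current_nu_rho]
    exact ⟨occ_nonneg _ _ _, G.occ_v_le_one le_rfl x⟩
  · rw [hF.current_mu_rho]
    exact ⟨occ_nonneg _ _ _, G.occ_h_le_one le_rfl x⟩

theorem Filling.IsAdmissible.hasFilling {N : ℕ} {F : Filling N} {m n : ℕ} {lam ν μ ρ : Sig N}
    (hF : F.IsAdmissible m n lam ν μ ρ) : HasFilling μ ρ lam ν := by
  have hs := hF.size_eq
  refine ⟨F, ?_⟩
  convert hF using 1 <;> omega

/-- The carries determine the currents and hence `ρ`. -/
theorem eq_of_carry_eq {N : ℕ} {lam μ ν ρ ρ' : Sig N}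
    (h : ∀ x, carry μ ρ lam ν x = carry μ ρ' lam ν x) : ρ = ρ' := by
  refine sig_ext fun x => ?_
  have h1 := carry_sub_carry μ ρ lam ν x
  have h2 := carry_sub_carry μ ρ' lam ν x
  rw [h x, h (x - 1)] at h1
  unfold current at h1 h2
  omega

theorem flow_eq_zero_of_lt {m n : ℕ} {h : ℕ → ℕ → ℤ} {x : ℤ} (hx : ∀ i < m, x < h i 0) :
    flow m n h x = 0 :=
  flow_eq_zero_iff.2 fun i hi h0 => absurd h0 (not_le.2 (hx i hi))

/-- The transition weights out of given `lam`, `μ`, `ν` are those of a Markov chain that makes a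
choice at each label at which both a horizontal and a vertical line start. -/
theorem exists_choices {N : ℕ} {t : ℝ} (ht0 : 0 ≤ t) (ht1 : t < 1) {lam μ ν : Sig N}
    (hμ : lam ≺ μ) (hν : lam ≺ ν) :
    ∃ (C : Finset ℤ) (W : Finset ℤ → ℝ) (k : Finset ℤ → ℤ → ℤ),
      ∑ S ∈ C.powerset, W S = 1 ∧
      (∀ S ∈ C.powerset, W S ≠ 0 → ∃ ρ, U t μ ρ lam ν = W S ∧
        ∀ x, carry μ ρ lam ν x = k S x) ∧
      (∀ ρ, U t μ ρ lam ν ≠ 0 → ∃ S ∈ C.powerset, W S ≠ 0 ∧ ∀ x, carry μ ρ lam ν x = k S x) ∧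
      (∀ S ∈ C.powerset, ∀ S' ∈ C.powerset, W S ≠ 0 → W S' ≠ 0 → (∀ x, k S x = k S' x) →
        S = S') := by
  obtain ⟨A, B, -, wl, wμ, wν, -⟩ := exists_common_window lam μ ν ν
  obtain ⟨m, h₀, hh, ha⟩ := exists_enumeration hν
  obtain ⟨n, v₀, hv, hb⟩ := exists_enumeration hμ
  set k : Finset ℤ → ℤ → ℤ := fun S => flow m n (gridH S h₀ v₀) with hk
  set C := (Finset.Ico A B).filter fun x => current lam ν x = 1 ∧ current lam μ x = 1 with hC
  set p : ℤ → Finset ℤ → ℝ := fun x S =>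
    choiceWeight t (current lam ν) (current lam μ) (k S) S (mult lam x) x with hp
  have hab : occ m h₀ = current lam ν ∧ occ n v₀ = current lam μ := ⟨funext ha, funext hb⟩
  have hrule : ∀ S, CarryRule (current lam ν) (current lam μ) S (k S) := fun S => by
    rw [← hab.1, ← hab.2]
    exact grid_carryRule S hh hv
  have hlowh : ∀ i < m, A ≤ h₀ i := by
    intro i hi
    by_contra hlt
    have h1 := ha (h₀ i)
    classical
    rw [occ_eq_ite hh, if_pos ⟨i, hi, rfl⟩, wl.current_eq_zero wν (Or.inl (by omega))] at h1
    omega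
  have hlow : ∀ S, ∀ x < A, k S x = 0 := fun S x hx =>
    flow_eq_zero_of_lt fun i hi => by
      rw [gridH_zero]
      have := hlowh i hi
      omega
  have hmemC : ∀ x, x ∈ C ↔ current lam ν x = 1 ∧ current lam μ x = 1 := by
    intro x
    simp only [hC, Finset.mem_filter, Finset.mem_Ico, and_iff_right_iff_imp]
    intro hx
    by_contra hc
    have := wl.current_eq_zero wν (x := x) (by omega)
    omega
  -- the weight of an outcome with the carries determined by `S`
  have hprod : ∀ S ρ, (∀ x, carry μ ρ lam ν x = k S x) → (∀ x ∈ C, 1 ≤ k S (x - 1) → x ∈ S) →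
      ∏ x ∈ Finset.Ico A B, localWeight t μ ρ lam ν x = ∏ x ∈ C, p x S := by
    intro S ρ hcar hforced
    rw [hC, Finset.prod_filter]
    refine Finset.prod_congr rfl fun x _ => ?_
    split_ifs with hx
    · have e1 := carry_sub_carry μ ρ lam ν (x - 1)
      have e2 : current μ ρ (x - 1) = current lam ν (x - 1) - k S (x - 1) + k S (x - 2) := by
        rw [← hcar, ← hcar]
        rw [show x - 1 - 1 = x - 2 by ring] at e1
        omega
      have e3 : current ν ρ (x - 1) = current lam μ (x - 1) - k S (x - 1) + k S (x - 2) := by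
        unfold current at e2 ⊢
        omega
      simp only [hp, choiceWeight, localWeight]
      rw [hcar, hcar, hcar, hx.1, hx.2, e2, e3]
      split_ifs with h1 h2
      · rw [siteWeight, if_neg]
        omega
      · exact absurd (hforced x ((hmemC x).2 hx) h1) h2
      · rfl
    · rw [localWeight, siteWeight, if_neg]
      tauto
  have hforced : ∀ S, ∏ x ∈ C, p x S ≠ 0 → ∀ x ∈ C, 1 ≤ k S (x - 1) → x ∈ S := by
    intro S hne x hx h1
    have := Finset.prod_ne_zero_iff.1 hne x hx
    simp only [hp, choiceWeight, if_pos h1] at this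
    by_contra hxS
    exact this (if_neg hxS)
  have hmem : ∀ S ∈ C.powerset, ∏ x ∈ C, p x S ≠ 0 → ∀ x, x ∈ S ↔ x ∈ C ∧ k S x ≠ 0 := by
    intro S hS hne x
    rw [Finset.mem_powerset] at hS
    have key : x ∈ C → (x ∈ S ↔ k S x ≠ 0) := by
      intro hx
      have h1 := hrule S x
      have h2 := (hrule S (x - 1)).1
      have h3 := (hmemC x).1 hx
      by_cases h0 : k S (x - 1) = 0
      · rw [h1.2.2 h0]
        simp [h3]
      · have h4 := h1.2.1 (by omega)
        have h5 := hforced S hne x hx (by omega)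
        simp only [h5, true_iff]
        omega
    constructor
    · intro hx
      exact ⟨hS hx, (key (hS hx)).1 hx⟩
    · rintro ⟨hx, hne⟩
      exact (key hx).2 hne
  refine ⟨C, fun S => ∏ x ∈ C, p x S, k, ?_, ?_, ?_, ?_⟩
  · have hkloc : ∀ S S' x, (∀ y ≤ x, y ∈ S ↔ y ∈ S') → k S x = k S' x := fun S S' x h =>
      (hrule S).unique (hrule S') (hlow S) (hlow S') x h
    refine sum_powerset_prod_eq_one ?_ ?_
    · intro x S S' h
      simp only [hp, choiceWeight]
      rw [hkloc S S' x h, hkloc S S' (x - 1) fun y hy => h y (by omega),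
        hkloc S S' (x - 2) fun y hy => h y (by omega), if_congr (h x le_rfl) rfl rfl]
    · intro x hx S hxS
      have hins : ∀ y < x, k (insert x S) y = k S y := fun y hy => hkloc _ _ _ fun z hz => by
        rw [Finset.mem_insert]
        constructor
        · rintro (h | h)
          · omega
          · exact h
        · exact Or.inr
      have hx' := (hmemC x).1 hx
      have h1 := hrule S x
      have h2 := hrule (insert x S) x
      rw [hins (x - 1) (by omega)] at h2
      have h3 := (hrule S (x - 1)).1
      simp only [hp, choiceWeight]
      rw [hins (x - 1) (by omega), hins (x - 2) (by omega)]
      rw [if_neg hxS, if_pos (Finset.mem_insert_self x S)]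
      split_ifs with h4
      · exact zero_add 1
      · have h0 : k S (x - 1) = 0 := by omega
        have e1 := h1.2.2 h0
        have e2 := h2.2.2 h0
        rw [if_neg (fun h => hxS h.2.2)] at e1
        rw [if_pos ⟨hx'.1, hx'.2, Finset.mem_insert_self _ _⟩] at e2
        rw [h0, e1, e2]
        refine siteWeight_add ht0 ht1 fun hp1 _ => ?_
        -- without an arrival the moving particle has been at `x` before
        have e3 := (hrule S (x - 2)).1
        have e4 := current_eq_zero_or_one hν (x - 1)
        have e5 := hrule S (x - 1)
        have e6 := dual_sub_one lam x
        have e7 := dual_antitone ν (show x - 1 ≤ x by omega)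
        rw [show x - 1 - 1 = x - 2 by ring] at e5
        have e8 : current lam ν (x - 1) = 0 := by
          rcases e4 with h | h
          · exact h
          · exfalso
            by_cases hz : k S (x - 2) = 0
            · omega
            · have := e5.2.1 (by omega)
              have := current_eq_zero_or_one hμ (x - 1)
              omega
        unfold current at e8 hx'
        omega
  · intro S hS hne
    have hF := gridFilling_isAdmissible (lam := lam) (μ := μ) (ν := ν) (S := S) hh hv ha hb (by
      intro x hxS h1 h2 h3 h4 h5 hm
      rw [ha] at h1
      rw [hb] at h2
      have hx := (hmemC x).2 ⟨h1, h2⟩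
      have h6 := Finset.prod_ne_zero_iff.1 hne x hx
      have G := labelGrid_grid (S := S) hh hv
      have e1 := G.flow_sub_flow (x - 1)
      have e2 := G.flow_sub_flow' (x - 1)
      have e3 : occ m (fun i => gridH S h₀ v₀ i 0) (x - 1) = current lam ν (x - 1) := ha _
      have e4 : occ n (fun j => gridV S h₀ v₀ 0 j) (x - 1) = current lam μ (x - 1) := hb _
      rw [show x - 1 - 1 = x - 2 by ring] at e1 e2
      change k S (x - 1) = 0 at h3
      change k S (x - 1) - k S (x - 2) = _ at e1 e2
      have e5 := (hrule S x).2.2 h3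
      rw [if_neg (fun h => hxS h.2.2)] at e5
      simp only [hp, choiceWeight] at h6
      rw [if_neg (by omega), e5, hm, h3, siteWeight, if_pos ⟨rfl, rfl, rfl⟩,
        if_neg (by omega), if_neg (by omega), if_pos rfl] at h6
      simp at h6)
    have hcar : ∀ x, carry μ ((gridFilling lam S h₀ v₀).Lam m n) lam ν x = k S x :=
      hF.carry_eq_flow
    exact ⟨_, by rw [U_eq_prod t hF.square hF.hasFilling wl wν, hprod S _ hcar (hforced S hne)],
      hcar⟩
  · intro ρ hU
    obtain ⟨hs, hf⟩ := square_of_U_ne_zero hU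
    obtain ⟨F, hF⟩ := id hf
    have G := hF.labelGrid
    have hrule' : CarryRule (current lam ν) (current lam μ)
        (C.filter fun x => carry μ ρ lam ν x ≠ 0) (carry μ ρ lam ν) := by
      have := G.carryRule (S := C.filter fun x => carry μ ρ lam ν x ≠ 0) (by
        intro x _ h1 h2
        rw [← hF.current_lam_nu] at h1
        rw [← hF.current_lam_mu] at h2
        rw [Finset.mem_filter, hF.carry_eq_flow, hmemC]
        simp [h1, h2])
      rwa [← funext hF.current_lam_nu, ← funext hF.current_lam_mu,
        ← funext hF.carry_eq_flow] at this
    have hlow' : ∀ x < A, carry μ ρ lam ν x = 0 := by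
      intro x hx
      rw [hF.carry_eq_flow]
      refine flow_eq_zero_of_lt fun i hi => ?_
      have h1 := (G.occ_h_eq_one_iff (Nat.zero_le _) (F.h i 0)).2 ⟨i, hi, rfl⟩
      rw [← hF.current_lam_nu] at h1
      by_contra hlt
      rw [wl.current_eq_zero wν (Or.inl (by omega))] at h1
      omega
    have hcar : ∀ x, carry μ ρ lam ν x = k (C.filter fun x => carry μ ρ lam ν x ≠ 0) x :=
      fun x => hrule'.unique (hrule _) hlow' (hlow _) x fun _ _ => Iff.rfl
    refine ⟨_, Finset.mem_powerset.2 (Finset.filter_subset _ _), ?_, hcar⟩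
    change ∏ x ∈ C, p x _ ≠ 0
    rw [← hprod _ ρ hcar, ← U_eq_prod t hs hf wl wν]
    · exact hU
    · intro x hx h1
      rw [Finset.mem_filter]
      refine ⟨hx, ?_⟩
      rw [← hcar] at h1
      have := (hrule' x).2.1 h1
      have := (hmemC x).1 hx
      omega
  · intro S hS S' hS' hne hne' hkk
    ext x
    rw [hmem S hS hne, hmem S' hS' hne', hkk]

theorem stochastic {N : ℕ} {t : ℝ} (ht0 : 0 ≤ t) (ht1 : t < 1) {lam μ ν : Sig N}
    (hμ : lam ≺ μ) (hν : lam ≺ ν) :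
    (Function.support fun ρ : Sig N => U t μ ρ lam ν).Finite ∧
      ∑ᶠ ρ : Sig N, U t μ ρ lam ν = 1 := by
  classical
  obtain ⟨C, W, k, hsum, hto, hfrom, hinj⟩ := exists_choices ht0 ht1 hμ hν
  have : Nonempty (Sig N) := ⟨lam⟩
  choose! r hr hrk using hto
  set T := C.powerset.filter fun S => W S ≠ 0 with hT
  have hsupp : (Function.support fun ρ : Sig N => U t μ ρ lam ν) ⊆
      ((T.image r : Finset (Sig N)) : Set (Sig N)) := by
    intro ρ hρ
    obtain ⟨S, hS, hne, hk⟩ := hfrom ρ hρ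
    rw [Finset.coe_image]
    refine ⟨S, by simp only [hT, Finset.coe_filter]; exact ⟨hS, hne⟩, ?_⟩
    refine eq_of_carry_eq (lam := lam) (μ := μ) (ν := ν) fun x => ?_
    rw [hrk S hS hne, hk]
  refine ⟨(Finset.finite_toSet _).subset hsupp, ?_⟩
  rw [finsum_eq_sum_of_support_subset _ hsupp, Finset.sum_image]
  · refine Eq.trans (Finset.sum_congr rfl fun S hS => ?_)
      ((Finset.sum_filter_ne_zero _).trans hsum)
    rw [Finset.mem_filter] at hS
    exact hr S hS.1 hS.2
  · intro S hS S' hS' heq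
    simp only [hT, Finset.coe_filter] at hS hS'
    refine hinj S hS.1 S' hS'.1 hS.2 hS'.2 fun x => ?_
    rw [← hrk S hS.1 hS.2, ← hrk S' hS'.1 hS'.2, heq]

end HallLittlewood

/-! ### Summation identities -/

namespace HallLittlewood

/-- Reversal as a permutation of the signatures of a given length. -/
def revEquiv (N : ℕ) : Sig N ≃ Sig N := ⟨rev, rev, rev_rev, rev_rev⟩

theorem stochastic_rev {N : ℕ} {t : ℝ} (ht0 : 0 ≤ t) (ht1 : t < 1) {μ ν ρ : Sig N}
    (hμ : μ ≺ ρ) (hν : ν ≺ ρ) :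
    (Function.support fun lam : Sig N => U t (rev ν) (rev lam) (rev ρ) (rev μ)).Finite ∧
      ∑ᶠ lam : Sig N, U t (rev ν) (rev lam) (rev ρ) (rev μ) = 1 := by
  obtain ⟨h1, h2⟩ := stochastic ht0 ht1 (rev_interlaces_rev hν) (rev_interlaces_rev hμ)
  refine ⟨h1.preimage (f := rev) (revEquiv N).injective.injOn, ?_⟩
  rw [← h2]
  exact finsum_comp_equiv (revEquiv N) (f := fun κ => U t (rev ν) κ (rev ρ) (rev μ))

/-- Two weighted sets with mutually inverse transition probabilities have the same total
weight. -/
theorem weighted_bijection {α β : Type*} {L : Set α} {R : Set β} (hL : L.Finite) (hR : R.Finite)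
    (f : α → ℝ) (g : β → ℝ) (P Q : α → β → ℝ)
    (hP : ∀ a ∈ L, ∑ᶠ b, P a b = 1) (hQ : ∀ b ∈ R, ∑ᶠ a, Q a b = 1)
    (heq : ∀ a b, f a * P a b = g b * Q a b)
    (hLR : ∀ a ∈ L, ∀ b, P a b ≠ 0 → b ∈ R) (hRL : ∀ b ∈ R, ∀ a, Q a b ≠ 0 → a ∈ L) :
    ∑ᶠ a ∈ L, f a = ∑ᶠ b ∈ R, g b ∧
    ∑ᶠ a ∈ L, f a = ∑ᶠ a ∈ L, f a * ∑ᶠ b, P a b ∧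
    ∑ᶠ a ∈ L, f a * ∑ᶠ b, P a b = ∑ᶠ b ∈ R, g b * ∑ᶠ a, Q a b ∧
    ∑ᶠ b ∈ R, g b * ∑ᶠ a, Q a b = ∑ᶠ b ∈ R, g b := by
  have e1 : ∑ᶠ a ∈ L, f a = ∑ᶠ a ∈ L, f a * ∑ᶠ b, P a b :=
    finsum_mem_congr rfl fun a ha => by rw [hP a ha, mul_one]
  have e3 : ∑ᶠ b ∈ R, g b * ∑ᶠ a, Q a b = ∑ᶠ b ∈ R, g b :=
    finsum_mem_congr rfl fun b hb => by rw [hQ b hb, mul_one]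
  have e2 : ∑ᶠ a ∈ L, f a * ∑ᶠ b, P a b = ∑ᶠ b ∈ R, g b * ∑ᶠ a, Q a b := by
    rw [finsum_mem_eq_finite_toFinset_sum _ hL, finsum_mem_eq_finite_toFinset_sum _ hR]
    have h1 : ∀ a ∈ hL.toFinset, f a * ∑ᶠ b, P a b = ∑ b ∈ hR.toFinset, f a * P a b := by
      intro a ha
      rw [finsum_eq_sum_of_support_subset, Finset.mul_sum]
      intro b hb
      rw [hR.coe_toFinset]
      exact hLR a (hL.mem_toFinset.1 ha) b hb
    have h2 : ∀ b ∈ hR.toFinset, g b * ∑ᶠ a, Q a b = ∑ a ∈ hL.toFinset, f a * P a b := by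
      intro b hb
      rw [finsum_eq_sum_of_support_subset (s := hL.toFinset), Finset.mul_sum]
      · exact Finset.sum_congr rfl fun a _ => (heq a b).symm
      · intro a ha
        rw [hL.coe_toFinset]
        exact hRL b (hR.mem_toFinset.1 hb) a ha
    rw [Finset.sum_congr rfl h1, Finset.sum_congr rfl h2, Finset.sum_comm]
  exact ⟨e1.trans (e2.trans e3), e1, e2, e3⟩

theorem finite_sig_Icc {N : ℕ} (a b : Fin N → ℤ) :
    {κ : Sig N | ∀ i, a i ≤ κ.1 i ∧ κ.1 i ≤ b i}.Finite := by
  refine Set.Finite.subset ((Set.finite_Icc a b).preimage Subtype.val_injective.injOn) ?_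
  intro κ hκ
  exact ⟨fun i => (hκ i).1, fun i => (hκ i).2⟩

theorem Interlaces.coord_le {N : ℕ} {lam μ : Sig N} (h : lam ≺ μ) (i : Fin N) :
    lam.1 i ≤ μ.1 i := by
  by_contra hlt
  have h1 := (lt_coord_iff lam _ i).1 (not_le.1 hlt)
  have h2 := (interlaces_iff lam μ).1 h (μ.1 i)
  exact lt_irrefl _ ((lt_coord_iff μ _ i).2 (h1.trans_le h2.1))

/-- A signature that interlaces from below is bounded from below in terms of its size. -/
theorem Interlaces.coord_ge {N : ℕ} {lam μ : Sig N} (h : lam ≺ μ) (i : Fin N) :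
    μ.1 i - (size μ - size lam) ≤ lam.1 i := by
  have h1 : size μ - size lam = ∑ j, (μ.1 j - lam.1 j) := by
    unfold size
    rw [Finset.sum_sub_distrib]
  have h2 := Finset.single_le_sum (f := fun j => μ.1 j - lam.1 j)
    (fun j _ => sub_nonneg.2 (h.coord_le j)) (Finset.mem_univ i)
  omega

theorem Interlaces.size_le {N : ℕ} {lam μ : Sig N} (h : lam ≺ μ) : size lam ≤ size μ :=
  Finset.sum_le_sum fun i _ => h.coord_le i

theorem finite_below {L M : ℕ} (μ : Sig M) (ν : Sig L) (k l : ℤ) : (Below L μ ν k l).Finite := by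
  refine (finite_sig_Icc (fun i => ν.1 i - l) ν.1).subset ?_
  rintro lam ⟨-, h, -, hl⟩ i
  rw [← hl]
  exact ⟨h.coord_ge i, h.coord_le i⟩

theorem finite_above {L M : ℕ} (μ : Sig L) (ν : Sig M) (k l : ℤ) : (Above L μ ν k l).Finite := by
  refine (finite_sig_Icc μ.1 (fun i => μ.1 i + l)).subset ?_
  rintro ρ ⟨h, -, -, hl⟩ i
  have := h.coord_ge i
  exact ⟨h.coord_le i, by omega⟩

theorem mem_above_of_U_ne_zero {N : ℕ} {t : ℝ} {μ ν lam ρ : Sig N} {k l : ℤ}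
    (hlam : lam ∈ Below N μ ν k l) (hU : U t μ ρ lam ν ≠ 0) : ρ ∈ Above N μ ν k l := by
  obtain ⟨⟨-, -, h1, h2, h3⟩, -⟩ := square_of_U_ne_zero hU
  obtain ⟨-, -, h4, h5⟩ := hlam
  exact ⟨h2, h1, by omega, by omega⟩

theorem mem_below_of_U_rev_ne_zero {N : ℕ} {t : ℝ} {μ ν lam ρ : Sig N} {k l : ℤ}
    (hρ : ρ ∈ Above N μ ν k l) (hU : U t (rev ν) (rev lam) (rev ρ) (rev μ) ≠ 0) :
    lam ∈ Below N μ ν k l := by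
  obtain ⟨h1, h2, -, -, h3⟩ := square_rev_iff.1 (square_of_U_ne_zero hU).1
  obtain ⟨-, -, h4, h5⟩ := hρ
  exact ⟨h2, h1, by omega, by omega⟩

/-- A weighted sum over a finite set of pairs as an iterated sum. -/
theorem finsum_mul_finsum_mem {α : Type*} {L : ℕ → Set α} {T : Set (α × ℕ)}
    (hT : ∀ p, p ∈ T ↔ p.1 ∈ L p.2) (hfin : T.Finite) (c : ℕ → ℝ) (F : α → ℕ → ℝ) :
    ∑ᶠ r : ℕ, c r * ∑ᶠ a ∈ L r, F a r = ∑ᶠ p ∈ T, c p.2 * F p.1 p.2 := by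
  have h1 : ∀ r, c r * ∑ᶠ a ∈ L r, F a r =
      ∑ᶠ a, T.indicator (fun p => c p.2 * F p.1 p.2) (a, r) := by
    intro r
    rw [mul_finsum_mem, finsum_mem_def]
    refine finsum_congr fun a => ?_
    by_cases ha : a ∈ L r
    · rw [Set.indicator_of_mem ha, Set.indicator_of_mem ((hT (a, r)).2 ha)]
    · rw [Set.indicator_of_notMem ha, Set.indicator_of_notMem (fun h => ha ((hT (a, r)).1 h))]
  rw [finsum_congr h1, finsum_mem_def,
    ← finsum_comp_equiv (Equiv.prodComm ℕ α), finsum_curry]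
  · rfl
  · refine (hfin.preimage (Equiv.prodComm ℕ α).injective.injOn).subset fun p hp => ?_
    by_contra hc
    exact hp (Set.indicator_of_notMem (s := T) hc _)

end HallLittlewood

/-! ### An additional particle as input -/

namespace HallLittlewood

variable {n : ℕ}

@[simp] theorem adjoin_castSucc (κ : Sig n) (x : ℤ) (hx : ∀ i, x ≤ κ.1 i) (i : Fin n) :
    (adjoin κ x hx).1 i.castSucc = κ.1 i := by
  simp [adjoin]

@[simp] theorem adjoin_last (κ : Sig n) (x : ℤ) (hx : ∀ i, x ≤ κ.1 i) :
    (adjoin κ x hx).1 (Fin.last n) = x := by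
  simp [adjoin]

theorem size_adjoin (κ : Sig n) (x : ℤ) (hx : ∀ i, x ≤ κ.1 i) :
    size (adjoin κ x hx) = size κ + x := by
  simp [size, Fin.sum_univ_castSucc]

theorem dual_adjoin (κ : Sig n) (x : ℤ) (hx : ∀ i, x ≤ κ.1 i) (y : ℤ) :
    dual (adjoin κ x hx) y = dual κ y + if y < x then 1 else 0 := by
  simp only [dual, Finset.card_filter, Fin.sum_univ_castSucc, adjoin_castSucc, adjoin_last]

theorem mult_adjoin (κ : Sig n) (x : ℤ) (hx : ∀ i, x ≤ κ.1 i) (y : ℤ) :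
    mult (adjoin κ x hx) y = mult κ y + if x = y then 1 else 0 := by
  simp only [mult, Finset.card_filter, Fin.sum_univ_castSucc, adjoin_castSucc, adjoin_last]

/-- All particles except the lowest one. -/
def dropLast (κ : Sig (n + 1)) : Sig n :=
  ⟨fun i => κ.1 i.castSucc, fun _ _ hij => κ.2 (Fin.castSucc_le_castSucc_iff.2 hij)⟩

theorem last_le_dropLast (κ : Sig (n + 1)) (i : Fin n) : κ.1 (Fin.last n) ≤ (dropLast κ).1 i :=
  κ.2 (Fin.le_last _)

theorem adjoin_dropLast (κ : Sig (n + 1)) :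
    adjoin (dropLast κ) (κ.1 (Fin.last n)) (last_le_dropLast κ) = κ :=
  Subtype.ext (Fin.snoc_init_self κ.1)

theorem dropLast_adjoin (κ : Sig n) (x : ℤ) (hx : ∀ i, x ≤ κ.1 i) :
    dropLast (adjoin κ x hx) = κ :=
  Subtype.ext (funext fun i => adjoin_castSucc κ x hx i)

theorem adjoin_interlaces_iff {κ : Sig n} {σ : Sig (n + 1)} {x : ℤ} (hx : ∀ i, x ≤ κ.1 i)
    (hσ : ∀ i, x < σ.1 i) : adjoin κ x hx ≺ σ ↔ κ ≺ σ := by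
  rw [interlaces_iff, interlaces_iff]
  refine forall_congr' fun z => ?_
  rw [dual_adjoin]
  split_ifs with h
  · rw [dual_eq_length σ z fun a => h.trans (hσ a),
      dual_eq_length κ z fun a => h.trans_le (hx a)]
    omega
  · omega

theorem adjoin_interlaces_adjoin_iff {lam ν : Sig n} {x y : ℤ} (hlam : ∀ i, x ≤ lam.1 i)
    (hy : ∀ i, y ≤ lam.1 i) (hν : ∀ i, x ≤ ν.1 i) (hyx : y ≤ x) :
    adjoin lam y hy ≺ adjoin ν x hν ↔ lam ≺ ν := by
  rw [interlaces_iff, interlaces_iff]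
  refine forall_congr' fun z => ?_
  rw [dual_adjoin, dual_adjoin]
  by_cases h : z < x
  · rw [dual_eq_length lam z fun a => h.trans_le (hlam a),
      dual_eq_length ν z fun a => h.trans_le (hν a)]
    split_ifs <;> omega
  · rw [if_neg h, if_neg (by omega)]
    simp

/-- If `κ` has one coordinate less than `σ`, then the coordinates of `κ` are bounded from below by
those of `σ`. -/
theorem Interlaces.lt_of_lt {κ : Sig n} {σ : Sig (n + 1)} (h : κ ≺ σ) {x : ℤ}
    (hσ : ∀ i, x < σ.1 i) (i : Fin n) : x < κ.1 i := by
  rw [lt_coord_iff]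
  have h1 := ((interlaces_iff κ σ).1 h x).2
  rw [dual_eq_length σ x hσ] at h1
  omega

theorem mult_eq_zero {N : ℕ} (κ : Sig N) (x : ℤ) (h : ∀ i, x < κ.1 i) : mult κ x = 0 := by
  have h1 := dual_sub_one κ x
  rw [dual_eq_length κ x h, dual_eq_length κ (x - 1) fun i => (sub_one_lt x).trans (h i)] at h1
  omega

theorem psi_adjoin (t : ℝ) {κ : Sig n} {σ : Sig (n + 1)} (h : κ ≺ σ) {x : ℤ}
    (hx : ∀ i, x ≤ κ.1 i) (hσ : ∀ i, x < σ.1 i) :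
    psi t σ (adjoin κ x hx) = (1 - t) * psi t σ κ := by
  have hκ := h.lt_of_lt hσ
  obtain ⟨M, -, hM⟩ := exists_inWindow (adjoin κ x hx)
  have hM' : InWindow (-M) M κ := fun i => by simpa using hM i.castSucc
  have hxM : x ∈ Finset.Ico (-M) M := by simpa using hM (Fin.last n)
  rw [psi_eq_prod t ((adjoin_interlaces_iff hx hσ).2 h) hM, psi_eq_prod t h hM']
  -- only the factor of the site `x` is new
  have key : ∀ z : ℤ,
      (if dual σ (z - 1) = dual (adjoin κ x hx) (z - 1) ∧
          dual σ z = dual (adjoin κ x hx) z + 1 then 1 - t ^ mult (adjoin κ x hx) z else 1) =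
        (if z = x then 1 - t else 1) *
          (if dual σ (z - 1) = dual κ (z - 1) ∧ dual σ z = dual κ z + 1 then
            1 - t ^ mult κ z else 1) := by
    intro z
    rw [dual_adjoin, dual_adjoin, mult_adjoin]
    rcases lt_trichotomy z x with hz | rfl | hz
    · rw [dual_eq_length σ z fun a => hz.trans (hσ a),
        dual_eq_length κ z fun a => hz.trans (hκ a),
        dual_eq_length σ (z - 1) fun a => (sub_one_lt z).trans (hz.trans (hσ a)),
        dual_eq_length κ (z - 1) fun a => (sub_one_lt z).trans (hz.trans (hκ a)),
        if_neg (by split_ifs <;> omega), if_neg hz.ne, if_neg (by omega), one_mul]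
    · rw [dual_eq_length σ z hσ, dual_eq_length κ z hκ,
        dual_eq_length σ (z - 1) fun a => (sub_one_lt z).trans (hσ a),
        dual_eq_length κ (z - 1) fun a => (sub_one_lt z).trans (hκ a), mult_eq_zero κ z hκ]
      simp
    · rw [if_neg (show ¬ z - 1 < x by omega), if_neg (show ¬ z < x by omega),
        if_neg (show ¬ x = z by omega), if_neg (show ¬ z = x by omega)]
      simp
  rw [Finset.prod_congr rfl fun z _ => key z, Finset.prod_mul_distrib, Finset.prod_ite_eq',
    if_pos hxM]

theorem phi_adjoin_adjoin (t : ℝ) {lam ν : Sig n} (h : lam ≺ ν) {x y : ℤ}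
    (hlam : ∀ i, x < lam.1 i) (hy : ∀ i, y ≤ lam.1 i) (hν : ∀ i, x < ν.1 i) (hyx : y ≤ x) :
    phi t (adjoin ν x fun i => (hν i).le) (adjoin lam y hy) =
      (if y < x then 1 - t else 1) * phi t ν lam := by
  have hx : ∀ i, x ≤ ν.1 i := fun i => (hν i).le
  obtain ⟨M, -, hM⟩ := exists_inWindow (adjoin ν x hx)
  have hM' : InWindow (-M) M ν := fun i => by simpa using hM i.castSucc
  have hxM : x ∈ Finset.Ico (-M) M := by simpa using hM (Fin.last n)
  rw [phi_eq_prod t ((adjoin_interlaces_adjoin_iff (fun i => (hlam i).le) hy hx hyx).2 h) hM,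
    phi_eq_prod t h hM']
  -- only the factor of the site `x` is new
  have key : ∀ z : ℤ,
      (if dual (adjoin ν x hx) (z - 1) = dual (adjoin lam y hy) (z - 1) + 1 ∧
          dual (adjoin ν x hx) z = dual (adjoin lam y hy) z then
            1 - t ^ mult (adjoin ν x hx) z else 1) =
        (if z = x then (if y < x then 1 - t else 1) else 1) *
          (if dual ν (z - 1) = dual lam (z - 1) + 1 ∧ dual ν z = dual lam z then
            1 - t ^ mult ν z else 1) := by
    intro z
    rw [dual_adjoin, dual_adjoin, dual_adjoin, dual_adjoin, mult_adjoin]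
    rcases lt_trichotomy z x with hz | rfl | hz
    · rw [dual_eq_length ν z fun a => hz.trans (hν a),
        dual_eq_length lam z fun a => hz.trans (hlam a),
        dual_eq_length ν (z - 1) fun a => (sub_one_lt z).trans (hz.trans (hν a)),
        dual_eq_length lam (z - 1) fun a => (sub_one_lt z).trans (hz.trans (hlam a)),
        if_neg (show ¬ z = x by omega)]
      split_ifs <;> first | omega | simp
    · rw [dual_eq_length ν z hν, dual_eq_length lam z hlam,
        dual_eq_length ν (z - 1) fun a => (sub_one_lt z).trans (hν a),
        dual_eq_length lam (z - 1) fun a => (sub_one_lt z).trans (hlam a), mult_eq_zero ν z hν]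
      split_ifs <;> first | omega | simp
    · rw [if_neg (show ¬ z - 1 < x by omega), if_neg (show ¬ z < x by omega),
        if_neg (show ¬ x = z by omega), if_neg (show ¬ z = x by omega),
        if_neg (show ¬ z - 1 < y by omega), if_neg (show ¬ z < y by omega)]
      simp
  rw [Finset.prod_congr rfl fun z _ => key z, Finset.prod_mul_distrib, Finset.prod_ite_eq',
    if_pos hxM]

section Input

variable {t : ℝ} {V : ℤ} {μ ρ : Sig (n + 1)} {lam ν : Sig n} {r : ℕ}

theorem IsLow.le_nu (hV : IsLow V μ ν) (i : Fin n) : -V ≤ ν.1 i := (hV.2 i).le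

theorem IsLow.lt_lam (hV : IsLow V μ ν) (h : lam ≺ μ) (i : Fin n) : -V < lam.1 i :=
  h.lt_of_lt hV.1 i

theorem IsLow.le_lam (hV : IsLow V μ ν) (h : lam ≺ μ) (r : ℕ) (i : Fin n) :
    -V - r ≤ lam.1 i := by
  have := hV.lt_lam h i
  omega

theorem IsLow.lt_above (hV : IsLow V μ ν) (h : μ ≺ ρ) (i : Fin (n + 1)) : -V < ρ.1 i :=
  (hV.1 i).trans_le (h.coord_le i)

theorem Uin_eq_zero (hc : ¬ InputCond V r μ ρ lam ν) : Uin t V r μ ρ lam ν = 0 :=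
  dif_neg hc

theorem UinHat_eq_zero (hc : ¬ InputCond V r μ ρ lam ν) : UinHat t V r ν lam ρ μ = 0 :=
  dif_neg hc

theorem inputCond_of_Uin_ne_zero (h : Uin t V r μ ρ lam ν ≠ 0) : InputCond V r μ ρ lam ν := by
  by_contra hc
  exact h (Uin_eq_zero hc)

theorem inputCond_of_UinHat_ne_zero (h : UinHat t V r ν lam ρ μ ≠ 0) :
    InputCond V r μ ρ lam ν := by
  by_contra hc
  exact h (UinHat_eq_zero hc)

theorem Uin_nonneg (ht0 : 0 ≤ t) (ht1 : t < 1) : 0 ≤ Uin t V r μ ρ lam ν := by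
  unfold Uin
  split_ifs
  · exact U_nonneg ht0 ht1 _ _ _ _
  · exact le_rfl

theorem UinHat_nonneg (ht0 : 0 ≤ t) (ht1 : t < 1) : 0 ≤ UinHat t V r ν lam ρ μ := by
  unfold UinHat
  split_ifs
  · exact U_nonneg ht0 ht1 _ _ _ _
  · exact le_rfl

/-- Without the conditions on `ρ` both sides vanish, so the coefficients with input are those of
the signatures with the additional particle for all `ρ`. -/
theorem Uin_eq (hV : IsLow V μ ν) (hμ : lam ≺ μ) (hν : lam ≺ ν) (ρ : Sig (n + 1)) :
    Uin t V r μ ρ lam ν =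
      U t μ ρ (adjoin lam (-V - r) (hV.le_lam hμ r)) (adjoin ν (-V) hV.le_nu) := by
  by_cases hc : InputCond V r μ ρ lam ν
  · exact dif_pos hc
  · rw [Uin_eq_zero hc]
    by_contra hU
    obtain ⟨⟨-, -, h1, h2, h3⟩, -⟩ := square_of_U_ne_zero (Ne.symm hU)
    rw [size_adjoin, size_adjoin] at h3
    exact hc ⟨hV, hμ, h2, hν, (adjoin_interlaces_iff _ (hV.lt_above h2)).1 h1, by omega⟩

theorem stochastic_input (ht0 : 0 ≤ t) (ht1 : t < 1) (hV : IsLow V μ ν) (hμ : lam ≺ μ)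
    (hν : lam ≺ ν) (r : ℕ) :
    (Function.support fun ρ : Sig (n + 1) => Uin t V r μ ρ lam ν).Finite ∧
      ∑ᶠ ρ : Sig (n + 1), Uin t V r μ ρ lam ν = 1 := by
  simp only [Uin_eq hV hμ hν]
  refine stochastic ht0 ht1 ((adjoin_interlaces_iff _ fun i => ?_).2 hμ)
    ((adjoin_interlaces_adjoin_iff (fun i => (hV.lt_lam hμ i).le) _ _ (by omega)).2 hν)
  have := hV.1 i
  omega

/-- The input `r` and the signature of the remaining particles are read off from the signature
with the additional particle. -/
theorem stochastic_input_rev (ht0 : 0 ≤ t) (ht1 : t < 1) (hV : IsLow V μ ν) (hμ : μ ≺ ρ)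
    (hν : ν ≺ ρ) :
    (Function.support fun p : Sig n × ℕ => UinHat t V p.2 ν p.1 ρ μ).Finite ∧
      ∑ᶠ p : Sig n × ℕ, UinHat t V p.2 ν p.1 ρ μ = 1 := by
  obtain ⟨h1, h2⟩ := stochastic_rev ht0 ht1 hμ
    ((adjoin_interlaces_iff hV.le_nu (hV.lt_above hμ)).2 hν)
  set g : Sig (n + 1) → ℝ := fun κ =>
    U t (rev (adjoin ν (-V) hV.le_nu)) (rev κ) (rev ρ) (rev μ)
  set e : Sig (n + 1) → Sig n × ℕ := fun κ => (dropLast κ, (-V - κ.1 (Fin.last n)).toNat)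
  have hlast : ∀ κ ∈ Function.support g, κ.1 (Fin.last n) ≤ -V := by
    intro κ hκ
    obtain ⟨hs, -⟩ := square_rev_iff.1 (square_of_U_ne_zero hκ).1
    simpa using hs.coord_le (Fin.last n)
  have hval : ∀ κ ∈ Function.support g, g κ = UinHat t V (e κ).2 ν (e κ).1 ρ μ := by
    intro κ hκ
    obtain ⟨hs1, hs2, -, -, hs3⟩ := square_rev_iff.1 (square_of_U_ne_zero hκ).1
    have hl := hlast κ hκ
    have hr : -V - ((-V - κ.1 (Fin.last n)).toNat : ℤ) = κ.1 (Fin.last n) := by omega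
    have h3 : dropLast κ ≺ μ := by
      rw [← adjoin_interlaces_iff (last_le_dropLast κ) fun i => hl.trans_lt (hV.1 i),
        adjoin_dropLast]
      exact hs2
    have h4 : dropLast κ ≺ ν := by
      rw [← adjoin_interlaces_adjoin_iff (fun i => (hV.lt_lam h3 i).le) (last_le_dropLast κ)
        hV.le_nu hl, adjoin_dropLast]
      exact hs1
    have h5 : size κ = size (dropLast κ) + κ.1 (Fin.last n) := by
      rw [← size_adjoin _ _ (last_le_dropLast κ), adjoin_dropLast]
    rw [size_adjoin] at hs3
    have hc : InputCond V (e κ).2 μ ρ (e κ).1 ν := ⟨hV, h3, hμ, h4, hν, by simp only [e]; omega⟩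
    have h6 : adjoin (e κ).1 (-V - (e κ).2) hc.le_lam = κ := by
      conv_rhs => rw [← adjoin_dropLast κ]
      simp only [e, hr]
    rw [UinHat, dif_pos hc, h6]
  have hbij : Set.BijOn e (Function.support g)
      (Function.support fun p : Sig n × ℕ => UinHat t V p.2 ν p.1 ρ μ) := by
    refine ⟨fun κ hκ => ?_, fun κ hκ κ' hκ' he => ?_, fun p hp => ?_⟩
    · rw [Function.mem_support, ← hval κ hκ]
      exact hκ
    · have hl := hlast κ hκ
      have hl' := hlast κ' hκ'
      simp only [e, Prod.mk.injEq] at he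
      have h7 : κ.1 (Fin.last n) = κ'.1 (Fin.last n) := by omega
      rw [← adjoin_dropLast κ, ← adjoin_dropLast κ']
      simp only [he.1, h7]
    · have hc := inputCond_of_UinHat_ne_zero hp
      refine ⟨adjoin p.1 (-V - p.2) hc.le_lam, ?_, ?_⟩
      · rw [Function.mem_support, UinHat, dif_pos hc] at hp
        exact hp
      · simp only [e, dropLast_adjoin, adjoin_last]
        exact Prod.ext rfl (by simp)
  refine ⟨hbij.image_eq ▸ h1.image e, ?_⟩
  rw [← h2, ← finsum_mem_support, ← finsum_mem_support g]
  exact (finsum_mem_eq_of_bijOn e hbij hval).symm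

/-- The additional particle contributes a factor `1 - t` to `ψ` on both sides, and one more such
factor to `φ_{ν/lam}` if the input is not zero. -/
theorem flip_input (ht0 : 0 ≤ t) (ht1 : t < 1) (r : ℕ) (lam ν : Sig n) (μ ρ : Sig (n + 1)) :
    inputFactor t r * (phi t ν lam * psi t μ lam) * Uin t V r μ ρ lam ν =
      psi t ρ ν * phi t ρ μ * UinHat t V r ν lam ρ μ := by
  by_cases hc : InputCond V r μ ρ lam ν
  · have hflip := flip ht0 ht1 (adjoin lam (-V - r) hc.le_lam) μ (adjoin ν (-V) hc.le_nu) ρ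
    rw [Uin, UinHat, dif_pos hc, dif_pos hc]
    obtain ⟨hV, hμ, hμρ, hν, hνρ, -⟩ := id hc
    rw [phi_adjoin_adjoin t hν (hV.lt_lam hμ) _ hV.2 (by omega),
      psi_adjoin t hμ _ (fun i => by have := hV.1 i; omega),
      psi_adjoin t hνρ _ (hV.lt_above hμρ)] at hflip
    have hr : (if -V - (r : ℤ) < -V then 1 - t else 1) = inputFactor t r := by
      unfold inputFactor
      exact if_congr (by omega) rfl rfl
    rw [hr] at hflip
    refine mul_left_cancel₀ (sub_pos.2 ht1).ne' ?_
    linear_combination hflip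
  · rw [Uin_eq_zero hc, UinHat_eq_zero hc, mul_zero, mul_zero]

theorem mem_above_of_Uin_ne_zero {k l : ℤ} (hlam : lam ∈ Below n μ ν (k - r) (l - r))
    (h : Uin t V r μ ρ lam ν ≠ 0) : ρ ∈ Above (n + 1) μ ν k l := by
  obtain ⟨-, -, h1, -, h2, h3⟩ := inputCond_of_Uin_ne_zero h
  obtain ⟨-, -, h4, h5⟩ := hlam
  exact ⟨h1, h2, by omega, by omega⟩

theorem mem_below_of_UinHat_ne_zero {k l : ℤ} (hρ : ρ ∈ Above (n + 1) μ ν k l)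
    (h : UinHat t V r ν lam ρ μ ≠ 0) : lam ∈ Below n μ ν (k - r) (l - r) := by
  obtain ⟨-, h1, -, h2, -, h3⟩ := inputCond_of_UinHat_ne_zero h
  obtain ⟨-, -, h4, h5⟩ := hρ
  exact ⟨h1, h2, by omega, by omega⟩

theorem finsum_mem_Uin :
    ∑ᶠ ρ ∈ {ρ : Sig (n + 1) | μ ≺ ρ ∧ ν ≺ ρ ∧ size ρ - size μ = size ν - size lam + r},
      Uin t V r μ ρ lam ν = ∑ᶠ ρ : Sig (n + 1), Uin t V r μ ρ lam ν := by
  rw [finsum_mem_def]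
  refine finsum_congr fun ρ => ?_
  refine Set.indicator_apply_eq_self.2 fun h => ?_
  by_contra hU
  obtain ⟨-, -, h1, -, h2, h3⟩ := inputCond_of_Uin_ne_zero hU
  exact h ⟨h1, h2, h3⟩

end Input

end HallLittlewood

/-! ### Cauchy identities with input -/

namespace HallLittlewood

variable {n : ℕ}

theorem finite_below_input (μ : Sig (n + 1)) (ν : Sig n) (k l : ℤ) :
    {p : Sig n × ℕ | p.1 ∈ Below n μ ν (k - p.2) (l - p.2)}.Finite := by
  have h : {κ : Sig n | ∀ i, ν.1 i - l ≤ κ.1 i ∧ κ.1 i ≤ ν.1 i}.Finite := finite_sig_Icc _ _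
  refine (h.prod (Set.finite_Iic l.toNat)).subset ?_
  rintro ⟨lam, r⟩ ⟨-, h1, -, h2⟩
  dsimp only at h1 h2
  have h3 := h1.size_le
  refine ⟨fun i => ⟨?_, h1.coord_le i⟩, ?_⟩
  · have := h1.coord_ge i
    dsimp only
    omega
  · simp only [Set.mem_Iic]
    omega

theorem finite_below_both (μ : Sig (n + 1)) (ν : Sig n) :
    {lam : Sig n | lam ≺ μ ∧ lam ≺ ν}.Finite := by
  obtain ⟨M, -, hM⟩ := exists_inWindow μ
  refine (finite_sig_Icc (fun _ => -M) ν.1).subset ?_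
  rintro lam ⟨h1, h2⟩ i
  have := h1.lt_of_lt (x := -M - 1) (fun i => by have := (hM i).1; omega) i
  exact ⟨by omega, h2.coord_le i⟩

theorem cauchy_input {t : ℝ} (ht0 : 0 ≤ t) (ht1 : t < 1) {μ : Sig (n + 1)} {ν : Sig n} {V : ℤ}
    (hV : IsLow V μ ν) (k l : ℤ) :
    ∑ᶠ r : ℕ, inputFactor t r *
        ∑ᶠ lam ∈ Below n μ ν (k - r) (l - r), phi t ν lam * psi t μ lam =
      ∑ᶠ ρ ∈ Above (n + 1) μ ν k l, psi t ρ ν * phi t ρ μ ∧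
    ∑ᶠ r : ℕ, inputFactor t r *
        ∑ᶠ lam ∈ Below n μ ν (k - r) (l - r), phi t ν lam * psi t μ lam =
      ∑ᶠ r : ℕ, inputFactor t r *
        ∑ᶠ lam ∈ Below n μ ν (k - r) (l - r), phi t ν lam * psi t μ lam *
          ∑ᶠ ρ : Sig (n + 1), Uin t V r μ ρ lam ν ∧
    ∑ᶠ r : ℕ, inputFactor t r *
        ∑ᶠ lam ∈ Below n μ ν (k - r) (l - r), phi t ν lam * psi t μ lam *
          ∑ᶠ ρ : Sig (n + 1), Uin t V r μ ρ lam ν =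
      ∑ᶠ ρ ∈ Above (n + 1) μ ν k l, psi t ρ ν * phi t ρ μ *
        ∑ᶠ p : Sig n × ℕ, UinHat t V p.2 ν p.1 ρ μ ∧
    ∑ᶠ ρ ∈ Above (n + 1) μ ν k l, psi t ρ ν * phi t ρ μ *
        ∑ᶠ p : Sig n × ℕ, UinHat t V p.2 ν p.1 ρ μ =
      ∑ᶠ ρ ∈ Above (n + 1) μ ν k l, psi t ρ ν * phi t ρ μ := by
  have hfin := finite_below_input μ ν k l
  rw [finsum_mul_finsum_mem (fun p => Iff.rfl) hfin (inputFactor t)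
      fun lam _ => phi t ν lam * psi t μ lam,
    finsum_mul_finsum_mem (fun p => Iff.rfl) hfin (inputFactor t)
      fun lam r => phi t ν lam * psi t μ lam * ∑ᶠ ρ : Sig (n + 1), Uin t V r μ ρ lam ν]
  simp only [← mul_assoc]
  refine weighted_bijection hfin (finite_above μ ν k l)
    (fun p => inputFactor t p.2 * phi t ν p.1 * psi t μ p.1) (fun ρ => psi t ρ ν * phi t ρ μ)
    (fun p ρ => Uin t V p.2 μ ρ p.1 ν) (fun p ρ => UinHat t V p.2 ν p.1 ρ μ) ?_ ?_ ?_ ?_ ?_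
  · exact fun p hp => (stochastic_input ht0 ht1 hV hp.1 hp.2.1 p.2).2
  · exact fun ρ hρ => (stochastic_input_rev ht0 ht1 hV hρ.1 hρ.2.1).2
  · intro p ρ
    rw [mul_assoc (inputFactor t p.2)]
    exact flip_input ht0 ht1 p.2 p.1 ν μ ρ
  · exact fun p hp ρ => mem_above_of_Uin_ne_zero hp
  · exact fun ρ hρ p => mem_below_of_UinHat_ne_zero hρ

/-! ### Convergence of the generating functions -/

/-- The weighted bijection for infinite families: if `f a P(a, ·)` and `g b Q(·, b)` agree, where
`P` and `Q` have total mass `1`, and `f` is summable, then `g` has the same sum. -/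
theorem hasSum_of_weighted_bijection {α β : Type*} {f : α → ℝ} {g : β → ℝ} {P Q : α → β → ℝ}
    (hP0 : ∀ a b, 0 ≤ P a b) (hP : ∀ a, f a ≠ 0 → HasSum (P a) 1)
    (hQ : ∀ b, g b ≠ 0 → HasSum (fun a => Q a b) 1)
    (heq : ∀ a b, f a * P a b = g b * Q a b) (hf : Summable f) : HasSum g (∑' a, f a) := by
  have hrow : ∀ a, HasSum (fun b => f a * P a b) (f a) := by
    intro a
    by_cases ha : f a = 0
    · simp only [ha, zero_mul]
      exact hasSum_zero
    · simpa using (hP a ha).mul_left (f a)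
  have hcol : ∀ b, HasSum (fun a => f a * P a b) (g b) := by
    intro b
    simp only [heq]
    by_cases hb : g b = 0
    · simp only [hb, zero_mul]
      exact hasSum_zero
    · simpa using (hQ b hb).mul_left (g b)
  have habs : ∀ a, HasSum (fun b => |f a * P a b|) |f a| := by
    intro a
    simp only [abs_mul, abs_of_nonneg (hP0 a _)]
    by_cases ha : f a = 0
    · simp only [ha, abs_zero, zero_mul]
      exact hasSum_zero
    · simpa using (hP a ha).mul_left |f a|
  have hsum : Summable fun p : α × β => f p.1 * P p.1 p.2 := by
    refine Summable.of_abs ((summable_prod_of_nonneg fun p => abs_nonneg _).2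
      ⟨fun a => (habs a).summable, ?_⟩)
    simp only [fun a => (habs a).tsum_eq]
    exact hf.abs
  obtain ⟨S, hS⟩ := hsum
  have h1 : HasSum f S := hS.prod_fiberwise hrow
  rw [h1.tsum_eq]
  exact ((Equiv.prodComm β α).hasSum_iff.2 hS).prod_fiberwise hcol

theorem hasSum_of_finite_support {α : Type*} {f : α → ℝ} (h : (Function.support f).Finite) :
    HasSum f (∑ᶠ a, f a) := by
  rw [finsum_eq_sum f h]
  exact hasSum_sum_of_ne_finset_zero fun a ha => by simpa using ha

theorem psi_eq_zero {M N : ℕ} (t : ℝ) {μ : Sig N} {lam : Sig M} (h : ¬ lam ≺ μ) :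
    psi t μ lam = 0 :=
  if_neg h

theorem phi_eq_zero {M N : ℕ} (t : ℝ) {μ : Sig N} {lam : Sig M} (h : ¬ lam ≺ μ) :
    phi t μ lam = 0 :=
  if_neg h

theorem inputFactor_abs_le {t : ℝ} (ht0 : 0 ≤ t) (ht1 : t < 1) (r : ℕ) : |inputFactor t r| ≤ 1 := by
  unfold inputFactor
  split_ifs
  · rw [abs_of_pos (sub_pos.2 ht1)]
    linarith
  · simp

/-- The weight of the term with the signature `p.1` and the input `p.2`. -/
noncomputable def inputTerm (t x y : ℝ) (μ : Sig (n + 1)) (ν : Sig n) (p : Sig n × ℕ) : ℝ :=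
  inputFactor t p.2 * (x * y) ^ p.2 *
    (phi t ν p.1 * psi t μ p.1 * x ^ (size μ - size p.1) * y ^ (size ν - size p.1))

theorem interlaces_of_inputTerm_ne_zero {t x y : ℝ} {μ : Sig (n + 1)} {ν : Sig n}
    {p : Sig n × ℕ} (h : inputTerm t x y μ ν p ≠ 0) : p.1 ≺ μ ∧ p.1 ≺ ν := by
  constructor <;> by_contra hc <;> refine h ?_ <;> unfold inputTerm
  · rw [psi_eq_zero t hc]
    ring
  · rw [phi_eq_zero t hc]
    ring

theorem summable_inputTerm {t x y : ℝ} (ht0 : 0 ≤ t) (ht1 : t < 1) (hxy : |x * y| < 1)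
    (μ : Sig (n + 1)) (ν : Sig n) : Summable (inputTerm t x y μ ν) := by
  have h1 : Summable fun r : ℕ => |inputFactor t r * (x * y) ^ r| := by
    refine Summable.of_nonneg_of_le (fun _ => abs_nonneg _) (fun r => ?_)
      (summable_geometric_of_lt_one (abs_nonneg _) hxy)
    rw [abs_mul, abs_pow]
    exact mul_le_of_le_one_left (by positivity) (inputFactor_abs_le ht0 ht1 r)
  have h2 : Summable fun lam : Sig n =>
      |phi t ν lam * psi t μ lam * x ^ (size μ - size lam) * y ^ (size ν - size lam)| := by
    refine summable_of_hasFiniteSupport ((finite_below_both μ ν).subset fun lam h => ?_)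
    constructor <;> by_contra hc <;> refine h ?_
    · simp [psi_eq_zero t hc]
    · simp [phi_eq_zero t hc]
  refine Summable.of_abs ?_
  have h3 := h2.mul_of_nonneg h1 (fun _ => abs_nonneg _) (fun _ => abs_nonneg _)
  refine h3.congr fun p => ?_
  rw [inputTerm, ← abs_mul, mul_comm]

/-- The flip property with the powers of `x` and `y` attached: the sizes match whenever the
coefficients do not vanish. -/
theorem inputTerm_mul_Uin {t x y : ℝ} (ht0 : 0 ≤ t) (ht1 : t < 1) (hx : x ≠ 0) (hy : y ≠ 0)
    {V : ℤ} (μ ρ : Sig (n + 1)) (ν : Sig n) (p : Sig n × ℕ) :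
    inputTerm t x y μ ν p * Uin t V p.2 μ ρ p.1 ν =
      psi t ρ ν * phi t ρ μ * x ^ (size ρ - size ν) * y ^ (size ρ - size μ) *
        UinHat t V p.2 ν p.1 ρ μ := by
  by_cases hc : InputCond V p.2 μ ρ p.1 ν
  · have hflip := flip_input ht0 ht1 (V := V) p.2 p.1 ν μ ρ
    obtain ⟨-, -, -, -, -, hs⟩ := id hc
    have ex : x ^ (size ρ - size ν) = x ^ p.2 * x ^ (size μ - size p.1) := by
      rw [← zpow_natCast, ← zpow_add₀ hx]
      congr 1
      omega
    have ey : y ^ (size ρ - size μ) = y ^ p.2 * y ^ (size ν - size p.1) := by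
      rw [← zpow_natCast, ← zpow_add₀ hy]
      congr 1
      omega
    rw [inputTerm, ex, ey, mul_pow]
    linear_combination
      x ^ p.2 * y ^ p.2 * x ^ (size μ - size p.1) * y ^ (size ν - size p.1) * hflip
  · rw [Uin_eq_zero hc, UinHat_eq_zero hc, mul_zero, mul_zero]

theorem hasSum_cauchy_input {t x y : ℝ} (ht0 : 0 ≤ t) (ht1 : t < 1) (hx : x ≠ 0) (hy : y ≠ 0)
    (hxy : |x * y| < 1) {μ : Sig (n + 1)} {ν : Sig n} {V : ℤ} (hV : IsLow V μ ν) :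
    HasSum (fun ρ : {ρ : Sig (n + 1) // μ ≺ ρ ∧ ν ≺ ρ} =>
      psi t ρ.1 ν * phi t ρ.1 μ * x ^ (size ρ.1 - size ν) * y ^ (size ρ.1 - size μ))
      (∑' p, inputTerm t x y μ ν p) := by
  have hsupp : ∀ ρ : Sig (n + 1),
      psi t ρ ν * phi t ρ μ * x ^ (size ρ - size ν) * y ^ (size ρ - size μ) ≠ 0 →
        μ ≺ ρ ∧ ν ≺ ρ := by
    intro ρ h
    constructor <;> by_contra hc <;> refine h ?_
    · simp [phi_eq_zero t hc]
    · simp [psi_eq_zero t hc]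
  refine (hasSum_subtype_iff_of_support_subset (s := {ρ : Sig (n + 1) | μ ≺ ρ ∧ ν ≺ ρ})
    (f := fun ρ : Sig (n + 1) =>
      psi t ρ ν * phi t ρ μ * x ^ (size ρ - size ν) * y ^ (size ρ - size μ)) hsupp).2 ?_
  refine hasSum_of_weighted_bijection (P := fun p ρ => Uin t V p.2 μ ρ p.1 ν)
    (Q := fun p ρ => UinHat t V p.2 ν p.1 ρ μ) (fun _ _ => Uin_nonneg ht0 ht1) ?_ ?_
    (fun p ρ => inputTerm_mul_Uin ht0 ht1 hx hy μ ρ ν p) (summable_inputTerm ht0 ht1 hxy μ ν)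
  · intro p hp
    obtain ⟨h1, h2⟩ := interlaces_of_inputTerm_ne_zero hp
    obtain ⟨h3, h4⟩ := stochastic_input ht0 ht1 hV h1 h2 p.2
    exact h4 ▸ hasSum_of_finite_support h3
  · intro ρ hρ
    obtain ⟨h1, h2⟩ := hsupp ρ hρ
    obtain ⟨h3, h4⟩ := stochastic_input_rev ht0 ht1 hV h1 h2
    exact h4 ▸ hasSum_of_finite_support h3

theorem hasSum_input {t x y : ℝ} (ht0 : 0 ≤ t) (ht1 : t < 1) (hxy : |x * y| < 1)
    {μ : Sig (n + 1)} {ν : Sig n} {V : ℤ} (hV : IsLow V μ ν) :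
    HasSum (fun r : ℕ => inputFactor t r * (x * y) ^ r *
      ∑ᶠ lam ∈ {lam : Sig n | lam ≺ μ ∧ lam ≺ ν},
        phi t ν lam * psi t μ lam * x ^ (size μ - size lam) * y ^ (size ν - size lam) *
          ∑ᶠ ρ ∈ {ρ : Sig (n + 1) | μ ≺ ρ ∧ ν ≺ ρ ∧
            size ρ - size μ = size ν - size lam + r}, Uin t V r μ ρ lam ν)
      (∑' p, inputTerm t x y μ ν p) := by
  have hS := (summable_inputTerm ht0 ht1 hxy μ ν).hasSum
  refine ((Equiv.prodComm ℕ (Sig n)).hasSum_iff.2 hS).prod_fiberwise fun r => ?_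
  have hfin : (Function.support fun lam : Sig n => inputTerm t x y μ ν (lam, r)).Finite :=
    (finite_below_both μ ν).subset fun lam h => interlaces_of_inputTerm_ne_zero h
  have heq : ∑ᶠ lam, inputTerm t x y μ ν (lam, r) = inputFactor t r * (x * y) ^ r *
      ∑ᶠ lam ∈ {lam : Sig n | lam ≺ μ ∧ lam ≺ ν},
        phi t ν lam * psi t μ lam * x ^ (size μ - size lam) * y ^ (size ν - size lam) *
          ∑ᶠ ρ ∈ {ρ : Sig (n + 1) | μ ≺ ρ ∧ ν ≺ ρ ∧
            size ρ - size μ = size ν - size lam + r}, Uin t V r μ ρ lam ν := by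
    rw [mul_finsum_mem, finsum_mem_def]
    refine finsum_congr fun lam => ?_
    by_cases h : lam ≺ μ ∧ lam ≺ ν
    · rw [Set.indicator_of_mem (show lam ∈ {lam : Sig n | lam ≺ μ ∧ lam ≺ ν} from h),
        finsum_mem_Uin, (stochastic_input ht0 ht1 hV h.1 h.2 r).2, mul_one, inputTerm]
    · rw [Set.indicator_of_notMem (show lam ∉ {lam : Sig n | lam ≺ μ ∧ lam ≺ ν} from h)]
      by_contra hc
      exact h (interlaces_of_inputTerm_ne_zero hc)
  exact heq ▸ hasSum_of_finite_support hfin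

end HallLittlewood

theorem mainTheorem4 (t : ℝ) (ht0 : 0 ≤ t) (ht1 : t < 1) :
    -- all four signatures of the same length `N`
    (∀ N : ℕ,
      -- the algorithm is stochastic
      (∀ lam μ ν : Sig N, lam ≺ μ → lam ≺ ν →
        (∀ ρ : Sig N, 0 ≤ U t μ ρ lam ν) ∧
        (Function.support fun ρ : Sig N => U t μ ρ lam ν).Finite ∧
        ∑ᶠ ρ : Sig N, U t μ ρ lam ν = 1) ∧
      -- the inverse algorithm is stochastic
      (∀ μ ν ρ : Sig N, μ ≺ ρ → ν ≺ ρ →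
        (∀ lam : Sig N, 0 ≤ U t (rev ν) (rev lam) (rev ρ) (rev μ)) ∧
        (Function.support fun lam : Sig N => U t (rev ν) (rev lam) (rev ρ) (rev μ)).Finite ∧
        ∑ᶠ lam : Sig N, U t (rev ν) (rev lam) (rev ρ) (rev μ) = 1) ∧
      -- the flip property: equality of the individual terms of the two double sums below
      (∀ lam μ ν ρ : Sig N,
        phi t ν lam * psi t μ lam * U t μ ρ lam ν =
          psi t ρ ν * phi t ρ μ * U t (rev ν) (rev lam) (rev ρ) (rev μ)) ∧
      -- the nonzero terms of the two double sums below have the same indices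
      (∀ (μ ν : Sig N) (k l : ℤ) (lam ρ : Sig N),
        (lam ∈ Below N μ ν k l → U t μ ρ lam ν ≠ 0 → ρ ∈ Above N μ ν k l) ∧
        (ρ ∈ Above N μ ν k l → U t (rev ν) (rev lam) (rev ρ) (rev μ) ≠ 0 →
          lam ∈ Below N μ ν k l)) ∧
      -- the Cauchy identity and its bijective proof
      (∀ (μ ν : Sig N) (k l : ℤ),
        (Below N μ ν k l).Finite ∧ (Above N μ ν k l).Finite ∧
        ∑ᶠ lam ∈ Below N μ ν k l, phi t ν lam * psi t μ lam =
          ∑ᶠ ρ ∈ Above N μ ν k l, psi t ρ ν * phi t ρ μ ∧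
        ∑ᶠ lam ∈ Below N μ ν k l, phi t ν lam * psi t μ lam =
          ∑ᶠ lam ∈ Below N μ ν k l, phi t ν lam * psi t μ lam * ∑ᶠ ρ : Sig N, U t μ ρ lam ν ∧
        ∑ᶠ lam ∈ Below N μ ν k l, phi t ν lam * psi t μ lam * ∑ᶠ ρ : Sig N, U t μ ρ lam ν =
          ∑ᶠ ρ ∈ Above N μ ν k l, psi t ρ ν * phi t ρ μ *
            ∑ᶠ lam : Sig N, U t (rev ν) (rev lam) (rev ρ) (rev μ) ∧
        ∑ᶠ ρ ∈ Above N μ ν k l, psi t ρ ν * phi t ρ μ *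
            ∑ᶠ lam : Sig N, U t (rev ν) (rev lam) (rev ρ) (rev μ) =
          ∑ᶠ ρ ∈ Above N μ ν k l, psi t ρ ν * phi t ρ μ)) ∧
    -- `lam` and `ν` of length `n = N - 1`, `μ` and `ρ` of length `n + 1 = N`, with input `r`
    (∀ (n : ℕ) (μ : Sig (n + 1)) (ν : Sig n) (V : ℤ), IsLow V μ ν →
      (∀ (lam : Sig n) (r : ℕ), lam ≺ μ → lam ≺ ν →
        (∀ ρ : Sig (n + 1), 0 ≤ Uin t V r μ ρ lam ν) ∧
        (Function.support fun ρ : Sig (n + 1) => Uin t V r μ ρ lam ν).Finite ∧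
        ∑ᶠ ρ : Sig (n + 1), Uin t V r μ ρ lam ν = 1) ∧
      (∀ ρ : Sig (n + 1), μ ≺ ρ → ν ≺ ρ →
        (∀ (lam : Sig n) (r : ℕ), 0 ≤ UinHat t V r ν lam ρ μ) ∧
        (Function.support fun p : Sig n × ℕ => UinHat t V p.2 ν p.1 ρ μ).Finite ∧
        ∑ᶠ p : Sig n × ℕ, UinHat t V p.2 ν p.1 ρ μ = 1) ∧
      (∀ (lam : Sig n) (ρ : Sig (n + 1)) (r : ℕ),
        inputFactor t r * (phi t ν lam * psi t μ lam) * Uin t V r μ ρ lam ν =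
          psi t ρ ν * phi t ρ μ * UinHat t V r ν lam ρ μ) ∧
      (∀ (k l : ℤ) (lam : Sig n) (ρ : Sig (n + 1)) (r : ℕ),
        (lam ∈ Below n μ ν (k - r) (l - r) → Uin t V r μ ρ lam ν ≠ 0 →
          ρ ∈ Above (n + 1) μ ν k l) ∧
        (ρ ∈ Above (n + 1) μ ν k l → UinHat t V r ν lam ρ μ ≠ 0 →
          lam ∈ Below n μ ν (k - r) (l - r))) ∧
      (∀ k l : ℤ,
        {p : ℕ × Sig n | p.2 ∈ Below n μ ν (k - p.1) (l - p.1)}.Finite ∧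
        (Above (n + 1) μ ν k l).Finite ∧
        ∑ᶠ r : ℕ, inputFactor t r *
            ∑ᶠ lam ∈ Below n μ ν (k - r) (l - r), phi t ν lam * psi t μ lam =
          ∑ᶠ ρ ∈ Above (n + 1) μ ν k l, psi t ρ ν * phi t ρ μ ∧
        ∑ᶠ r : ℕ, inputFactor t r *
            ∑ᶠ lam ∈ Below n μ ν (k - r) (l - r), phi t ν lam * psi t μ lam =
          ∑ᶠ r : ℕ, inputFactor t r *
            ∑ᶠ lam ∈ Below n μ ν (k - r) (l - r), phi t ν lam * psi t μ lam *
              ∑ᶠ ρ : Sig (n + 1), Uin t V r μ ρ lam ν ∧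
        ∑ᶠ r : ℕ, inputFactor t r *
            ∑ᶠ lam ∈ Below n μ ν (k - r) (l - r), phi t ν lam * psi t μ lam *
              ∑ᶠ ρ : Sig (n + 1), Uin t V r μ ρ lam ν =
          ∑ᶠ ρ ∈ Above (n + 1) μ ν k l, psi t ρ ν * phi t ρ μ *
            ∑ᶠ p : Sig n × ℕ, UinHat t V p.2 ν p.1 ρ μ ∧
        ∑ᶠ ρ ∈ Above (n + 1) μ ν k l, psi t ρ ν * phi t ρ μ *
            ∑ᶠ p : Sig n × ℕ, UinHat t V p.2 ν p.1 ρ μ =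
          ∑ᶠ ρ ∈ Above (n + 1) μ ν k l, psi t ρ ν * phi t ρ μ ∧
        -- the identity summed over `k` and `l`, for formal `x` and `y`: the coefficients
        -- of `x ^ k * y ^ l` on its two sides
        ∑ᶠ ρ ∈ Above (n + 1) μ ν k l, psi t ρ ν * phi t ρ μ =
          ∑ᶠ r : ℕ, inputFactor t r *
            ∑ᶠ lam ∈ Below n μ ν (k - r) (l - r), phi t ν lam * psi t μ lam *
              ∑ᶠ ρ ∈ {ρ : Sig (n + 1) | μ ≺ ρ ∧ ν ≺ ρ ∧
                size ρ - size μ = size ν - size lam + r}, Uin t V r μ ρ lam ν) ∧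
      -- the same identity for numbers `x` and `y`, with convergence of both sides
      (∀ x y : ℝ, x ≠ 0 → y ≠ 0 → |x * y| < 1 →
        {lam : Sig n | lam ≺ μ ∧ lam ≺ ν}.Finite ∧
        ∃ S : ℝ,
          HasSum (fun ρ : {ρ : Sig (n + 1) // μ ≺ ρ ∧ ν ≺ ρ} =>
            psi t ρ.1 ν * phi t ρ.1 μ *
              x ^ (size ρ.1 - size ν) * y ^ (size ρ.1 - size μ)) S ∧
          HasSum (fun r : ℕ => inputFactor t r * (x * y) ^ r *
            ∑ᶠ lam ∈ {lam : Sig n | lam ≺ μ ∧ lam ≺ ν},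
              phi t ν lam * psi t μ lam *
                x ^ (size μ - size lam) * y ^ (size ν - size lam) *
              ∑ᶠ ρ ∈ {ρ : Sig (n + 1) | μ ≺ ρ ∧ ν ≺ ρ ∧
                size ρ - size μ = size ν - size lam + r}, Uin t V r μ ρ lam ν) S)) := by
  refine ⟨fun N => ⟨fun lam μ ν hμ hν => ⟨fun ρ => U_nonneg ht0 ht1 _ _ _ _,
      stochastic ht0 ht1 hμ hν⟩,
    fun μ ν ρ hμ hν => ⟨fun lam => U_nonneg ht0 ht1 _ _ _ _, stochastic_rev ht0 ht1 hμ hν⟩,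
    fun lam μ ν ρ => flip ht0 ht1 lam μ ν ρ,
    fun μ ν k l lam ρ => ⟨mem_above_of_U_ne_zero, mem_below_of_U_rev_ne_zero⟩,
    fun μ ν k l => ⟨finite_below μ ν k l, finite_above μ ν k l, ?_⟩⟩,
    fun n μ ν V hV => ⟨fun lam r hμ hν => ⟨fun ρ => Uin_nonneg ht0 ht1,
      stochastic_input ht0 ht1 hV hμ hν r⟩,
    fun ρ hμ hν => ⟨fun lam r => UinHat_nonneg ht0 ht1,
      stochastic_input_rev ht0 ht1 hV hμ hν⟩,
    fun lam ρ r => flip_input ht0 ht1 r lam ν μ ρ,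
    fun k l lam ρ r => ⟨mem_above_of_Uin_ne_zero, mem_below_of_UinHat_ne_zero⟩,
    fun k l => ?_, fun x y hx hy hxy => ⟨finite_below_both μ ν, _,
      hasSum_cauchy_input ht0 ht1 hx hy hxy hV, hasSum_input ht0 ht1 hxy hV⟩⟩⟩
  · exact weighted_bijection (finite_below μ ν k l) (finite_above μ ν k l) _ _
      (fun lam ρ => U t μ ρ lam ν) (fun lam ρ => U t (rev ν) (rev lam) (rev ρ) (rev μ))
      (fun lam h => (stochastic ht0 ht1 h.1 h.2.1).2)
      (fun ρ h => (stochastic_rev ht0 ht1 h.1 h.2.1).2) (fun lam ρ => flip ht0 ht1 lam μ ν ρ)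
      (fun lam h ρ => mem_above_of_U_ne_zero h) (fun ρ h lam => mem_below_of_U_rev_ne_zero h)
  · obtain ⟨h1, h2, h3, h4⟩ := cauchy_input ht0 ht1 hV k l
    refine ⟨(finite_below_input μ ν k l).preimage (Equiv.prodComm ℕ (Sig n)).injective.injOn,
      finite_above μ ν k l, h1, h2, h3, h4, ?_⟩
    simp only [finsum_mem_Uin]
    exact h1.symm.trans h2
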